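/- Let $M$ be a smooth (finite-dimensional, Hausdorff, second countable, boundaryless) manifold, let $\mathbb E=\mathbb R^k$ with canonical basis $e_1,\dots,e_k$, and let $\Lambda$ be a compact topological space. A *CC-bundle structure* on $M$ is a pair $(f,N)$, where $f:M\times\mathbb E\to TM$ is a smooth morphism of bundles over the identity of $M$ (so each $f(p,\cdot):\mathbb E\to T_pM$ is linear) and $N:M\times\mathbb E\to[0,\infty)$ is continuous with $N(p,\cdot)$ a norm for every $p\in M$. Its Carnot–Carathéodory distance is $$d_{(f,N)}(p,q)=\inf\Big\{\operatorname*{ess\,sup}_{t\in[0,1]}N(\gamma(t),u(t))\Big\}\in[0,\infty],$$ where the infimum is over all $u\in L^\infty([0,1];\mathbb E)$ for which the Cauchy problem $\gamma'(t)=f(\gamma(t),u(t))$ for a.e. $t$, $\gamma(0)=p$, has an absolutely continuous solution $\gamma:[0,1]\to M$, with $\gamma(1)=q$ (and $\inf\emptyset=\infty$). Let $(f_\lambda,N_\lambda)_{\lambda\in\Lambda}$ be a *continuously varying CC-bundle structure* on $M$: each $(f_\lambda,N_\lambda)$ is a CC-bundle structure; in coordinates around every point of $M$, all partial derivatives in $q$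 of order at most two of $X^i_\lambda(q)=f_\lambda(q,e_i)$ are continuous in $(\lambda,q)$ for $i=1,\dots,k$; and $N:\Lambda\times M\times\mathbb E\to[0,\infty)$ and $f:\Lambda\times M\times\mathbb E\to TM$ are continuous. Write $d_\lambda=d_{(f_\lambda,N_\lambda)}$. Let $\lambda_0\in\Lambda$ be such that $X^1_{\lambda_0},\dots,X^k_{\lambda_0}$ are bracket-generating (at each point $p$, the vector fields of the Lie algebra they generate span $T_pM$), and suppose that $(M,d_{\lambda_0})$ is boundedly compact, i.e. every $d_{\lambda_0}$-closed set of finite $d_{\lambda_0}$-diameter is compact in the topology of $d_{\lambda_0}$. Then $d_\lambda\to d_{\lambda_0}$ uniformly on compact sets of $M$ as $\lambda\to\lambda_0$: for every compact $K\subseteq M$ and every $\varepsilon>0$ there is a neighbourhood $I$ of $\lambda_0$ in $\Lambda$ such that, for all $\lambda\in I$ and all $p,q\in K$, $$d_\lambda(p,q)\le d_{\lambda_0}(p,q)+\varepsilon\quad\text{and}\quad d_{\lambda_0}(p,q)\le d_\lambda(p,q)+\varepsilon .$$ (If $M$ is connected then $d_{\lambda_0}$ is finite, and this reads $|d_\lambda(p,q)-d_{\lambda_0}(p,q)|\le\varepsilon$.)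 -/

import Mathlib

open Set Filter Topology MeasureTheory
open scoped ENNReal NNReal Manifold ContDiff

/-- The control space `ℝ^k`. -/
abbrev CtrlSpace (k : ℕ) : Type := EuclideanSpace ℝ (Fin k)

/-- The function `n` is a norm on the real vector space `E`. -/
structure IsNormFun {E : Type*} [AddCommGroup E] [Module ℝ E] (n : E → ℝ) : Prop where
  nonneg : ∀ v, 0 ≤ n v
  eq_zero_iff : ∀ v, n v = 0 ↔ v = 0
  smul : ∀ (c : ℝ) (v : E), n (c • v) = |c| * n v
  add_le : ∀ v w : E, n (v + w) ≤ n v + n w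

section CCStructures

variable {V : Type*} [NormedAddCommGroup V] [NormedSpace ℝ V]
  {M : Type*} [TopologicalSpace M] [ChartedSpace V M]

/-- A CC-bundle structure `(f, N)` on `M` modelled on `ℝ^k`: a smooth bundle morphism
`f : M × ℝ^k → TM` over the identity of `M` together with a continuous function
`N : M × ℝ^k → [0, ∞)` that is a norm on each fibre. -/
structure IsCCBundleStructure [IsManifold 𝓘(ℝ, V) ∞ M] {k : ℕ}
    (f : (p : M) → CtrlSpace k →L[ℝ] TangentSpace 𝓘(ℝ, V) p)
    (N : M → CtrlSpace k → ℝ) : Prop where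
  smooth : ContMDiff (𝓘(ℝ, V).prod 𝓘(ℝ, CtrlSpace k)) 𝓘(ℝ, V).tangent ∞
    (fun x : M × CtrlSpace k => (⟨x.1, f x.1 x.2⟩ : TangentBundle 𝓘(ℝ, V) M))
  continuous_norm : Continuous (fun x : M × CtrlSpace k => N x.1 x.2)
  isNorm : ∀ p, IsNormFun (N p)

/-- The vector field `X` read in the chart around `x₀`, as a map `V → V`
(meaningful on the target of the chart). -/
noncomputable def vectorFieldInChart (x₀ : M) (X : (p : M) → TangentSpace 𝓘(ℝ, V) p) (y : V) : V :=
  mfderiv 𝓘(ℝ, V) 𝓘(ℝ, V) (extChartAt 𝓘(ℝ, V) x₀) ((extChartAt 𝓘(ℝ, V) x₀).symm y)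
    (X ((extChartAt 𝓘(ℝ, V) x₀).symm y))

/-- A continuously varying family `(f_l, N_l)`, `l ∈ Λ`, of CC-bundle structures: in coordinates,
the derivatives of order at most two in the space variable of the vector fields
`f_l(·, e_i)` are continuous in `(l, q)`, and `f` and `N` are jointly continuous. -/
structure IsContinuouslyVaryingCC {Λ : Type*} [TopologicalSpace Λ] [IsManifold 𝓘(ℝ, V) ∞ M]
    {k : ℕ} (f : Λ → (p : M) → CtrlSpace k →L[ℝ] TangentSpace 𝓘(ℝ, V) p)
    (N : Λ → M → CtrlSpace k → ℝ) : Prop where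
  isCC : ∀ l, IsCCBundleStructure (f l) (N l)
  continuous_derivs : ∀ (x₀ : M) (i : Fin k) (j : ℕ), j ≤ 2 →
    ContinuousOn (fun z : Λ × V => iteratedFDeriv ℝ j
        (vectorFieldInChart x₀ (fun p => f z.1 p (EuclideanSpace.single i 1))) z.2)
      (univ ×ˢ (extChartAt 𝓘(ℝ, V) x₀).target)
  continuous_norm : Continuous (fun z : Λ × M × CtrlSpace k => N z.1 z.2.1 z.2.2)
  continuous_morphism : Continuous (fun z : Λ × M × CtrlSpace k =>
    (⟨z.2.1, f z.1 z.2.1 z.2.2⟩ : TangentBundle 𝓘(ℝ, V) M))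

/-- Membership in the Lie algebra of vector fields generated by the fields `X i`. -/
inductive InGeneratedLieAlgebra {ι : Type*} (X : ι → (p : M) → TangentSpace 𝓘(ℝ, V) p) :
    ((p : M) → TangentSpace 𝓘(ℝ, V) p) → Prop
  | base (i : ι) : InGeneratedLieAlgebra X (X i)
  | zero : InGeneratedLieAlgebra X (fun _ => 0)
  | add (Y Z : (p : M) → TangentSpace 𝓘(ℝ, V) p) :
      InGeneratedLieAlgebra X Y → InGeneratedLieAlgebra X Z →
        InGeneratedLieAlgebra X (fun p => Y p + Z p)
  | smul (c : ℝ) (Y : (p : M) → TangentSpace 𝓘(ℝ, V) p) :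
      InGeneratedLieAlgebra X Y → InGeneratedLieAlgebra X (fun p => c • Y p)
  | bracket (Y Z : (p : M) → TangentSpace 𝓘(ℝ, V) p) :
      InGeneratedLieAlgebra X Y → InGeneratedLieAlgebra X Z →
        InGeneratedLieAlgebra X (VectorField.mlieBracket 𝓘(ℝ, V) Y Z)

/-- The family `X` is bracket-generating: at every point, the values of the fields of the
generated Lie algebra fill the tangent space. -/
def IsBracketGenerating {ι : Type*} (X : ι → (p : M) → TangentSpace 𝓘(ℝ, V) p) : Prop :=
  ∀ (p : M) (v : TangentSpace 𝓘(ℝ, V) p), ∃ Y, InGeneratedLieAlgebra X Y ∧ Y p = v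

/-- The curve `γ`, restricted to `[0, 1]`, is an absolutely continuous (Carathéodory) solution of
`γ'(t) = f(γ(t), u(t))`. Absolute continuity is required in every chart, on every compact
time interval on which the curve stays in the chart domain. -/
structure IsControlledCurve {k : ℕ} (f : (p : M) → CtrlSpace k →L[ℝ] TangentSpace 𝓘(ℝ, V) p)
    (u : ℝ → CtrlSpace k) (γ : ℝ → M) : Prop where
  continuousOn : ContinuousOn γ (Icc 0 1)
  absolutelyContinuous : ∀ (x₀ : M) (a b : ℝ), 0 ≤ a → a ≤ b → b ≤ 1 →
    MapsTo γ (Icc a b) (chartAt V x₀).source →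
      AbsolutelyContinuousOnInterval (extChartAt 𝓘(ℝ, V) x₀ ∘ γ) a b
  ae_hasDeriv : ∀ᵐ t ∂(volume.restrict (Icc (0 : ℝ) 1)),
    HasMFDerivAt 𝓘(ℝ, ℝ) 𝓘(ℝ, V) γ t
      ((1 : ℝ →L[ℝ] ℝ).smulRight (f (γ t) (u t) : TangentSpace 𝓘(ℝ, V) (γ t)))

/-- The energy `ess sup_{t ∈ [0, 1]} N(γ(t), u(t))`. -/
noncomputable def ccEnergy {k : ℕ} (N : M → CtrlSpace k → ℝ) (u : ℝ → CtrlSpace k)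
    (γ : ℝ → M) : ℝ≥0∞ :=
  essSup (fun t => ENNReal.ofReal (N (γ t) (u t))) (volume.restrict (Icc (0 : ℝ) 1))

/-- The Carnot-Carathéodory distance: the infimum of the energies of the controls
`u ∈ L^∞([0, 1]; ℝ^k)` whose trajectory starting at `p` is defined on `[0, 1]` and ends at `q`
(`∞` if there is no such control). -/
noncomputable def ccDist {k : ℕ} (f : (p : M) → CtrlSpace k →L[ℝ] TangentSpace 𝓘(ℝ, V) p)
    (N : M → CtrlSpace k → ℝ) (p q : M) : ℝ≥0∞ :=
  sInf {e : ℝ≥0∞ | ∃ (u : ℝ → CtrlSpace k) (γ : ℝ → M),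
    MemLp u ⊤ (volume.restrict (Icc (0 : ℝ) 1)) ∧ IsControlledCurve f u γ ∧
      γ 0 = p ∧ γ 1 = q ∧ e = ccEnergy N u γ}

end CCStructures

/-- The topology of a distance function `d`: a set is open iff it contains, with each of its
points, a `d`-ball of positive radius around it. -/
abbrev distTopology {X : Type*} (d : X → X → ℝ≥0∞) : TopologicalSpace X where
  IsOpen U := ∀ x ∈ U, ∃ ε : ℝ≥0∞, 0 < ε ∧ ∀ y, d x y < ε → y ∈ U
  isOpen_univ := fun _ _ => ⟨1, one_pos, fun _ _ => trivial⟩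
  isOpen_inter := fun s t hs ht x hx => by
    obtain ⟨a, ha, ha'⟩ := hs x hx.1
    obtain ⟨b, hb, hb'⟩ := ht x hx.2
    exact ⟨min a b, lt_min ha hb, fun y hy =>
      ⟨ha' y (hy.trans_le (min_le_left _ _)), hb' y (hy.trans_le (min_le_right _ _))⟩⟩
  isOpen_sUnion := fun S hS x hx => by
    obtain ⟨U, hU, hxU⟩ := hx
    obtain ⟨a, ha, ha'⟩ := hS U hU x hxU
    exact ⟨a, ha, fun y hy => ⟨U, hU, ha' y hy⟩⟩

/-- The distance `d` is boundedly compact: every `d`-closed set of finite `d`-diameter is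
compact for the topology of `d`. -/
def IsBoundedlyCompact {X : Type*} (d : X → X → ℝ≥0∞) : Prop :=
  ∀ S : Set X, IsClosed[distTopology d] S → (∃ C : ℝ≥0, ∀ x ∈ S, ∀ y ∈ S, d x y ≤ C) →
    @IsCompact X (distTopology d) S

/-! Locally, the two distances are compared by shadowing. In a chart, a curve of speed at most `c`
for one structure solves an ODE driven by a bounded control. The same control drives a solution for
a nearby structure from the same point. By a Grönwall estimate its endpoint is close to the original
one, and by continuity of `N` its speed is at most slightly larger. The small gap between the
endpoints must then be closed at small cost (`IsChartModel.exists_shadow`,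
`IsContinuouslyVaryingCC.exists_local_comparison`).

Closing the gap requires Chow's theorem uniformly for parameters near `l₀`. Iterated brackets of
arbitrary length are not controlled away from `l₀`, so they are used at `l₀` only, and in the form
of an orbit theorem. The span at `x` of the fields pushed forward to `x` by short compositions of
flows contains the values at `x` of all generated fields, hence is everything
(`IsBracketGenerating.orbitSpan_eq_top`). Choose finitely many pushforwards forming a basis. Each is
the velocity of a detour: travel back along a word, follow one field briefly, return along the word.
The concatenated detours, as a function of the times, have an invertible derivative at `l₀`. Flows
are strictly differentiable uniformly in the parameter (`HasUniformStrictFDerivAt`), so for all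
parameters near `l₀` the same map is close to linear and covers a ball of fixed size
(`eventually_exists_wordFlow_eq`). This needs only first derivatives that are continuous in
parameter and point.

Globally, a curve is cut into `m` pieces shorter than the radius `r` of the local comparison, each
compared with error `ε / (2 * m)`. A single `r` serves because all division points stay in finitely
many closed balls of the limit distance, which are compact by bounded compactness. For a curve of
the perturbed structure this confinement is not known beforehand. It is proved by induction along
the chain, since the comparison itself bounds the limit distance travelled so far
(`ccDist_chain_le`). Finally, if the perturbed distance is finite the points are joined by a path,
so the limit distance is finite too. This disposes of infinite values without assuming `M`
connected. -/

set_option linter.unusedSectionVars false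

/-! ### Integral equations on the unit interval with kernels of Lipschitz constant one half -/

section IntegralEquation

variable {W : Type*} [NormedAddCommGroup W] [NormedSpace ℝ W]

/-- A Grönwall-type bound on the unit interval for kernels of small Lipschitz constant. -/
theorem norm_le_of_integral_eq {e g : ℝ → W} {a : W} {δ : ℝ} (he : ContinuousOn e (Icc 0 1))
    (heq : ∀ t ∈ Icc (0 : ℝ) 1, e t = a + ∫ τ in (0 : ℝ)..t, g τ)
    (hg : ∀ᵐ τ ∂(volume.restrict (Icc (0 : ℝ) 1)), ‖g τ‖ ≤ ‖e τ‖ / 2 + δ) :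
    ∀ t ∈ Icc (0 : ℝ) 1, ‖e t‖ ≤ 2 * (‖a‖ + |δ|) := by
  -- At a maximum point of `‖e‖` the integral is at most half the maximum plus `|δ|`, so the half is
  -- absorbed on the left.
  obtain ⟨s, hs, hmax⟩ := isCompact_Icc.exists_isMaxOn (nonempty_Icc.2 zero_le_one) he.norm
  have hmax' : ∀ t ∈ Icc (0 : ℝ) 1, ‖e t‖ ≤ ‖e s‖ := fun t ht => hmax ht
  have key : ‖∫ τ in (0 : ℝ)..s, g τ‖ ≤ (‖e s‖ / 2 + |δ|) * |s - 0| := by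
    refine intervalIntegral.norm_integral_le_of_norm_le_const_ae ?_
    rw [ae_restrict_iff' measurableSet_Icc] at hg
    filter_upwards [hg] with τ hτ hτ'
    rw [uIoc_of_le hs.1] at hτ'
    have hmem : τ ∈ Icc (0 : ℝ) 1 := ⟨hτ'.1.le, hτ'.2.trans hs.2⟩
    linarith [hτ hmem, hmax' τ hmem, le_abs_self δ]
  have h1 : ‖e s‖ ≤ ‖a‖ + (‖e s‖ / 2 + |δ|) * |s - 0| := by
    calc ‖e s‖ = ‖a + ∫ τ in (0 : ℝ)..s, g τ‖ := by rw [← heq s hs]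
      _ ≤ _ := (norm_add_le _ _).trans (by gcongr)
  have h2 : (‖e s‖ / 2 + |δ|) * |s - 0| ≤ (‖e s‖ / 2 + |δ|) * 1 := by
    gcongr
    rw [sub_zero, abs_of_nonneg hs.1]; exact hs.2
  intro t ht
  linarith [hmax' t ht]

/-- Solutions of `γ(t) = y + ∫₀ᵗ G(τ, γ(τ)) dτ` on the unit interval, for kernels of small
Lipschitz constant. -/
theorem exists_integral_eq [CompleteSpace W] {G : ℝ → W → W} {B : ℝ}
    (hlip : ∀ t x x', ‖G t x - G t x'‖ ≤ ‖x - x'‖ / 2) (hbdd : ∀ t, ‖G t 0‖ ≤ B)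
    (hmeas : ∀ γ : ℝ → W, Continuous γ → AEStronglyMeasurable (fun t => G t (γ t)) volume)
    (y : W) :
    ∃ γ : ℝ → W, Continuous γ ∧ ∀ t ∈ Icc (0 : ℝ) 1, γ t = y + ∫ τ in (0 : ℝ)..t, G τ (γ τ) := by
  have hB : ∀ (γ : BoundedContinuousFunction ℝ W) t, ‖G t (γ t)‖ ≤ ‖γ‖ / 2 + B := fun γ t => by
    have h1 := hlip t (γ t) 0
    have h2 : ‖G t (γ t)‖ ≤ ‖G t (γ t) - G t 0‖ + ‖G t 0‖ := by
      simpa using norm_add_le (G t (γ t) - G t 0) (G t 0)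
    have h3 := γ.norm_coe_le_norm t
    rw [sub_zero] at h1
    linarith [hbdd t]
  have hint : ∀ (γ : BoundedContinuousFunction ℝ W) (a b : ℝ),
      IntervalIntegrable (fun t => G t (γ t)) volume a b := fun γ a b => by
    rw [intervalIntegrable_iff]
    exact Measure.integrableOn_of_bounded (M := ‖γ‖ / 2 + B) (by simp)
      (hmeas γ γ.continuous) (ae_of_all _ (hB γ))
  have h01 : (0 : ℝ) ≤ 1 := zero_le_one
  -- Clamping the upper limit to `[0, 1]` lets the Picard operator act on bounded continuous
  -- functions on the whole line. It contracts by one half there, so no shrinking of the interval is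
  -- needed.
  let T : BoundedContinuousFunction ℝ W → BoundedContinuousFunction ℝ W := fun γ =>
    BoundedContinuousFunction.ofNormedAddCommGroup
      (fun s => y + ∫ τ in (0 : ℝ)..(projIcc 0 1 h01 s : ℝ), G τ (γ τ))
      (continuous_const.add ((intervalIntegral.continuous_primitive (hint γ) 0).comp
        (continuous_subtype_val.comp continuous_projIcc)))
      (‖y‖ + (‖γ‖ / 2 + B)) (fun s => by
        refine (norm_add_le _ _).trans (add_le_add le_rfl ?_)
        have h := intervalIntegral.norm_integral_le_of_norm_le_const
          (a := 0) (b := (projIcc 0 1 h01 s : ℝ)) (f := fun τ => G τ (γ τ))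
          (fun τ _ => hB γ τ)
        refine h.trans ?_
        have h2 := (projIcc 0 1 h01 s).2
        have h3 : 0 ≤ ‖γ‖ / 2 + B := (norm_nonneg _).trans (hB γ 0)
        rw [sub_zero, abs_of_nonneg h2.1]
        exact mul_le_of_le_one_right h3 h2.2)
  have hT : ∀ γ s, T γ s = y + ∫ τ in (0 : ℝ)..(projIcc 0 1 h01 s : ℝ), G τ (γ τ) :=
    fun _ _ => rfl
  have hcontr : ContractingWith (1 / 2) T := by
    refine ⟨by rw [← NNReal.coe_lt_coe]; norm_num, LipschitzWith.of_dist_le_mul fun γ γ' => ?_⟩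
    rw [BoundedContinuousFunction.dist_le (by positivity)]
    intro s
    rw [dist_eq_norm, hT, hT, add_sub_add_left_eq_sub,
      ← intervalIntegral.integral_sub (hint γ _ _) (hint γ' _ _)]
    have h := intervalIntegral.norm_integral_le_of_norm_le_const
          (a := 0) (b := (projIcc 0 1 h01 s : ℝ)) (f := fun τ => G τ (γ τ) - G τ (γ' τ))
          (C := dist γ γ' / 2) (fun τ _ => (hlip _ _ _).trans (by
            rw [← dist_eq_norm]; gcongr; exact BoundedContinuousFunction.dist_coe_le_dist τ))
    refine h.trans ?_
    have h2 := (projIcc 0 1 h01 s).2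
    rw [sub_zero, abs_of_nonneg h2.1]
    have h3 : dist γ γ' / 2 * (projIcc 0 1 h01 s : ℝ) ≤ dist γ γ' / 2 * 1 := by
      gcongr; exact h2.2
    refine h3.trans (le_of_eq ?_)
    push_cast; ring
  let γ := ContractingWith.fixedPoint T hcontr
  have hfix : T γ = γ := hcontr.fixedPoint_isFixedPt
  refine ⟨γ, γ.continuous, fun t ht => ?_⟩
  have := hT γ t
  rw [hfix, projIcc_of_mem h01 ht] at this
  exact this

end IntegralEquation

/-! ### Flows of bounded vector fields for short times -/

section BoundedFields

variable {V : Type*} [NormedAddCommGroup V] [NormedSpace ℝ V]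

/-- A differentiable vector field bounded by `C` together with its derivative. -/
structure IsBddField (C : ℝ) (Z : V → V) : Prop where
  differentiable : Differentiable ℝ Z
  continuous_fderiv : Continuous (fderiv ℝ Z)
  norm_le : ∀ y, ‖Z y‖ ≤ C
  fderiv_le : ∀ y, ‖fderiv ℝ Z y‖ ≤ C

/-- The curve `γ` is the trajectory of `t • Z` starting at `y`, on the unit interval. -/
def IsTrajectory (Z : V → V) (t : ℝ) (y : V) (γ : ℝ → V) : Prop :=
  Continuous γ ∧ ∀ s ∈ Icc (0 : ℝ) 1, γ s = y + ∫ τ in (0 : ℝ)..s, t • Z (γ τ)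

namespace IsBddField

variable {C : ℝ} {Z : V → V}

theorem nonneg (hZ : IsBddField C Z) : 0 ≤ C := (norm_nonneg _).trans (hZ.norm_le 0)

theorem norm_sub_le (hZ : IsBddField C Z) (x y : V) : ‖Z x - Z y‖ ≤ C * ‖x - y‖ :=
  convex_univ.norm_image_sub_le_of_norm_fderiv_le (fun x _ => hZ.differentiable x)
    (fun x _ => hZ.fderiv_le x) (mem_univ y) (mem_univ x)

theorem continuous (hZ : IsBddField C Z) : Continuous Z := hZ.differentiable.continuous

theorem smul_sub_le (hZ : IsBddField C Z) {t : ℝ} (ht : |t| * C ≤ 1 / 2) (x y : V) :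
    ‖t • Z x - t • Z y‖ ≤ ‖x - y‖ / 2 := by
  rw [← smul_sub, norm_smul, Real.norm_eq_abs]
  calc |t| * ‖Z x - Z y‖ ≤ |t| * (C * ‖x - y‖) := by gcongr; exact hZ.norm_sub_le x y
    _ = (|t| * C) * ‖x - y‖ := by ring
    _ ≤ 1 / 2 * ‖x - y‖ := by gcongr
    _ = _ := by ring

theorem exists_trajectory [CompleteSpace V] (hZ : IsBddField C Z) {t : ℝ}
    (ht : |t| * C ≤ 1 / 2) (y : V) : ∃ γ, IsTrajectory Z t y γ :=
  exists_integral_eq (G := fun _ x => t • Z x) (B := ‖t • Z 0‖)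
    (fun _ x y => hZ.smul_sub_le ht x y) (fun _ => le_rfl)
    (fun _ hγ => ((hZ.continuous.comp hγ).const_smul t).aestronglyMeasurable) y

end IsBddField

theorem IsTrajectory.intervalIntegrable {Z : V → V} {t : ℝ} {y : V} {γ : ℝ → V}
    (h : IsTrajectory Z t y γ) (hZ : Continuous Z) (a b : ℝ) :
    IntervalIntegrable (fun τ => t • Z (γ τ)) volume a b :=
  ((hZ.comp h.1).const_smul t).intervalIntegrable a b

/-- The mismatch of the two fields is measured along `γ` only, so only `Z'` has to be Lipschitz.
Uniqueness and continuity in time, starting point and parameter are all instances. -/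
theorem IsTrajectory.norm_sub_le {Z Z' : V → V} {t t' C δ : ℝ} {y y' : V} {γ γ' : ℝ → V}
    (h : IsTrajectory Z t y γ) (h' : IsTrajectory Z' t' y' γ') (hZ : Continuous Z)
    (hZ' : IsBddField C Z') (ht' : |t'| * C ≤ 1 / 2)
    (hδ : ∀ s ∈ Icc (0 : ℝ) 1, ‖t • Z (γ s) - t' • Z' (γ s)‖ ≤ δ) :
    ∀ s ∈ Icc (0 : ℝ) 1, ‖γ s - γ' s‖ ≤ 2 * (‖y - y'‖ + |δ|) := by
  refine norm_le_of_integral_eq (h.1.sub h'.1).continuousOn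
    (g := fun τ => t • Z (γ τ) - t' • Z' (γ' τ)) (fun s hs => ?_) ?_
  · rw [intervalIntegral.integral_sub (h.intervalIntegrable hZ _ _)
      (h'.intervalIntegrable hZ'.continuous _ _), h.2 s hs, h'.2 s hs]
    abel
  · rw [ae_restrict_iff' measurableSet_Icc]
    refine ae_of_all _ fun s hs => ?_
    have h1 := hδ s hs
    have h2 := hZ'.smul_sub_le ht' (γ s) (γ' s)
    have h3 : t • Z (γ s) - t' • Z' (γ' s)
        = (t • Z (γ s) - t' • Z' (γ s)) + (t' • Z' (γ s) - t' • Z' (γ' s)) := by abel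
    rw [h3]
    linarith [norm_add_le (t • Z (γ s) - t' • Z' (γ s)) (t' • Z' (γ s) - t' • Z' (γ' s))]

theorem IsTrajectory.eq_of_eq {Z : V → V} {t C : ℝ} {y : V} {γ γ' : ℝ → V}
    (h : IsTrajectory Z t y γ) (h' : IsTrajectory Z t y γ')
    (hZ : IsBddField C Z) (ht : |t| * C ≤ 1 / 2) {s : ℝ} (hs : s ∈ Icc (0 : ℝ) 1) :
    γ s = γ' s := by
  have := h.norm_sub_le h' hZ.continuous hZ ht (δ := 0) (by simp) s hs
  simpa [sub_eq_zero] using this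

theorem IsTrajectory.apply_zero {Z : V → V} {t : ℝ} {y : V} {γ : ℝ → V}
    (h : IsTrajectory Z t y γ) : γ 0 = y := by
  simpa using h.2 0 (by simp)

theorem IsTrajectory.norm_sub_start_le {Z : V → V} {t C : ℝ} {y : V} {γ : ℝ → V}
    (h : IsTrajectory Z t y γ) (hZ : IsBddField C Z) {s : ℝ} (hs : s ∈ Icc (0 : ℝ) 1) :
    ‖γ s - y‖ ≤ |t| * C := by
  rw [h.2 s hs, add_sub_cancel_left]
  have h1 := intervalIntegral.norm_integral_le_of_norm_le_const (a := 0) (b := s)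
    (f := fun τ => t • Z (γ τ)) (C := |t| * C) (fun τ _ => by
      rw [norm_smul, Real.norm_eq_abs]; gcongr; exact hZ.norm_le _)
  refine h1.trans ?_
  rw [sub_zero, abs_of_nonneg hs.1]
  exact mul_le_of_le_one_right (mul_nonneg (abs_nonneg _) hZ.nonneg) hs.2

theorem IsTrajectory.reverse {Z : V → V} {t : ℝ} {y : V} {γ : ℝ → V}
    (h : IsTrajectory Z t y γ) (hZ : Continuous Z) :
    IsTrajectory Z (-t) (γ 1) (fun s => γ (1 - s)) := by
  refine ⟨h.1.comp (by fun_prop), fun s hs => ?_⟩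
  have h1 : ∫ τ in (0 : ℝ)..s, -t • Z (γ (1 - τ)) = ∫ τ in (1 - s)..(1 : ℝ), -t • Z (γ τ) := by
    simpa using intervalIntegral.integral_comp_sub_left (a := 0) (b := s)
      (fun τ => -t • Z (γ τ)) 1
  rw [h1]
  have h2 := intervalIntegral.integral_add_adjacent_intervals
    (h.intervalIntegrable hZ 0 (1 - s)) (h.intervalIntegrable hZ (1 - s) 1)
  simp only [neg_smul, intervalIntegral.integral_neg]
  rw [h.2 (1 - s) ⟨by linarith [hs.2], by linarith [hs.1]⟩, h.2 1 (by simp), ← h2]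
  abel

open Classical in
/-- The trajectory of `t • Z` starting at `y` (constant if there is none). -/
noncomputable def trajectory (Z : V → V) (t : ℝ) (y : V) : ℝ → V :=
  if h : ∃ γ, IsTrajectory Z t y γ then h.choose else fun _ => y

/-- The flow of `Z` at time `t`. -/
noncomputable def fieldFlow (Z : V → V) (t : ℝ) (y : V) : V := trajectory Z t y 1

variable [CompleteSpace V] {C t : ℝ} {Z : V → V}

theorem IsBddField.isTrajectory (hZ : IsBddField C Z) (ht : |t| * C ≤ 1 / 2) (y : V) :
    IsTrajectory Z t y (trajectory Z t y) := by
  have h := hZ.exists_trajectory ht y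
  rw [trajectory, dif_pos h]
  exact h.choose_spec

theorem IsBddField.flow_neg (hZ : IsBddField C Z) (ht : |t| * C ≤ 1 / 2) (y : V) :
    fieldFlow Z (-t) (fieldFlow Z t y) = y := by
  have h1 := hZ.isTrajectory ht y
  have h2 := hZ.isTrajectory (t := -t) (by rwa [abs_neg]) (fieldFlow Z t y)
  have h3 := h2.eq_of_eq (h1.reverse hZ.continuous) hZ (by rwa [abs_neg]) (s := 1) (by simp)
  rw [fieldFlow, h3]
  simpa using h1.apply_zero

theorem IsBddField.flow_sub_le (hZ : IsBddField C Z) (ht : |t| * C ≤ 1 / 2) (y : V) :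
    ‖fieldFlow Z t y - y‖ ≤ |t| * C :=
  (hZ.isTrajectory ht y).norm_sub_start_le hZ (by simp)

theorem IsBddField.flow_zero (hZ : IsBddField C Z) (y : V) : fieldFlow Z 0 y = y := by
  have := hZ.flow_sub_le (t := 0) (by simp) y
  simpa [sub_eq_zero] using this

theorem IsBddField.trajectory_sub_le (hZ : IsBddField C Z) {t t' : ℝ} (ht : |t| * C ≤ 1 / 2)
    (ht' : |t'| * C ≤ 1 / 2) (y y' : V) {s : ℝ} (hs : s ∈ Icc (0 : ℝ) 1) :
    ‖trajectory Z t y s - trajectory Z t' y' s‖ ≤ 2 * (‖y - y'‖ + |t - t'| * C) := by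
  have h := (hZ.isTrajectory ht y).norm_sub_le (hZ.isTrajectory ht' y') hZ.continuous hZ ht'
    (δ := |t - t'| * C) (fun s _ => by
      rw [← sub_smul, norm_smul, Real.norm_eq_abs]; gcongr; exact hZ.norm_le _) s hs
  rwa [abs_of_nonneg (mul_nonneg (abs_nonneg _) hZ.nonneg)] at h

theorem IsBddField.flow_eq (hZ : IsBddField C Z) (ht : |t| * C ≤ 1 / 2) (y : V) :
    fieldFlow Z t y = y + ∫ τ in (0 : ℝ)..1, t • Z (trajectory Z t y τ) :=
  (hZ.isTrajectory ht y).2 1 (by simp)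

/-- The flow of `Z` is the identity to first order in time. -/
theorem IsBddField.flow_sub_sub_le (hZ : IsBddField C Z) (ht : |t| * C ≤ 1 / 2) (y : V) :
    ‖fieldFlow Z t y - y - t • Z y‖ ≤ |t| * C * (|t| * C) := by
  have hT := hZ.isTrajectory ht y
  have h1 : fieldFlow Z t y - y - t • Z y
      = ∫ τ in (0 : ℝ)..1, (t • Z (trajectory Z t y τ) - t • Z y) := by
    rw [intervalIntegral.integral_sub (hT.intervalIntegrable hZ.continuous _ _) (by simp),
      hZ.flow_eq ht y]
    simp
  rw [h1]
  have h2 := intervalIntegral.norm_integral_le_of_norm_le_const (a := 0) (b := 1)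
    (f := fun τ => t • Z (trajectory Z t y τ) - t • Z y) (C := |t| * C * (|t| * C)) (fun τ hτ => by
      rw [uIoc_of_le zero_le_one] at hτ
      rw [← smul_sub, norm_smul, Real.norm_eq_abs, mul_assoc]
      have h3 := hZ.norm_sub_le (trajectory Z t y τ) y
      have h4 := hT.norm_sub_start_le hZ (s := τ) ⟨hτ.1.le, hτ.2⟩
      have h5 := hZ.nonneg
      gcongr
      exact h3.trans (by gcongr))
  simpa using h2

/-- The flow of `Z` is the identity plus `t` times `Z`, to first order in time, in the Lipschitz
sense. -/
theorem IsBddField.flow_lipschitz_sub (hZ : IsBddField C Z) (z : V) {ε : ℝ} (hε : 0 < ε) :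
    ∃ δ > 0, ∀ t, |t| ≤ δ → ∀ y y', ‖y - z‖ ≤ δ → ‖y' - z‖ ≤ δ →
      ‖(fieldFlow Z t y - fieldFlow Z t y') - (y - y') - t • fderiv ℝ Z z (y - y')‖
        ≤ ε * |t| * ‖y - y'‖ := by
  have hC := hZ.nonneg
  obtain ⟨ρ, hρ, hρ'⟩ := Metric.continuousAt_iff.1 (hZ.continuous_fderiv.continuousAt (x := z))
    (ε / 4) (by positivity)
  set D : ℝ := C + 1 with hD
  have hD0 : 0 < D := by positivity
  -- The first bound makes trajectories exist. The second keeps them in the ball where `fderiv ℝ Z`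
  -- varies by at most `ε / 4`. The third makes the drift of `a - b` away from `y - y'` contribute
  -- at most `ε / 2`. `D = C + 1` avoids division by zero.
  refine ⟨min (1 / (2 * D)) (min (ρ / (2 * (1 + D))) (ε / (4 * D ^ 2))), by positivity,
    fun t ht y y' hy hy' => ?_⟩
  have ht1 : |t| * D ≤ 1 / 2 := by
    have := ht.trans (min_le_left _ _)
    rw [le_div_iff₀ (by positivity)] at this; linarith
  have htC : |t| * C ≤ 1 / 2 := le_trans (by gcongr; linarith) ht1
  have ht3 : |t| * D ^ 2 * 4 ≤ ε := by
    have := ht.trans ((min_le_right _ _).trans (min_le_right _ _))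
    rw [le_div_iff₀ (by positivity)] at this; linarith
  have hsmall : ∀ y, ‖y - z‖ ≤ min (1 / (2 * D)) (min (ρ / (2 * (1 + D))) (ε / (4 * D ^ 2))) →
      ∀ s ∈ Icc (0 : ℝ) 1, trajectory Z t y s ∈ Metric.ball z ρ := fun y hy s hs => by
    have h1 := (hZ.isTrajectory htC y).norm_sub_start_le hZ hs
    have h2 := ht.trans ((min_le_right _ _).trans (min_le_left _ _))
    have h3 := hy.trans ((min_le_right _ _).trans (min_le_left _ _))
    rw [Metric.mem_ball, dist_eq_norm]
    have h4 : |t| * C ≤ ρ / (2 * (1 + D)) * D := by gcongr; linarith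
    have h5 : ρ / (2 * (1 + D)) * (1 + D) = ρ / 2 := by field_simp
    calc ‖trajectory Z t y s - z‖ ≤ ‖trajectory Z t y s - y‖ + ‖y - z‖ := norm_sub_le_norm_sub_add_norm_sub _ _ _
      _ ≤ ρ / (2 * (1 + D)) * D + ρ / (2 * (1 + D)) := by linarith
      _ = ρ / 2 := by rw [← h5]; ring
      _ < ρ := by linarith
  have hT := hZ.isTrajectory htC y
  have hT' := hZ.isTrajectory htC y'
  have h1 : (fieldFlow Z t y - fieldFlow Z t y') - (y - y') - t • fderiv ℝ Z z (y - y')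
      = ∫ τ in (0 : ℝ)..1, ((t • Z (trajectory Z t y τ) - t • Z (trajectory Z t y' τ))
          - t • fderiv ℝ Z z (y - y')) := by
    rw [intervalIntegral.integral_sub ((hT.intervalIntegrable hZ.continuous _ _).sub
      (hT'.intervalIntegrable hZ.continuous _ _)) (by simp), intervalIntegral.integral_sub
      (hT.intervalIntegrable hZ.continuous _ _) (hT'.intervalIntegrable hZ.continuous _ _),
      hZ.flow_eq htC y, hZ.flow_eq htC y']
    simp only [intervalIntegral.integral_const, sub_zero, one_smul]
    abel
  rw [h1]
  have h2 := intervalIntegral.norm_integral_le_of_norm_le_const (a := 0) (b := 1)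
    (f := fun τ => (t • Z (trajectory Z t y τ) - t • Z (trajectory Z t y' τ))
          - t • fderiv ℝ Z z (y - y')) (C := ε * |t| * ‖y - y'‖) (fun τ hτ => ?_)
  · simpa using h2
  rw [uIoc_of_le zero_le_one] at hτ
  have hτ' : τ ∈ Icc (0 : ℝ) 1 := ⟨hτ.1.le, hτ.2⟩
  set a := trajectory Z t y τ
  set b := trajectory Z t y' τ
  have h3 : ‖Z a - Z b - fderiv ℝ Z z (a - b)‖ ≤ ε / 4 * ‖a - b‖ :=
    (convex_ball z ρ).norm_image_sub_le_of_norm_hasFDerivWithin_le'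
      (fun x _ => (hZ.differentiable x).hasFDerivAt.hasFDerivWithinAt)
      (fun x hx => by rw [← dist_eq_norm]; exact (hρ' hx).le)
      (hsmall y' hy' τ hτ') (hsmall y hy τ hτ')
  have h4 : ‖a - b‖ ≤ 2 * ‖y - y'‖ := by
    simpa using hZ.trajectory_sub_le htC htC y y' hτ'
  have h5 : ‖(a - b) - (y - y')‖ ≤ |t| * C * (2 * ‖y - y'‖) := by
    have e : (a - b) - (y - y') = ∫ σ in (0 : ℝ)..τ,
        (t • Z (trajectory Z t y σ) - t • Z (trajectory Z t y' σ)) := by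
      rw [intervalIntegral.integral_sub
        (hT.intervalIntegrable hZ.continuous _ _) (hT'.intervalIntegrable hZ.continuous _ _)]
      rw [show a = _ from hT.2 τ hτ', show b = _ from hT'.2 τ hτ']
      abel
    rw [e]
    have h6 := intervalIntegral.norm_integral_le_of_norm_le_const (a := 0) (b := τ)
      (f := fun σ => t • Z (trajectory Z t y σ) - t • Z (trajectory Z t y' σ))
      (C := |t| * C * (2 * ‖y - y'‖)) (fun σ hσ => by
        rw [uIoc_of_le hτ'.1] at hσ
        have hσ' : σ ∈ Icc (0 : ℝ) 1 := ⟨hσ.1.le, hσ.2.trans hτ'.2⟩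
        rw [← smul_sub, norm_smul, Real.norm_eq_abs, mul_assoc]
        gcongr
        refine (hZ.norm_sub_le _ _).trans ?_
        gcongr
        simpa using hZ.trajectory_sub_le htC htC y y' hσ')
    refine h6.trans ?_
    rw [sub_zero, abs_of_nonneg hτ'.1]
    exact mul_le_of_le_one_right (by positivity) hτ'.2
  have h7 : (t • Z a - t • Z b) - t • fderiv ℝ Z z (y - y')
      = t • ((Z a - Z b - fderiv ℝ Z z (a - b)) + fderiv ℝ Z z ((a - b) - (y - y'))) := by
    rw [map_sub _ (a - b), ← smul_sub, ← smul_sub]; congr 1; abel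
  rw [h7, norm_smul, Real.norm_eq_abs]
  have h8 : ‖fderiv ℝ Z z ((a - b) - (y - y'))‖ ≤ C * (|t| * C * (2 * ‖y - y'‖)) :=
    (ContinuousLinearMap.le_opNorm _ _).trans (by gcongr; exact hZ.fderiv_le z)
  have h9 : C * (|t| * C * (2 * ‖y - y'‖)) ≤ ε / 2 * ‖y - y'‖ := by
    have : |t| * C ^ 2 * 4 ≤ |t| * D ^ 2 * 4 := by gcongr; linarith
    have h10 : |t| * C ^ 2 * 2 ≤ ε / 2 := by linarith
    calc C * (|t| * C * (2 * ‖y - y'‖)) = (|t| * C ^ 2 * 2) * ‖y - y'‖ := by ring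
      _ ≤ _ := by gcongr
  have h10 : ε / 4 * ‖a - b‖ ≤ ε / 2 * ‖y - y'‖ := by
    calc ε / 4 * ‖a - b‖ ≤ ε / 4 * (2 * ‖y - y'‖) := by gcongr
      _ = _ := by ring
  calc |t| * _ ≤ |t| * (ε * ‖y - y'‖) := by
        gcongr
        refine (norm_add_le _ _).trans ?_
        linarith
    _ = _ := by ring

end BoundedFields

/-! ### Strict differentiability uniform in a parameter -/

section UniformStrict

variable {Λ : Type*} [TopologicalSpace Λ]
  {E F G : Type*} [NormedAddCommGroup E] [NormedSpace ℝ E] [NormedAddCommGroup F] [NormedSpace ℝ F]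
  [NormedAddCommGroup G] [NormedSpace ℝ G]

/-- The maps `g l` are strictly differentiable at `x` with derivative `A`, uniformly as
`l → l₀`. -/
structure HasUniformStrictFDerivAt (l₀ : Λ) (g : Λ → E → F) (A : E →L[ℝ] F) (x : E) : Prop where
  tendsto : Tendsto (fun z : Λ × E => g z.1 z.2) (𝓝 l₀ ×ˢ 𝓝 x) (𝓝 (g l₀ x))
  norm_le : ∀ ε > 0, ∀ᶠ z : Λ × E × E in 𝓝 l₀ ×ˢ (𝓝 x ×ˢ 𝓝 x),
    ‖g z.1 z.2.1 - g z.1 z.2.2 - A (z.2.1 - z.2.2)‖ ≤ ε * ‖z.2.1 - z.2.2‖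

namespace HasUniformStrictFDerivAt

variable {l₀ : Λ} {g : Λ → E → F} {A : E →L[ℝ] F} {x : E}

theorem hasFDerivAt (h : HasUniformStrictFDerivAt l₀ g A x) : HasFDerivAt (g l₀) A x := by
  refine .of_isLittleO (Asymptotics.IsLittleO.of_bound fun ε hε => ?_)
  have h1 : Tendsto (fun y : E => (l₀, y, x)) (𝓝 x) (𝓝 l₀ ×ˢ (𝓝 x ×ˢ 𝓝 x)) := by
    simp only [← nhds_prod_eq]
    exact Continuous.tendsto (by fun_prop) x
  exact h1.eventually (h.norm_le ε hε)

theorem comp {h : Λ → F → G} {B : F →L[ℝ] G} (hh : HasUniformStrictFDerivAt l₀ h B (g l₀ x))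
    (hg : HasUniformStrictFDerivAt l₀ g A x) :
    HasUniformStrictFDerivAt l₀ (fun l y => h l (g l y)) (B ∘L A) x := by
  refine ⟨hh.tendsto.comp (tendsto_fst.prodMk hg.tendsto), fun ε hε => ?_⟩
  set a := ‖A‖
  set b := ‖B‖
  have ha : 0 ≤ a := norm_nonneg _
  have hb : 0 ≤ b := norm_nonneg _
  have h1 := hh.norm_le (ε / (2 * (a + 1))) (by positivity)
  -- The bound by `1` gives `g l` the Lipschitz constant `‖A‖ + 1` near `x`; the other bound absorbs
  -- `‖B‖`.
  set ε' := min 1 (ε / (2 * (b + 1))) with hε'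
  have hε'0 : 0 < ε' := by positivity
  have h2 := hg.norm_le ε' hε'0
  have ht : Tendsto (fun z : Λ × E × E => (z.1, g z.1 z.2.1, g z.1 z.2.2))
      (𝓝 l₀ ×ˢ (𝓝 x ×ˢ 𝓝 x)) (𝓝 l₀ ×ˢ (𝓝 (g l₀ x) ×ˢ 𝓝 (g l₀ x))) := by
    refine tendsto_fst.prodMk (Tendsto.prodMk ?_ ?_)
    · exact hg.tendsto.comp (tendsto_fst.prodMk (tendsto_fst.comp tendsto_snd))
    · exact hg.tendsto.comp (tendsto_fst.prodMk (tendsto_snd.comp tendsto_snd))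
  filter_upwards [ht.eventually h1, h2] with ⟨l, y, y'⟩ h3 h4
  simp only at h3 h4 ⊢
  set w := y - y'
  set u := g l y - g l y'
  have h5 : ‖u‖ ≤ (a + 1) * ‖w‖ := by
    have : ‖u‖ ≤ ‖u - A w‖ + ‖A w‖ := by simpa using norm_add_le (u - A w) (A w)
    have h6 : ‖A w‖ ≤ a * ‖w‖ := A.le_opNorm w
    have h7 : ε' * ‖w‖ ≤ 1 * ‖w‖ := by gcongr; exact min_le_left _ _
    linarith
  have h6 : h l (g l y) - h l (g l y') - (B ∘L A) w
      = (h l (g l y) - h l (g l y') - B u) + B (u - A w) := by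
    simp only [ContinuousLinearMap.comp_apply, map_sub]; abel
  rw [h6]
  have h7 : ‖B (u - A w)‖ ≤ b * (ε / (2 * (b + 1)) * ‖w‖) :=
    (B.le_opNorm _).trans (by gcongr; exact h4.trans (by gcongr; exact min_le_right _ _))
  have h8 : b * (ε / (2 * (b + 1)) * ‖w‖) ≤ ε / 2 * ‖w‖ := by
    have : b * (ε / (2 * (b + 1))) ≤ ε / 2 := by
      rw [mul_div_assoc', div_le_div_iff₀ (by positivity) (by positivity)]; nlinarith
    calc _ = b * (ε / (2 * (b + 1))) * ‖w‖ := by ring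
      _ ≤ _ := by gcongr
  have h9 : ε / (2 * (a + 1)) * ‖u‖ ≤ ε / 2 * ‖w‖ := by
    calc _ ≤ ε / (2 * (a + 1)) * ((a + 1) * ‖w‖) := by gcongr
      _ = _ := by field_simp
  refine (norm_add_le _ _).trans ?_
  linarith

theorem of_linear (l₀ : Λ) (A : E →L[ℝ] F) (x : E) :
    HasUniformStrictFDerivAt l₀ (fun _ y => A y) A x :=
  ⟨(A.continuous.tendsto x).comp tendsto_snd, fun ε hε => Eventually.of_forall fun z => by
    simp only [map_sub, sub_self, norm_zero]; positivity⟩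

theorem prodMk {h : Λ → E → G} {B : E →L[ℝ] G} (hg : HasUniformStrictFDerivAt l₀ g A x)
    (hh : HasUniformStrictFDerivAt l₀ h B x) :
    HasUniformStrictFDerivAt l₀ (fun l y => (g l y, h l y)) (A.prod B) x := by
  refine ⟨hg.tendsto.prodMk_nhds hh.tendsto, fun ε hε => ?_⟩
  filter_upwards [hg.norm_le ε hε, hh.norm_le ε hε] with z h1 h2
  exact max_le h1 h2

end HasUniformStrictFDerivAt

/-- Continuity is uniform near compact sets. -/
theorem eventually_forall_norm_sub_le {H : Type*} [NormedAddCommGroup H] {g : Λ → E → H}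
    (hg : Continuous fun z : Λ × E => g z.1 z.2)
    (l₀ : Λ) {K : Set E} (hK : IsCompact K) {ε : ℝ} (hε : 0 < ε) :
    ∃ δ > 0, ∀ᶠ l in 𝓝 l₀, ∀ x ∈ K, ∀ y, ‖y - x‖ ≤ δ → ‖g l y - g l₀ x‖ ≤ ε := by
  -- The displacement `y - x` is treated as a parameter next to `l`, so that compactness in `x`
  -- yields one `δ` for all of `K`.
  have h1 : ∀ x ∈ K, ∀ᶠ z : (Λ × E) × E in 𝓝 (((l₀, (0 : E)) : Λ × E), x),
      ‖g z.1.1 (z.2 + z.1.2) - g l₀ z.2‖ < ε := fun x _ => by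
    have hc : Continuous fun z : (Λ × E) × E => ‖g z.1.1 (z.2 + z.1.2) - g l₀ z.2‖ :=
      ((hg.comp (f := fun z : (Λ × E) × E => (z.1.1, z.2 + z.1.2)) (by fun_prop)).sub
        (hg.comp (f := fun z : (Λ × E) × E => (l₀, z.2)) (by fun_prop))).norm
    exact hc.continuousAt.eventually_lt continuousAt_const (by simpa using hε)
  have h2 := hK.eventually_forall_of_forall_eventually
    (P := fun (z : Λ × E) (y : E) => ‖g z.1 (y + z.2) - g l₀ y‖ < ε) h1
  rw [nhds_prod_eq, eventually_prod_iff] at h2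
  obtain ⟨p, hp, q, hq, hpq⟩ := h2
  obtain ⟨δ, hδ, hδ'⟩ := Metric.eventually_nhds_iff.1 hq
  refine ⟨δ / 2, by positivity, ?_⟩
  filter_upwards [hp] with l hl x hx y hy
  have := hpq hl (hδ' (y := y - x) (by rw [dist_zero_right]; linarith)) x hx
  simpa using this.le

end UniformStrict

/-! ### Differentiability of flows, uniformly in the parameter -/

section Families

variable {Λ : Type*} [TopologicalSpace Λ] {V : Type*} [NormedAddCommGroup V] [NormedSpace ℝ V]

/-- A family of vector fields, uniformly bounded with their derivatives, that depends continuously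
on the parameter together with the derivatives. -/
structure IsBddFamily (C : ℝ) (X : Λ → V → V) : Prop where
  bdd : ∀ l, IsBddField C (X l)
  continuous : Continuous fun z : Λ × V => X z.1 z.2
  continuous_fderiv : Continuous fun z : Λ × V => fderiv ℝ (X z.1) z.2

variable [CompleteSpace V] {C t : ℝ} {X : Λ → V → V}

theorem IsBddFamily.eventually_trajectory_sub_le (hX : IsBddFamily C X) (ht : |t| * C ≤ 1 / 2)
    (l₀ : Λ) (x : V) {ε : ℝ} (hε : 0 < ε) :
    ∀ᶠ z : Λ × V in 𝓝 l₀ ×ˢ 𝓝 x, ∀ s ∈ Icc (0 : ℝ) 1,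
      ‖trajectory (X z.1) t z.2 s - trajectory (X l₀) t x s‖ ≤ ε := by
  have h0 := (hX.bdd l₀).isTrajectory ht x
  have hK : IsCompact (trajectory (X l₀) t x '' Icc 0 1) := isCompact_Icc.image h0.1
  obtain ⟨δ, hδ, h1⟩ := eventually_forall_norm_sub_le hX.continuous l₀ hK
    (ε := ε / (4 * (|t| + 1))) (by positivity)
  have h2 : ∀ᶠ y in 𝓝 x, ‖y - x‖ ≤ ε / 4 := by
    have : ContinuousAt (fun y : V => ‖y - x‖) x := by fun_prop
    exact (this.eventually_lt continuousAt_const (by simp; positivity)).mono fun _ h => h.le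
  filter_upwards [h1.prod_mk h2] with ⟨l, y⟩ h s hs
  obtain ⟨h3, h4⟩ := h
  simp only at h3 h4 ⊢
  have h5 := h0.norm_sub_le ((hX.bdd l).isTrajectory ht y) (hX.bdd l₀).continuous (hX.bdd l) ht
    (δ := ε / 4) (fun s hs => by
      rw [← smul_sub, norm_smul, Real.norm_eq_abs]
      have h6 := h3 _ (mem_image_of_mem _ hs) (trajectory (X l₀) t x s) (by simpa using hδ.le)
      rw [norm_sub_rev] at h6
      calc _ ≤ |t| * (ε / (4 * (|t| + 1))) := by gcongr
        _ ≤ ε / 4 := by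
          rw [mul_div_assoc', div_le_div_iff₀ (by positivity) (by positivity)]
          nlinarith [abs_nonneg t]) s hs
  rw [norm_sub_rev]
  rw [norm_sub_rev] at h4
  rw [abs_of_pos (by positivity : 0 < ε / 4)] at h5
  linarith

/-- The derivative is the time-one value of the solution `J` of the variational equation along the
trajectory of `X l₀`. For nearby parameters and starting points, `γ - γ' - J (y - y')` solves an
integral equation with a kernel of constant one half and a forcing term of size `ε / 2 * ‖y - y'‖`,
by the mean value inequality and continuity of the derivatives. -/
theorem IsBddFamily.exists_hasUniformStrictFDerivAt_flow (hX : IsBddFamily C X)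
    (ht : |t| * C ≤ 1 / 2) (l₀ : Λ) (x : V) :
    ∃ A, HasUniformStrictFDerivAt l₀ (fun l => fieldFlow (X l) t) A x := by
  have h0 := (hX.bdd l₀).isTrajectory ht x
  set γ₀ := trajectory (X l₀) t x with hγ₀
  have hDc : Continuous fun τ => fderiv ℝ (X l₀) (γ₀ τ) := (hX.bdd l₀).continuous_fderiv.comp h0.1
  obtain ⟨J, hJc, hJ⟩ := exists_integral_eq (W := V →L[ℝ] V)
    (G := fun τ (A : V →L[ℝ] V) => t • (fderiv ℝ (X l₀) (γ₀ τ) ∘L A)) (B := 0)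
    (fun τ A A' => by
      rw [← smul_sub, ← ContinuousLinearMap.comp_sub, norm_smul, Real.norm_eq_abs]
      calc |t| * _ ≤ |t| * (C * ‖A - A'‖) := by
            gcongr
            exact (ContinuousLinearMap.opNorm_comp_le _ _).trans
              (by gcongr; exact (hX.bdd l₀).fderiv_le _)
        _ = (|t| * C) * ‖A - A'‖ := by ring
        _ ≤ 1 / 2 * ‖A - A'‖ := by gcongr
        _ = _ := by ring)
    (fun τ => by simp)
    (fun γ hγ => Continuous.aestronglyMeasurable ((hDc.clm_comp hγ).const_smul t)) 1
  refine ⟨J 1, ⟨?_, fun ε hε => ?_⟩⟩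
  · rw [Metric.tendsto_nhds]
    intro ε hε
    filter_upwards [hX.eventually_trajectory_sub_le ht l₀ x (half_pos hε)] with z hz
    rw [dist_eq_norm]
    exact (hz 1 (by simp)).trans_lt (half_lt_self hε)
  have hK : IsCompact (γ₀ '' Icc 0 1) := isCompact_Icc.image h0.1
  obtain ⟨δ, hδ, h1⟩ := eventually_forall_norm_sub_le
    (g := fun l y => fderiv ℝ (X l) y) hX.continuous_fderiv l₀ hK (ε := ε / (4 * (|t| + 1))) (by positivity)
  have h2 := hX.eventually_trajectory_sub_le ht l₀ x hδ
  have hp1 : Tendsto (fun z : Λ × V × V => (z.1, z.2.1)) (𝓝 l₀ ×ˢ (𝓝 x ×ˢ 𝓝 x))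
      (𝓝 l₀ ×ˢ 𝓝 x) := tendsto_fst.prodMk (tendsto_fst.comp tendsto_snd)
  have hp2 : Tendsto (fun z : Λ × V × V => (z.1, z.2.2)) (𝓝 l₀ ×ˢ (𝓝 x ×ˢ 𝓝 x))
      (𝓝 l₀ ×ˢ 𝓝 x) := tendsto_fst.prodMk (tendsto_snd.comp tendsto_snd)
  filter_upwards [tendsto_fst.eventually h1, hp1.eventually h2, hp2.eventually h2]
    with ⟨l, y, y'⟩ h3 h4 h5
  simp only at h3 h4 h5 ⊢
  have hl := hX.bdd l
  have hT := hl.isTrajectory ht y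
  have hT' := hl.isTrajectory ht y'
  set γ := trajectory (X l) t y with hγ
  set γ' := trajectory (X l) t y' with hγ'
  have hw : ∀ s ∈ Icc (0 : ℝ) 1, ‖γ s - γ' s‖ ≤ 2 * ‖y - y'‖ := fun s hs => by
    simpa using hl.trajectory_sub_le ht ht y y' hs
  have hint : ∀ s, IntervalIntegrable (fun τ => t • (fderiv ℝ (X l₀) (γ₀ τ) ∘L J τ)) volume 0 s :=
    fun s => ((hDc.clm_comp hJc).const_smul t).intervalIntegrable _ _
  have key := norm_le_of_integral_eq (a := (0 : V)) (δ := ε / 4 * (2 * ‖y - y'‖))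
    (e := fun s => γ s - γ' s - J s (y - y'))
    (g := fun τ => (t • X l (γ τ) - t • X l (γ' τ)) -
      (t • (fderiv ℝ (X l₀) (γ₀ τ) ∘L J τ)) (y - y'))
    ((hT.1.sub hT'.1).sub (hJc.clm_apply continuous_const)).continuousOn
    (fun s hs => by
      have hJs := hJ s hs
      rw [intervalIntegral.integral_sub ((hT.intervalIntegrable hl.continuous _ _).sub
        (hT'.intervalIntegrable hl.continuous _ _)) ?_, intervalIntegral.integral_sub
        (hT.intervalIntegrable hl.continuous _ _) (hT'.intervalIntegrable hl.continuous _ _),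
        ← ContinuousLinearMap.intervalIntegral_apply (hint s), hT.2 s hs, hT'.2 s hs, hJs]
      · simp only [add_apply, one_apply_eq_self]
        abel
      · exact (((hDc.clm_comp hJc).const_smul t).clm_apply continuous_const).intervalIntegrable _ _)
    (by
      rw [ae_restrict_iff' measurableSet_Icc]
      refine ae_of_all _ fun s hs => ?_
      have hmv : ‖X l (γ s) - X l (γ' s) - fderiv ℝ (X l₀) (γ₀ s) (γ s - γ' s)‖
          ≤ ε / (4 * (|t| + 1)) * ‖γ s - γ' s‖ :=
        (convex_closedBall (γ₀ s) δ).norm_image_sub_le_of_norm_hasFDerivWithin_le'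
          (fun x _ => (hl.differentiable x).hasFDerivAt.hasFDerivWithinAt)
          (fun x hx => h3 _ (mem_image_of_mem _ hs) x (by rwa [← dist_eq_norm]))
          (by rw [Metric.mem_closedBall, dist_eq_norm]; exact h5 s hs)
          (by rw [Metric.mem_closedBall, dist_eq_norm]; exact h4 s hs)
      set D := fderiv ℝ (X l₀) (γ₀ s) with hD
      have e1 : t • X l (γ s) - t • X l (γ' s) - (t • (D ∘L J s)) (y - y')
          = t • (X l (γ s) - X l (γ' s) - D (γ s - γ' s))
            + t • D (γ s - γ' s - J s (y - y')) := by
        rw [map_sub D (γ s - γ' s)]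
        simp only [smul_apply, ContinuousLinearMap.comp_apply, smul_sub]
        abel
      have e2 : ‖t • D (γ s - γ' s - J s (y - y'))‖ ≤ ‖γ s - γ' s - J s (y - y')‖ / 2 := by
        rw [norm_smul, Real.norm_eq_abs]
        calc _ ≤ |t| * (C * ‖γ s - γ' s - J s (y - y')‖) := by
              gcongr
              exact (D.le_opNorm _).trans (by gcongr; exact (hX.bdd l₀).fderiv_le _)
          _ = (|t| * C) * ‖γ s - γ' s - J s (y - y')‖ := by ring
          _ ≤ 1 / 2 * ‖γ s - γ' s - J s (y - y')‖ := by gcongr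
          _ = _ := by ring
      have e3 : ‖t • (X l (γ s) - X l (γ' s) - D (γ s - γ' s))‖ ≤ ε / 4 * (2 * ‖y - y'‖) := by
        rw [norm_smul, Real.norm_eq_abs]
        calc _ ≤ |t| * (ε / (4 * (|t| + 1)) * (2 * ‖y - y'‖)) := by
              gcongr
              exact hmv.trans (by gcongr; exact hw s hs)
          _ = (|t| * (ε / (4 * (|t| + 1)))) * (2 * ‖y - y'‖) := by ring
          _ ≤ _ := by
              gcongr
              rw [mul_div_assoc', div_le_div_iff₀ (by positivity) (by positivity)]
              nlinarith [abs_nonneg t]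
      rw [e1]
      refine (norm_add_le _ _).trans ?_
      linarith) 1 (by simp)
  rw [norm_zero, zero_add, abs_of_nonneg (by positivity)] at key
  calc _ ≤ _ := key
    _ = _ := by ring

/-- Here point and time vary jointly around time zero. The error in velocity splits as `(t - t') •
(X l a - X l₀ x) + t' • (X l a - X l b)`. In the first term the bracket is small by continuity. In
the second, `a - b` is controlled by the increment of the data and `t'` is small. -/
theorem IsBddFamily.hasUniformStrictFDerivAt_flow_zero (hX : IsBddFamily C X) (l₀ : Λ) (x : V) :
    HasUniformStrictFDerivAt l₀ (fun l (z : V × ℝ) => fieldFlow (X l) z.2 z.1)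
      (ContinuousLinearMap.fst ℝ V ℝ + (ContinuousLinearMap.snd ℝ V ℝ).smulRight (X l₀ x))
      (x, 0) := by
  have hC := (hX.bdd l₀).nonneg
  set D := C + 1 with hD
  have hD0 : 0 < D := by positivity
  have htD : ∀ ρ > 0, ∀ᶠ t : ℝ in 𝓝 0, |t| * D ≤ ρ := fun ρ hρ => by
    have : ContinuousAt (fun t : ℝ => |t| * D) 0 := by fun_prop
    exact (this.eventually_lt continuousAt_const (by simpa using hρ)).mono fun _ h => h.le
  have htC : ∀ {t ρ : ℝ}, |t| * D ≤ ρ → |t| * C ≤ ρ := fun h => le_trans (by gcongr; linarith) h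
  have hyx : ∀ ρ > 0, ∀ᶠ y : V in 𝓝 x, ‖y - x‖ ≤ ρ := fun ρ hρ => by
    have : ContinuousAt (fun y : V => ‖y - x‖) x := by fun_prop
    exact (this.eventually_lt continuousAt_const (by simpa using hρ)).mono fun _ h => h.le
  refine ⟨?_, fun ε hε => ?_⟩
  · rw [Metric.tendsto_nhds]
    intro ε hε
    rw [nhds_prod_eq]
    filter_upwards [tendsto_snd.eventually ((hyx (ε / 4) (by positivity)).prod_mk
      ((htD (ε / 4) (by positivity)).and (htD (1 / 2) (by positivity))))] with ⟨l, y, t⟩ h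
    obtain ⟨h1, h2, h3⟩ := h
    simp only at h1 h2 h3 ⊢
    rw [(hX.bdd l₀).flow_zero, dist_eq_norm]
    have h4 := (hX.bdd l).flow_sub_le (htC h3) y
    have h5 := htC h2
    linarith [norm_sub_le_norm_sub_add_norm_sub (fieldFlow (X l) t y) y x]
  · obtain ⟨δ, hδ, h1⟩ := eventually_forall_norm_sub_le hX.continuous l₀
      (isCompact_singleton (x := x)) (ε := ε / 4) (by positivity)
    have hyt := (hyx (δ / 2) (by positivity)).prod_mk
      (((htD (δ / 2) (by positivity)).and (htD (1 / 2) (by positivity))).and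
        (htD (ε / (16 * D)) (by positivity)))
    rw [nhds_prod_eq]
    filter_upwards [h1.prod_mk (hyt.prod_mk hyt)] with ⟨l, ⟨y, t⟩, ⟨y', t'⟩⟩ h
    obtain ⟨h2, ⟨h3, ⟨h4, h5⟩, h6⟩, ⟨h3', ⟨h4', h5'⟩, h6'⟩⟩ := h
    simp only [mem_singleton_iff, forall_eq] at h2 h3 h4 h5 h6 h3' h4' h5' h6' ⊢
    have hl := hX.bdd l
    have hT := hl.isTrajectory (htC h5) y
    have hT' := hl.isTrajectory (htC h5') y'
    have hnn : ‖((y, t) : V × ℝ) - (y', t')‖ = max ‖y - y'‖ |t - t'| := rfl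
    have hm1 : ‖y - y'‖ ≤ ‖((y, t) : V × ℝ) - (y', t')‖ := le_max_left _ _
    have hm2 : |t - t'| ≤ ‖((y, t) : V × ℝ) - (y', t')‖ := le_max_right _ _
    set m := ‖((y, t) : V × ℝ) - (y', t')‖
    have e1 : fieldFlow (X l) t y - fieldFlow (X l) t' y' -
        (ContinuousLinearMap.fst ℝ V ℝ + (ContinuousLinearMap.snd ℝ V ℝ).smulRight (X l₀ x))
          ((y, t) - (y', t')) = ∫ τ in (0 : ℝ)..1, ((t • X l (trajectory (X l) t y τ)
            - t' • X l (trajectory (X l) t' y' τ)) - (t - t') • X l₀ x) := by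
      rw [intervalIntegral.integral_sub ((hT.intervalIntegrable hl.continuous _ _).sub
        (hT'.intervalIntegrable hl.continuous _ _)) (by simp), intervalIntegral.integral_sub
        (hT.intervalIntegrable hl.continuous _ _) (hT'.intervalIntegrable hl.continuous _ _),
        hl.flow_eq (htC h5) y, hl.flow_eq (htC h5') y']
      simp only [intervalIntegral.integral_const, sub_zero, one_smul, Prod.mk_sub_mk,
        add_apply, ContinuousLinearMap.coe_fst',
        ContinuousLinearMap.smulRight_apply, ContinuousLinearMap.coe_snd']
      abel
    rw [e1]
    have e2 := intervalIntegral.norm_integral_le_of_norm_le_const (a := 0) (b := 1)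
      (f := fun τ => (t • X l (trajectory (X l) t y τ)
            - t' • X l (trajectory (X l) t' y' τ)) - (t - t') • X l₀ x) (C := ε * m)
      (fun τ hτ => ?_)
    · simpa using e2
    rw [uIoc_of_le zero_le_one] at hτ
    have hτ' : τ ∈ Icc (0 : ℝ) 1 := ⟨hτ.1.le, hτ.2⟩
    set a := trajectory (X l) t y τ
    set b := trajectory (X l) t' y' τ
    have e3 : t • X l a - t' • X l b - (t - t') • X l₀ x
        = (t - t') • (X l a - X l₀ x) + t' • (X l a - X l b) := by
      simp only [sub_smul, smul_sub]; abel
    have ha : ‖X l a - X l₀ x‖ ≤ ε / 4 := h2 a (by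
      have h7 : ‖a - y‖ ≤ |t| * C := hT.norm_sub_start_le hl hτ'
      linarith [norm_sub_le_norm_sub_add_norm_sub a y x, htC h4])
    have hab : ‖a - b‖ ≤ 2 * (‖y - y'‖ + |t - t'| * C) :=
      hl.trajectory_sub_le (htC h5) (htC h5') y y' hτ'
    have hab' : ‖a - b‖ ≤ 4 * D * m := by
      have : |t - t'| * C ≤ m * C := by gcongr
      have hm0 : 0 ≤ m := norm_nonneg _
      nlinarith
    rw [e3]
    refine (norm_add_le _ _).trans ?_
    rw [norm_smul, norm_smul, Real.norm_eq_abs, Real.norm_eq_abs]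
    have e4 : |t - t'| * ‖X l a - X l₀ x‖ ≤ m * (ε / 4) := by gcongr
    have e5 : |t'| * ‖X l a - X l b‖ ≤ |t'| * (D * (4 * D * m)) := by
      gcongr
      exact (hl.norm_sub_le a b).trans (by gcongr; linarith)
    have e6 : |t'| * (D * (4 * D * m)) = |t'| * D * (4 * D * m) := by ring
    have e7 : |t'| * D * (4 * D * m) ≤ ε / (16 * D) * (4 * D * m) := by gcongr
    have e8 : ε / (16 * D) * (4 * D * m) = ε / 4 * m := by field_simp; norm_num
    have e9 : 0 ≤ ε * m := by positivity
    nlinarith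

end Families

/-! ### Compositions of flows -/

section Words

variable {ι V : Type*} [NormedAddCommGroup V] [NormedSpace ℝ V]

/-- The composition of flows of the fields `Z i`, in the order prescribed by the word. -/
noncomputable def wordFlow (Z : ι → V → V) : List (ι × ℝ) → V → V
  | [], y => y
  | p :: w, y => wordFlow Z w (fieldFlow (Z p.1) p.2 y)

/-- The total time of a word. -/
noncomputable def wordCost : List (ι × ℝ) → ℝ
  | [] => 0
  | p :: w => |p.2| + wordCost w

/-- The word that travels back. -/
def wordInv : List (ι × ℝ) → List (ι × ℝ)
  | [] => []
  | p :: w => wordInv w ++ [(p.1, -p.2)]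

@[simp] theorem wordFlow_nil (Z : ι → V → V) (y : V) : wordFlow Z [] y = y := rfl

@[simp] theorem wordFlow_cons (Z : ι → V → V) (p : ι × ℝ) (w : List (ι × ℝ)) (y : V) :
    wordFlow Z (p :: w) y = wordFlow Z w (fieldFlow (Z p.1) p.2 y) := rfl

@[simp] theorem wordCost_nil : wordCost ([] : List (ι × ℝ)) = 0 := rfl

@[simp] theorem wordCost_cons (p : ι × ℝ) (w : List (ι × ℝ)) :
    wordCost (p :: w) = |p.2| + wordCost w := rfl

theorem wordCost_nonneg (w : List (ι × ℝ)) : 0 ≤ wordCost w := by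
  induction w with
  | nil => simp
  | cons p w ih => rw [wordCost_cons]; positivity

theorem wordFlow_append (Z : ι → V → V) (w w' : List (ι × ℝ)) (y : V) :
    wordFlow Z (w ++ w') y = wordFlow Z w' (wordFlow Z w y) := by
  induction w generalizing y with
  | nil => rfl
  | cons p w ih => simp [ih]

theorem wordCost_append (w w' : List (ι × ℝ)) :
    wordCost (w ++ w') = wordCost w + wordCost w' := by
  induction w with
  | nil => simp
  | cons p w ih => simp [ih, add_assoc]

theorem wordCost_inv (w : List (ι × ℝ)) : wordCost (wordInv w) = wordCost w := by
  induction w with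
  | nil => rfl
  | cons p w ih => simp [wordInv, wordCost_append, ih, add_comm]

theorem wordInv_append (w w' : List (ι × ℝ)) :
    wordInv (w ++ w') = wordInv w' ++ wordInv w := by
  induction w with
  | nil => simp [wordInv]
  | cons p w ih => simp [wordInv, ih]

theorem wordInv_inv (w : List (ι × ℝ)) : wordInv (wordInv w) = w := by
  induction w with
  | nil => rfl
  | cons p w ih => simp [wordInv, wordInv_append, ih]

variable [CompleteSpace V] {C : ℝ} {Z : ι → V → V}

theorem wordFlow_sub_le (hZ : ∀ i, IsBddField C (Z i)) (hC : 0 ≤ C) {w : List (ι × ℝ)}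
    (hw : wordCost w * C ≤ 1 / 2) (y : V) : ‖wordFlow Z w y - y‖ ≤ wordCost w * C := by
  induction w generalizing y with
  | nil => simp
  | cons p w ih =>
    rw [wordCost_cons, add_mul] at hw ⊢
    have h1 : 0 ≤ wordCost w * C := mul_nonneg (wordCost_nonneg w) hC
    have h2 : 0 ≤ |p.2| * C := by positivity
    have h3 := ih (by linarith) (fieldFlow (Z p.1) p.2 y)
    have h4 := (hZ p.1).flow_sub_le (t := p.2) (by linarith) y
    rw [wordFlow_cons]
    linarith [norm_sub_le_norm_sub_add_norm_sub (wordFlow Z w (fieldFlow (Z p.1) p.2 y))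
      (fieldFlow (Z p.1) p.2 y) y]

theorem wordFlow_inv_wordFlow (hZ : ∀ i, IsBddField C (Z i)) (hC : 0 ≤ C) {w : List (ι × ℝ)}
    (hw : wordCost w * C ≤ 1 / 2) (y : V) : wordFlow Z (wordInv w) (wordFlow Z w y) = y := by
  induction w generalizing y with
  | nil => rfl
  | cons p w ih =>
    rw [wordCost_cons, add_mul] at hw
    have h1 : 0 ≤ wordCost w * C := mul_nonneg (wordCost_nonneg w) hC
    have h2 : 0 ≤ |p.2| * C := by positivity
    rw [wordInv, wordFlow_append, wordFlow_cons, wordFlow_nil, wordFlow_cons, ih (by linarith),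
      (hZ p.1).flow_neg (by linarith)]

theorem wordFlow_wordFlow_inv (hZ : ∀ i, IsBddField C (Z i)) (hC : 0 ≤ C) {w : List (ι × ℝ)}
    (hw : wordCost w * C ≤ 1 / 2) (y : V) : wordFlow Z w (wordFlow Z (wordInv w) y) = y := by
  have := wordFlow_inv_wordFlow hZ hC (w := wordInv w) (by rwa [wordCost_inv]) y
  rwa [wordInv_inv] at this

theorem exists_hasUniformStrictFDerivAt_wordFlow {Λ : Type*} [TopologicalSpace Λ]
    {X : Λ → ι → V → V} (hX : ∀ i, IsBddFamily C (fun l => X l i)) (hC : 0 ≤ C) (l₀ : Λ)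
    {w : List (ι × ℝ)} (hw : wordCost w * C ≤ 1 / 2) (x : V) :
    ∃ A, HasUniformStrictFDerivAt l₀ (fun l => wordFlow (X l) w) A x := by
  induction w generalizing x with
  | nil => exact ⟨_, HasUniformStrictFDerivAt.of_linear l₀ (ContinuousLinearMap.id ℝ V) x⟩
  | cons p w ih =>
    rw [wordCost_cons, add_mul] at hw
    have h1 : 0 ≤ wordCost w * C := mul_nonneg (wordCost_nonneg w) hC
    have h2 : 0 ≤ |p.2| * C := by positivity
    obtain ⟨A, hA⟩ := (hX p.1).exists_hasUniformStrictFDerivAt_flow (t := p.2) (by linarith) l₀ x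
    obtain ⟨B, hB⟩ := ih (by linarith) (fieldFlow (X l₀ p.1) p.2 x)
    exact ⟨_, HasUniformStrictFDerivAt.comp (h := fun l => wordFlow (X l) w) hB hA⟩

end Words

/-! ### The orbit argument: pushforwards by short words capture all brackets -/

section Orbit

variable {ι V : Type*} [NormedAddCommGroup V] [NormedSpace ℝ V]

/-- The word `w` has total time less than `η`, sends `z` to `x`, and its flow has derivative `A`
at `z`. -/
structure IsTransport (Z : ι → V → V) (η : ℝ) (x : V) (w : List (ι × ℝ)) (z : V)
    (A : V →L[ℝ] V) : Prop where
  cost_lt : wordCost w < η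
  flow_eq : wordFlow Z w z = x
  hasFDerivAt : HasFDerivAt (wordFlow Z w) A z

/-- The span at `x` of the fields `Z i` transported by short words. -/
def orbitSpan (Z : ι → V → V) (η : ℝ) (x : V) : Submodule ℝ V :=
  Submodule.span ℝ {v | ∃ w z A i, IsTransport Z η x w z A ∧ A (Z i z) = v}

/-- The field `W`, smooth on `O`, is carried into `orbitSpan Z η x` by short words. -/
def IsOrbitField (Z : ι → V → V) (η : ℝ) (x : V) (O : Set V) (W : V → V) : Prop :=
  ContDiffOn ℝ ∞ W O ∧ ∀ w z A, IsTransport Z η x w z A → A (W z) ∈ orbitSpan Z η x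

/-- The orbit fields whose brackets with orbit fields are orbit fields. -/
def IsOrbitNormalizer (Z : ι → V → V) (η : ℝ) (x : V) (O : Set V) (Y : V → V) : Prop :=
  IsOrbitField Z η x O Y ∧
    ∀ W, IsOrbitField Z η x O W → IsOrbitField Z η x O (VectorField.lieBracket ℝ Y W)

variable [CompleteSpace V] {C η : ℝ} {Z : ι → V → V} {x : V} {O : Set V}

/-- A word of total time below `η` displaces points by at most `η * C`, so every transport to `x`
starts in `O`. Fields therefore matter only through their restriction to `O`. -/
theorem IsTransport.mem (hZ : ∀ i, IsBddField C (Z i)) (hC : 0 ≤ C) (hη : η * C ≤ 1 / 2)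
    (hO : ∀ z, ‖z - x‖ ≤ η * C → z ∈ O) {w : List (ι × ℝ)} {z : V} {A : V →L[ℝ] V}
    (h : IsTransport Z η x w z A) : z ∈ O := by
  have hw : wordCost w * C ≤ η * C := by gcongr; exact h.cost_lt.le
  have := wordFlow_sub_le hZ hC (hw.trans hη) z
  rw [h.flow_eq, norm_sub_rev] at this
  exact hO z (this.trans hw)

theorem contDiffOn_lieBracket (hOo : IsOpen O) {Y W : V → V} (hY : ContDiffOn ℝ ∞ Y O)
    (hW : ContDiffOn ℝ ∞ W O) : ContDiffOn ℝ ∞ (VectorField.lieBracket ℝ Y W) O := fun z hz =>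
  ((hY.contDiffAt (hOo.mem_nhds hz)).lieBracket_vectorField (m := ∞)
    (hW.contDiffAt (hOo.mem_nhds hz)) (by simp)).contDiffWithinAt

/-- Transporting a field along the flow of `Z` differentiates to the Lie bracket. -/
theorem IsBddField.hasDerivAt_transport {Z : V → V} (hZ : IsBddField C Z) {W : V → V} {z : V}
    (hW : DifferentiableAt ℝ W z)
    (hdiff : ∀ t, |t| * C ≤ 1 / 2 → Differentiable ℝ (fieldFlow Z t)) :
    HasDerivAt (fun t => fderiv ℝ (fieldFlow Z t) (fieldFlow Z (-t) z) (W (fieldFlow Z (-t) z)))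
      (-VectorField.lieBracket ℝ Z W z) 0 := by
  have hsmall : ∀ ρ > 0, ∀ᶠ t : ℝ in 𝓝 0, |t| * C ≤ ρ := fun ρ hρ => by
    have : ContinuousAt (fun t : ℝ => |t| * C) 0 := by fun_prop
    exact (this.eventually_lt continuousAt_const (by simpa using hρ)).mono fun _ h => h.le
  have hC := hZ.nonneg
  have hflow : HasDerivAt (fun t => fieldFlow Z (-t) z) (-Z z) 0 := by
    rw [hasDerivAt_iff_isLittleO]
    refine Asymptotics.IsLittleO.of_bound fun ε hε => ?_
    have h1 : ∀ᶠ t : ℝ in 𝓝 0, |t| * C * C ≤ ε := by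
      have : ContinuousAt (fun t : ℝ => |t| * C * C) 0 := by fun_prop
      exact (this.eventually_lt continuousAt_const (by simpa using hε)).mono fun _ h => h.le
    filter_upwards [hsmall (1 / 2) (by norm_num), h1] with t ht h2
    have h3 := hZ.flow_sub_sub_le (t := -t) (by rwa [abs_neg]) z
    rw [abs_neg] at h3
    rw [neg_zero, hZ.flow_zero, sub_zero, smul_neg, ← neg_smul, Real.norm_eq_abs]
    calc _ ≤ _ := h3
      _ = |t| * C * C * |t| := by ring
      _ ≤ _ := by gcongr
  have hW0 : HasDerivAt (fun t => W (fieldFlow Z (-t) z)) (fderiv ℝ W z (-Z z)) 0 := by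
    have h : HasFDerivAt W (fderiv ℝ W z) (fieldFlow Z (-0) z) := by
      rw [neg_zero, hZ.flow_zero]; exact hW.hasFDerivAt
    exact h.comp_hasDerivAt 0 hflow
  have hlin : HasDerivAt (fun t => t • fderiv ℝ Z z (W (fieldFlow Z (-t) z)))
      (fderiv ℝ Z z (W z)) 0 := by
    have h := (hasDerivAt_id (0 : ℝ)).smul ((fderiv ℝ Z z).hasFDerivAt.comp_hasDerivAt 0 hW0)
    simp only [id_eq, zero_smul, one_smul, zero_add, Function.comp_apply, neg_zero,
      hZ.flow_zero] at h
    exact h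
  -- The pushforward is `W + t • fderiv ℝ Z z W + o(t)`, with `W` taken at the moving point
  -- `fieldFlow Z (-t) z`. The remainder is `o(t)` because `flow_lipschitz_sub` bounds the Lipschitz
  -- constant, hence the derivative, of the flow minus its first-order expansion near `z`. No second
  -- derivative of the flow is needed.
  have hrem : HasDerivAt (fun t => fderiv ℝ (fieldFlow Z t) (fieldFlow Z (-t) z)
      (W (fieldFlow Z (-t) z)) - W (fieldFlow Z (-t) z)
        - t • fderiv ℝ Z z (W (fieldFlow Z (-t) z))) 0 0 := by
    have hid : fieldFlow Z 0 = id := funext fun y => hZ.flow_zero y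
    rw [hasDerivAt_iff_isLittleO]
    refine Asymptotics.IsLittleO.of_bound fun ε hε => ?_
    obtain ⟨δ, hδ, h1⟩ := hZ.flow_lipschitz_sub z (ε := ε / (‖W z‖ + 1)) (by positivity)
    have h2 : ∀ᶠ t : ℝ in 𝓝 0, ‖fieldFlow Z (-t) z - z‖ < δ := by
      have : ContinuousAt (fun t : ℝ => ‖fieldFlow Z (-t) z - z‖) 0 :=
        (hflow.continuousAt.sub continuousAt_const).norm
      exact this.eventually_lt continuousAt_const (by simpa [hZ.flow_zero] using hδ)
    have h3 : ∀ᶠ t : ℝ in 𝓝 0, ‖W (fieldFlow Z (-t) z)‖ ≤ ‖W z‖ + 1 := by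
      have : ContinuousAt (fun t : ℝ => ‖W (fieldFlow Z (-t) z)‖) 0 := hW0.continuousAt.norm
      exact (this.eventually_lt continuousAt_const (by simp [hZ.flow_zero])).mono
        fun _ h => h.le
    have h4 : ∀ᶠ t : ℝ in 𝓝 0, |t| ≤ δ := by
      have : ContinuousAt (fun t : ℝ => |t|) 0 := by fun_prop
      exact (this.eventually_lt continuousAt_const (by simpa using hδ)).mono fun _ h => h.le
    filter_upwards [hsmall (1 / 2) (by norm_num), h2, h3, h4] with t ht h2 h3 h4
    simp only [neg_zero, hZ.flow_zero, hid, fderiv_id, ContinuousLinearMap.id_apply, sub_self,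
      zero_smul, smul_zero, sub_zero, Real.norm_eq_abs]
    set zt := fieldFlow Z (-t) z
    have hd : HasFDerivAt (fun y => fieldFlow Z t y - y - t • fderiv ℝ Z z y)
        (fderiv ℝ (fieldFlow Z t) zt - ContinuousLinearMap.id ℝ V - t • fderiv ℝ Z z) zt :=
      ((hdiff t ht zt).hasFDerivAt.sub (hasFDerivAt_id zt)).sub
        ((fderiv ℝ Z z).hasFDerivAt.const_smul t)
    have hb := hd.le_of_lip' (C := ε / (‖W z‖ + 1) * |t|) (by positivity) (by
      have hnear : ∀ᶠ y in 𝓝 zt, ‖y - z‖ < δ := by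
        have : ContinuousAt (fun y : V => ‖y - z‖) zt := by fun_prop
        exact this.eventually_lt continuousAt_const h2
      filter_upwards [hnear] with y hy
      have := h1 t h4 y zt hy.le h2.le
      refine le_trans (le_of_eq ?_) this
      rw [map_sub, smul_sub]
      congr 1
      abel)
    calc _ = ‖(fderiv ℝ (fieldFlow Z t) zt - ContinuousLinearMap.id ℝ V - t • fderiv ℝ Z z)
          (W zt)‖ := by simp
      _ ≤ (ε / (‖W z‖ + 1) * |t|) * (‖W z‖ + 1) :=
          (ContinuousLinearMap.le_opNorm _ _).trans (by gcongr)
      _ = ε * |t| := by field_simp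
  have hsum := (hrem.add hW0).add hlin
  have e : -VectorField.lieBracket ℝ Z W z = 0 + fderiv ℝ W z (-Z z) + fderiv ℝ Z z (W z) := by
    simp only [VectorField.lieBracket, map_neg]; abel
  rw [e]
  exact hsum.congr_of_eventuallyEq (Eventually.of_forall fun t => by
    simp only [Pi.add_apply]; abel)

theorem IsBddField.differentiable_flow {Z : V → V} (hZ : IsBddField C Z) {t : ℝ}
    (ht : |t| * C ≤ 1 / 2) : Differentiable ℝ (fieldFlow Z t) := fun x => by
  have hX : IsBddFamily C (fun _ : Unit => Z) :=
    ⟨fun _ => hZ, hZ.continuous.comp continuous_snd, hZ.continuous_fderiv.comp continuous_snd⟩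
  obtain ⟨A, hA⟩ := hX.exists_hasUniformStrictFDerivAt_flow ht () x
  exact hA.hasFDerivAt.differentiableAt

/-- Putting `(i, t)` in front of `w` still gives a short word for small `t`, because the cost bound
is strict. Hence a curve through `A (W z)`, obtained by transporting `W` along the flow of `Z i`,
stays in `orbitSpan`. That subspace is closed in finite dimension, so it contains the derivative of
the curve at zero, which is minus the image under `A` of the bracket. -/
theorem IsOrbitField.lieBracket_left [FiniteDimensional ℝ V] (hZ : ∀ i, IsBddField C (Z i))
    (hC : 0 ≤ C) (hη : η * C ≤ 1 / 2)
    (hOo : IsOpen O) (hO : ∀ z, ‖z - x‖ ≤ η * C → z ∈ O) (hZs : ∀ i, ContDiffOn ℝ ∞ (Z i) O)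
    (i : ι) {W : V → V} (hW : IsOrbitField Z η x O W) :
    IsOrbitField Z η x O (VectorField.lieBracket ℝ (Z i) W) := by
  refine ⟨contDiffOn_lieBracket hOo (hZs i) hW.1, fun w z A h => ?_⟩
  have hz := h.mem hZ hC hη hO
  have hWd : DifferentiableAt ℝ W z :=
    (hW.1.contDiffAt (hOo.mem_nhds hz)).differentiableAt (by simp)
  have hder := A.hasFDerivAt.comp_hasDerivAt 0
    ((hZ i).hasDerivAt_transport hWd fun t ht => (hZ i).differentiable_flow ht)
  have hclosed : IsClosed (orbitSpan Z η x : Set V) := Submodule.closed_of_finiteDimensional _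
  have hmem : ∀ᶠ t : ℝ in 𝓝 0, A (fderiv ℝ (fieldFlow (Z i) t) (fieldFlow (Z i) (-t) z)
      (W (fieldFlow (Z i) (-t) z))) ∈ orbitSpan Z η x := by
    have h1 : ∀ᶠ t : ℝ in 𝓝 0, |t| + wordCost w < η := by
      have : ContinuousAt (fun t : ℝ => |t| + wordCost w) 0 := by fun_prop
      exact this.eventually_lt continuousAt_const (by simpa using h.cost_lt)
    filter_upwards [h1] with t ht
    have htC : |t| * C ≤ 1 / 2 := le_trans (by
      gcongr; linarith [wordCost_nonneg w]) hη
    have hback : fieldFlow (Z i) t (fieldFlow (Z i) (-t) z) = z := by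
      simpa using (hZ i).flow_neg (t := -t) (by rwa [abs_neg]) z
    refine hW.2 ((i, t) :: w) (fieldFlow (Z i) (-t) z) (A ∘L _) ⟨by simpa using ht, ?_, ?_⟩
    · rw [wordFlow_cons, hback, h.flow_eq]
    · have hA : HasFDerivAt (wordFlow Z w) A (fieldFlow (Z i) t (fieldFlow (Z i) (-t) z)) := by
        rw [hback]; exact h.hasFDerivAt
      exact hA.comp _ ((hZ i).differentiable_flow htC _).hasFDerivAt
  have hslope := hasDerivAt_iff_tendsto_slope.1 hder
  have hlim := hclosed.mem_of_tendsto hslope (by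
    filter_upwards [hmem.filter_mono nhdsWithin_le_nhds] with t ht
    exact Submodule.smul_mem _ _ (Submodule.sub_mem _ ht hmem.self_of_nhds))
  rw [map_neg] at hlim
  simpa using Submodule.neg_mem _ hlim

namespace IsOrbitField

variable {W W' : V → V}

theorem zero : IsOrbitField Z η x O (fun _ => 0) :=
  ⟨contDiffOn_const, fun w z A _ => by rw [map_zero]; exact Submodule.zero_mem _⟩

theorem add (h : IsOrbitField Z η x O W) (h' : IsOrbitField Z η x O W') :
    IsOrbitField Z η x O (fun z => W z + W' z) :=
  ⟨h.1.add h'.1, fun w z A ht => by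
    rw [map_add]; exact Submodule.add_mem _ (h.2 w z A ht) (h'.2 w z A ht)⟩

theorem smul (c : ℝ) (h : IsOrbitField Z η x O W) : IsOrbitField Z η x O (fun z => c • W z) :=
  ⟨h.1.const_smul c, fun w z A ht => by
    rw [map_smul]; exact Submodule.smul_mem _ _ (h.2 w z A ht)⟩

theorem congr (hZ : ∀ i, IsBddField C (Z i)) (hC : 0 ≤ C) (hη : η * C ≤ 1 / 2)
    (hO : ∀ z, ‖z - x‖ ≤ η * C → z ∈ O) (h : IsOrbitField Z η x O W) (hWW' : EqOn W' W O) :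
    IsOrbitField Z η x O W' :=
  ⟨h.1.congr hWW', fun w z A ht => by
    rw [hWW' (ht.mem hZ hC hη hO)]; exact h.2 w z A ht⟩

theorem base (hZs : ∀ i, ContDiffOn ℝ ∞ (Z i) O) (i : ι) : IsOrbitField Z η x O (Z i) :=
  ⟨hZs i, fun w z A ht => Submodule.subset_span ⟨w, z, A, i, ht, rfl⟩⟩

end IsOrbitField

namespace IsOrbitNormalizer

variable {Y Y' : V → V}

theorem lieBracket_congr_left (hOo : IsOpen O) (hYY' : EqOn Y' Y O) (W : V → V) :
    EqOn (VectorField.lieBracket ℝ Y' W) (VectorField.lieBracket ℝ Y W) O := fun _ hz =>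
  Filter.EventuallyEq.lieBracket_vectorField_eq
    (Filter.eventuallyEq_of_mem (hOo.mem_nhds hz) hYY') (Filter.EventuallyEq.refl _ _)

theorem congr (hZ : ∀ i, IsBddField C (Z i)) (hC : 0 ≤ C) (hη : η * C ≤ 1 / 2)
    (hOo : IsOpen O)
    (hO : ∀ z, ‖z - x‖ ≤ η * C → z ∈ O) (h : IsOrbitNormalizer Z η x O Y) (hYY' : EqOn Y' Y O) :
    IsOrbitNormalizer Z η x O Y' :=
  ⟨h.1.congr hZ hC hη hO hYY', fun W hW =>
    (h.2 W hW).congr hZ hC hη hO (lieBracket_congr_left hOo hYY' W)⟩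

theorem base [FiniteDimensional ℝ V] (hZ : ∀ i, IsBddField C (Z i)) (hC : 0 ≤ C)
    (hη : η * C ≤ 1 / 2) (hOo : IsOpen O) (hO : ∀ z, ‖z - x‖ ≤ η * C → z ∈ O)
    (hZs : ∀ i, ContDiffOn ℝ ∞ (Z i) O) (i : ι) : IsOrbitNormalizer Z η x O (Z i) :=
  ⟨IsOrbitField.base hZs i, fun _ hW => hW.lieBracket_left hZ hC hη hOo hO hZs i⟩

theorem zero : IsOrbitNormalizer Z η x O (fun _ => 0) :=
  ⟨IsOrbitField.zero, fun W _ => by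
    have : VectorField.lieBracket ℝ (fun _ => (0 : V)) W = fun _ => 0 :=
      VectorField.lieBracket_zero_left
    rw [this]; exact IsOrbitField.zero⟩

theorem add (hZ : ∀ i, IsBddField C (Z i)) (hC : 0 ≤ C) (hη : η * C ≤ 1 / 2)
    (hOo : IsOpen O) (hO : ∀ z, ‖z - x‖ ≤ η * C → z ∈ O)
    (h : IsOrbitNormalizer Z η x O Y) (h' : IsOrbitNormalizer Z η x O Y') :
    IsOrbitNormalizer Z η x O (fun z => Y z + Y' z) :=
  ⟨h.1.add h'.1, fun W hW => ((h.2 W hW).add (h'.2 W hW)).congr hZ hC hη hO fun _ hz =>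
    VectorField.lieBracket_add_left
      ((h.1.1.contDiffAt (hOo.mem_nhds hz)).differentiableAt (by simp))
      ((h'.1.1.contDiffAt (hOo.mem_nhds hz)).differentiableAt (by simp))⟩

theorem smul (hZ : ∀ i, IsBddField C (Z i)) (hC : 0 ≤ C) (hη : η * C ≤ 1 / 2)
    (hOo : IsOpen O) (hO : ∀ z, ‖z - x‖ ≤ η * C → z ∈ O)
    (c : ℝ) (h : IsOrbitNormalizer Z η x O Y) :
    IsOrbitNormalizer Z η x O (fun z => c • Y z) :=
  ⟨h.1.smul c, fun W hW => ((h.2 W hW).smul c).congr hZ hC hη hO fun _ hz =>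
    VectorField.lieBracket_const_smul_left
      ((h.1.1.contDiffAt (hOo.mem_nhds hz)).differentiableAt (by simp))⟩

/-- By the Jacobi identity, bracketing with `[Y, Y']` is the commutator of bracketing with `Y` and
with `Y'`. So the normalizers form a Lie algebra. It contains the `Z i`, and hence everything they
generate. -/
theorem lieBracket (hZ : ∀ i, IsBddField C (Z i)) (hC : 0 ≤ C) (hη : η * C ≤ 1 / 2)
    (hOo : IsOpen O) (hO : ∀ z, ‖z - x‖ ≤ η * C → z ∈ O)
    (h : IsOrbitNormalizer Z η x O Y) (h' : IsOrbitNormalizer Z η x O Y') :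
    IsOrbitNormalizer Z η x O (VectorField.lieBracket ℝ Y Y') :=
  ⟨h.2 Y' h'.1, fun W hW =>
    ((h.2 _ (h'.2 W hW)).add ((h'.2 _ (h.2 W hW)).smul (-1))).congr hZ hC hη hO fun z hz => by
      have := VectorField.leibniz_identity_lieBracket (𝕜 := ℝ) (n := ∞)
        (by simp only [minSmoothness_of_isRCLikeNormedField]; exact WithTop.coe_le_coe.2 (le_top : (2 : ℕ∞) ≤ ⊤))
        (h.1.1.contDiffAt (hOo.mem_nhds hz)) (h'.1.1.contDiffAt (hOo.mem_nhds hz))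
        (hW.1.contDiffAt (hOo.mem_nhds hz))
      rw [this]
      simp⟩

/-- The empty word transports `x` to itself with derivative the identity. -/
theorem apply_mem (hη : 0 < η) (h : IsOrbitNormalizer Z η x O Y) : Y x ∈ orbitSpan Z η x :=
  h.1.2 [] x (ContinuousLinearMap.id ℝ V) ⟨hη, rfl, hasFDerivAt_id x⟩

end IsOrbitNormalizer

end Orbit

/-! ### Detours and a parameter-uniform open mapping argument -/

section Surjectivity

variable {ι V : Type*} [NormedAddCommGroup V] [NormedSpace ℝ V]

/-- The word that successively performs the detours `w k`, moving along the field `i k` for the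
time `c k` at the far end of each. -/
def detourWord {κ : Type*} (w : κ → List (ι × ℝ)) (i : κ → ι) (c : κ → ℝ) :
    List κ → List (ι × ℝ)
  | [] => []
  | k :: L => wordInv (w k) ++ (i k, c k) :: w k ++ detourWord w i c L

theorem wordCost_detourWord_le {κ : Type*} {w : κ → List (ι × ℝ)} {i : κ → ι} {c : κ → ℝ} {η : ℝ}
    (hw : ∀ k, wordCost (w k) ≤ η) (hc : ∀ k, |c k| ≤ η) (L : List κ) :
    wordCost (detourWord w i c L) ≤ L.length * (3 * η) := by
  induction L with
  | nil => simp [detourWord]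
  | cons k L ih =>
    simp only [detourWord, wordCost_append, wordCost_inv, wordCost_cons, List.length_cons,
      Nat.cast_add, Nat.cast_one]
    linarith [hw k, hc k]

variable [CompleteSpace V] {C η : ℝ} {x : V}

theorem wordFlow_detourWord_zero {Z : ι → V → V} (hZ : ∀ i, IsBddField C (Z i)) (hC : 0 ≤ C)
    {κ : Type*} {w : κ → List (ι × ℝ)} {i : κ → ι} {c : κ → ℝ}
    (hw : ∀ k, wordCost (w k) * C ≤ 1 / 2) (hc : ∀ k, c k = 0) (L : List κ) (y : V) :
    wordFlow Z (detourWord w i c L) y = y := by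
  induction L with
  | nil => rfl
  | cons k L ih =>
    rw [detourWord, wordFlow_append, wordFlow_append, wordFlow_cons, hc k, (hZ _).flow_zero,
      wordFlow_wordFlow_inv hZ hC (hw k), ih]

variable {Λ : Type*} [TopologicalSpace Λ] {X : Λ → ι → V → V}

/-- At time zero and parameter `l₀` the detour is the identity, which accounts for the derivative in
the starting point. The motion along the field `i` at the far end `z` reaches `x` through the
derivative `A` of the return word. -/
theorem hasUniformStrictFDerivAt_detour (hX : ∀ i, IsBddFamily C (fun l => X l i)) (hC : 0 ≤ C)
    (hη : η * C ≤ 1 / 2) (l₀ : Λ) {w : List (ι × ℝ)} {z : V} {A : V →L[ℝ] V}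
    (h : IsTransport (X l₀) η x w z A) (i : ι) :
    HasUniformStrictFDerivAt l₀
      (fun l (q : V × ℝ) => wordFlow (X l) (wordInv w ++ (i, q.2) :: w) q.1)
      (ContinuousLinearMap.fst ℝ V ℝ
        + (ContinuousLinearMap.snd ℝ V ℝ).smulRight (A (X l₀ i z))) (x, 0) := by
  have hZ : ∀ l i, IsBddField C (X l i) := fun l i => (hX i).bdd l
  have hw : wordCost w * C ≤ 1 / 2 := le_trans (by gcongr; exact h.cost_lt.le) hη
  obtain ⟨A', hA'⟩ := exists_hasUniformStrictFDerivAt_wordFlow hX hC l₀ (w := wordInv w)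
    (by rwa [wordCost_inv]) x
  obtain ⟨A₁, hA₁⟩ := exists_hasUniformStrictFDerivAt_wordFlow hX hC l₀ hw z
  obtain rfl : A₁ = A := hA₁.hasFDerivAt.unique h.hasFDerivAt
  have hinv : wordFlow (X l₀) (wordInv w) x = z := by
    rw [← h.flow_eq]; exact wordFlow_inv_wordFlow (hZ l₀) hC hw z
  have hcomp : A₁ ∘L A' = ContinuousLinearMap.id ℝ V := by
    have h1 : HasFDerivAt (wordFlow (X l₀) w) A₁ (wordFlow (X l₀) (wordInv w) x) := by
      rw [hinv]; exact hA₁.hasFDerivAt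
    have h2 := h1.comp x hA'.hasFDerivAt
    have h3 : wordFlow (X l₀) w ∘ wordFlow (X l₀) (wordInv w) = id :=
      funext fun y => wordFlow_wordFlow_inv (hZ l₀) hC hw y
    rw [h3] at h2
    exact h2.unique (hasFDerivAt_id x)
  have s1 : HasUniformStrictFDerivAt l₀
      (fun l (q : V × ℝ) => (wordFlow (X l) (wordInv w) q.1, q.2))
      ((A' ∘L ContinuousLinearMap.fst ℝ V ℝ).prod (ContinuousLinearMap.snd ℝ V ℝ)) (x, 0) :=
    (HasUniformStrictFDerivAt.comp (h := fun l => wordFlow (X l) (wordInv w))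
      (g := fun _ (q : V × ℝ) => q.1) (x := (x, (0 : ℝ))) hA'
      (HasUniformStrictFDerivAt.of_linear l₀ (ContinuousLinearMap.fst ℝ V ℝ) _)).prodMk
      (HasUniformStrictFDerivAt.of_linear l₀ (ContinuousLinearMap.snd ℝ V ℝ) _)
  have s2 := HasUniformStrictFDerivAt.comp
    (h := fun l (q : V × ℝ) => fieldFlow (X l i) q.2 q.1) (x := (x, (0 : ℝ)))
    (by have := (hX i).hasUniformStrictFDerivAt_flow_zero l₀ z
        simpa only [hinv] using this) s1
  have s3 := HasUniformStrictFDerivAt.comp (h := fun l => wordFlow (X l) w) (x := (x, (0 : ℝ)))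
    (by simpa only [hinv, (hZ l₀ i).flow_zero] using hA₁) s2
  convert s3 using 1
  · ext l q
    rw [wordFlow_append, wordFlow_cons]
  · ext q
    · have := congrArg (fun B : V →L[ℝ] V => B q) hcomp
      simpa using this.symm
    · simp

/-- With zero times each detour is a loop at `x`, so the next detour is again linearised at `x` and
the velocities add up. Making the times linear functions of one vector of `V` gives a map between
spaces of equal dimension. -/
theorem hasUniformStrictFDerivAt_detourWord (hX : ∀ i, IsBddFamily C (fun l => X l i))
    (hC : 0 ≤ C) (hη : η * C ≤ 1 / 2) (l₀ : Λ) {κ : Type*} {w : κ → List (ι × ℝ)} {z : κ → V}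
    {A : κ → V →L[ℝ] V} (h : ∀ k, IsTransport (X l₀) η x (w k) (z k) (A k)) (i : κ → ι)
    (c : κ → V →L[ℝ] ℝ) (L : List κ) :
    HasUniformStrictFDerivAt l₀
      (fun l (q : V × V) => wordFlow (X l) (detourWord w i (fun k => c k q.2) L) q.1)
      (ContinuousLinearMap.fst ℝ V V + (L.map fun k =>
        (c k).smulRight (A k (X l₀ (i k) (z k)))).sum ∘L ContinuousLinearMap.snd ℝ V V) (x, 0) := by
  have hZ : ∀ l i, IsBddField C (X l i) := fun l i => (hX i).bdd l
  induction L with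
  | nil =>
    simpa [detourWord] using
      HasUniformStrictFDerivAt.of_linear l₀ (ContinuousLinearMap.fst ℝ V V) (x, (0 : V))
  | cons k L ih =>
    have hw : wordCost (w k) * C ≤ 1 / 2 := le_trans (by gcongr; exact (h k).cost_lt.le) hη
    have s0 : HasUniformStrictFDerivAt l₀ (fun _ (q : V × V) => (q.1, c k q.2))
        ((ContinuousLinearMap.fst ℝ V V).prod (c k ∘L ContinuousLinearMap.snd ℝ V V)) (x, 0) :=
      HasUniformStrictFDerivAt.of_linear l₀
        ((ContinuousLinearMap.fst ℝ V V).prod (c k ∘L ContinuousLinearMap.snd ℝ V V)) (x, 0)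
    have s1 := HasUniformStrictFDerivAt.comp
      (h := fun l (q : V × ℝ) => wordFlow (X l) (wordInv (w k) ++ (i k, q.2) :: w k) q.1)
      (x := (x, (0 : V)))
      (by simpa only [map_zero] using hasUniformStrictFDerivAt_detour hX hC hη l₀ (h k) (i k)) s0
    have s2 := s1.prodMk
      (HasUniformStrictFDerivAt.of_linear l₀ (ContinuousLinearMap.snd ℝ V V) (x, 0))
    have hz : wordFlow (X l₀) (wordInv (w k) ++ (i k, c k (0 : V)) :: w k) x = x := by
      rw [map_zero, wordFlow_append, wordFlow_cons, (hZ _ _).flow_zero,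
        wordFlow_wordFlow_inv (hZ l₀) hC hw]
    have s3 := HasUniformStrictFDerivAt.comp
      (h := fun l (q : V × V) => wordFlow (X l) (detourWord w i (fun k => c k q.2) L) q.1)
      (x := (x, (0 : V))) (by simpa only [hz, ContinuousLinearMap.coe_snd'] using ih) s2
    convert s3 using 1
    · ext l q
      rw [detourWord, wordFlow_append]
      rfl
    · refine ContinuousLinearMap.ext fun q => ?_
      simp [add_assoc]

/-- If short transported fields span at `x`, then, for parameters near `l₀`, all points near `x`
can be joined by short words. -/
theorem eventually_exists_wordFlow_eq [FiniteDimensional ℝ V]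
    (hX : ∀ i, IsBddFamily C (fun l => X l i))
    (hC : 0 ≤ C) (hη0 : 0 < η) (hη : η * C ≤ 1 / 2) (l₀ : Λ) (hspan : orbitSpan (X l₀) η x = ⊤) :
    ∃ U ∈ 𝓝 x, ∀ᶠ l in 𝓝 l₀, ∀ y ∈ U, ∀ z ∈ U,
      ∃ w, wordCost w ≤ Module.finrank ℝ V * (3 * η) ∧ wordFlow (X l) w y = z := by
  have hZ : ∀ l i, IsBddField C (X l i) := fun l i => (hX i).bdd l
  set b := Module.Basis.ofSpan hspan.ge with hb
  have hmem : ∀ k, ∃ w z A i, IsTransport (X l₀) η x w z A ∧ A (X l₀ i z) = b k := fun k =>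
    Module.Basis.ofSpan_subset hspan.ge (mem_range_self k)
  choose w z A i ht hA using hmem
  have : Fintype ((linearIndepOn_empty ℝ (id : V → V)).extend (empty_subset
    {v | ∃ w z A i, IsTransport (X l₀) η x w z A ∧ A (X l₀ i z) = v})) :=
    @Fintype.ofFinite _ (Module.Finite.finite_basis b)
  -- With the coordinates in the basis `b` as times, the derivative becomes `(v, ξ) ↦ v + ξ`, the
  -- identity in `ξ`.
  set c := fun k => LinearMap.toContinuousLinearMap (b.coord k) with hc
  set L := (Finset.univ : Finset ((linearIndepOn_empty ℝ (id : V → V)).extend (empty_subset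
    {v | ∃ w z A i, IsTransport (X l₀) η x w z A ∧ A (X l₀ i z) = v}))).toList with hL
  have hstrict := hasUniformStrictFDerivAt_detourWord hX hC hη l₀ ht i c L
  have hlen : L.length = Module.finrank ℝ V := by
    rw [hL, Finset.length_toList, Finset.card_univ, Module.finrank_eq_card_basis b]
  have hsum : ∀ v ξ : V, (ContinuousLinearMap.fst ℝ V V + (L.map fun k =>
      (c k).smulRight (A k (X l₀ (i k) (z k)))).sum ∘L ContinuousLinearMap.snd ℝ V V) (v, ξ)
        = v + ξ := fun v ξ => by
    rw [add_apply, ContinuousLinearMap.comp_apply, hL, Finset.sum_map_toList, sum_apply]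
    congr 1
    conv_rhs => rw [← b.sum_repr ξ]
    refine Finset.sum_congr rfl fun k _ => ?_
    simp [hA, hc]
  have hev := hstrict.norm_le (1 / 4) (by norm_num)
  rw [eventually_prod_iff] at hev
  obtain ⟨p, hp, q, hq, hpq⟩ := hev
  rw [← nhds_prod_eq] at hq
  obtain ⟨ρ, hρ, hρ'⟩ := Metric.eventually_nhds_iff.1 hq
  have hcoord : ∀ᶠ ξ in 𝓝 (0 : V), ∀ k, |c k ξ| < η := by
    refine eventually_all.2 fun k => ?_
    have : ContinuousAt (fun ξ : V => |c k ξ|) 0 := by fun_prop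
    exact this.eventually_lt continuousAt_const (by simpa using hη0)
  obtain ⟨σ, hσ, hσ'⟩ := Metric.eventually_nhds_iff.1 hcoord
  set r := min ρ σ / 2 with hr
  have hr0 : 0 < r := by positivity
  have hrρ : r < ρ := by
    have := min_le_left ρ σ
    have : 0 < min ρ σ := by positivity
    linarith
  have hrσ : r < σ := by
    have := min_le_right ρ σ
    have : 0 < min ρ σ := by positivity
    linarith
  refine ⟨Metric.ball x (r / 4), Metric.ball_mem_nhds _ (by positivity), ?_⟩
  filter_upwards [hp] with l hl y hy z' hz'
  rw [Metric.mem_ball] at hy hz'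
  have happ : ApproximatesLinearOn
      (fun ξ => wordFlow (X l) (detourWord w i (fun k => c k ξ) L) y)
      (ContinuousLinearMap.id ℝ V) (Metric.closedBall 0 r) (1 / 4) := by
    intro ξ hξ ξ' hξ'
    have h1 := hpq hl (y := ((y, ξ), (y, ξ'))) (hρ' ?_)
    · simp only [Prod.mk_sub_mk, sub_self, hsum, zero_add] at h1
      have h2 : ‖((0 : V), ξ - ξ')‖ = ‖ξ - ξ'‖ := by
        rw [Prod.norm_mk, norm_zero]; exact max_eq_right (norm_nonneg _)
      rw [h2] at h1
      refine h1.trans (le_of_eq ?_)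
      push_cast; rfl
    · rw [Metric.mem_closedBall] at hξ hξ'
      simp only [Prod.dist_eq, max_lt_iff]
      exact ⟨⟨by linarith, by linarith⟩, by linarith, by linarith⟩
  -- A map within `1 / 4` of the identity on the ball of radius `r` covers the ball of radius `3 / 4
  -- * r` around its value at `0`, which is `y`. Points of the ball of radius `r / 4` around `x` are
  -- within `r / 2` of `y`. The radius `r` was fixed before `l`.
  have hsurj := happ.surjOn_closedBall_of_nonlinearRightInverse
    ⟨id, 1, fun y => by simp, fun y => rfl⟩ hr0.le subset_rfl
  have hbase : wordFlow (X l) (detourWord w i (fun k => c k (0 : V)) L) y = y :=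
    wordFlow_detourWord_zero (hZ l) hC
      (fun k => le_trans (by gcongr; exact (ht k).cost_lt.le) hη) (fun k => by simp) L y
  obtain ⟨ξ, hξ, hξz⟩ := hsurj (a := z') (by
    rw [hbase, Metric.mem_closedBall]
    push_cast
    have := dist_triangle_right z' y x
    linarith)
  refine ⟨_, ?_, hξz⟩
  rw [← hlen]
  refine wordCost_detourWord_le (fun k => (ht k).cost_lt.le) (fun k => (hσ' ?_ k).le) L
  rw [Metric.mem_closedBall] at hξ
  linarith

end Surjectivity

/-! ### Vector fields and brackets read in charts -/

section ChartFields

variable {V : Type*} [NormedAddCommGroup V] [NormedSpace ℝ V]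
  {M : Type*} [TopologicalSpace M] [ChartedSpace V M] [IsManifold 𝓘(ℝ, V) ∞ M]

/-- The vector field `X` is smooth. -/
def IsSmoothField (X : (p : M) → TangentSpace 𝓘(ℝ, V) p) : Prop :=
  ContMDiff 𝓘(ℝ, V) 𝓘(ℝ, V).tangent ∞ (fun p => (⟨p, X p⟩ : TangentBundle 𝓘(ℝ, V) M))

/-- The reading in the chart is the fibre component of the section in the trivialization of the
tangent bundle at `x₀`. -/
theorem IsSmoothField.contDiffOn_vectorFieldInChart {X : (p : M) → TangentSpace 𝓘(ℝ, V) p}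
    (hX : IsSmoothField X) (x₀ : M) :
    ContDiffOn ℝ ∞ (vectorFieldInChart x₀ X) (extChartAt 𝓘(ℝ, V) x₀).target := by
  have : IsManifold 𝓘(ℝ, V) 1 M := IsManifold.of_le (n := ∞) (by simp)
  rw [← contMDiffOn_iff_contDiffOn]
  have h1 := ((trivializationAt V (TangentSpace 𝓘(ℝ, V)) x₀).contMDiffOn_section_baseSet_iff
    (n := ∞) (IB := 𝓘(ℝ, V)) (s := X)).1 hX.contMDiffOn
  have h2 : ContMDiffOn 𝓘(ℝ, V) 𝓘(ℝ, V) ∞ (extChartAt 𝓘(ℝ, V) x₀).symm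
    (extChartAt 𝓘(ℝ, V) x₀).target := contMDiffOn_extChartAt_symm x₀
  have hmem : ∀ y ∈ (extChartAt 𝓘(ℝ, V) x₀).target,
      (extChartAt 𝓘(ℝ, V) x₀).symm y ∈ (chartAt V x₀).source := fun y hy => by
    rw [← extChartAt_source 𝓘(ℝ, V)]; exact (extChartAt 𝓘(ℝ, V) x₀).map_target hy
  refine (h1.comp h2 fun y hy => ?_).congr fun y hy => ?_
  · rw [TangentBundle.trivializationAt_baseSet]; exact hmem y hy
  · set q := (extChartAt 𝓘(ℝ, V) x₀).symm y
    have e1 := TangentBundle.continuousLinearMapAt_trivializationAt (𝕜 := ℝ) (I := 𝓘(ℝ, V))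
      (hmem y hy)
    have e2 : (trivializationAt V (TangentSpace 𝓘(ℝ, V)) x₀).continuousLinearMapAt ℝ q (X q)
        = (trivializationAt V (TangentSpace 𝓘(ℝ, V)) x₀ ⟨q, X q⟩).2 := by
      rw [Bundle.Trivialization.continuousLinearMapAt_apply,
        Bundle.Trivialization.linearMapAt_apply, if_pos]
      rw [TangentBundle.trivializationAt_baseSet]; exact hmem y hy
    exact (DFunLike.congr_fun e1 (X q)).symm.trans e2

/-- Pushing forward by the chart is pulling back by its inverse, and the Lie bracket is natural
under pullback. -/
theorem vectorFieldInChart_eq_mpullback (x₀ : M) (X : (p : M) → TangentSpace 𝓘(ℝ, V) p) {y : V}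
    (hy : y ∈ (extChartAt 𝓘(ℝ, V) x₀).target) :
    vectorFieldInChart x₀ X y
      = VectorField.mpullback 𝓘(ℝ, V) 𝓘(ℝ, V) (extChartAt 𝓘(ℝ, V) x₀).symm X y := by
  have : IsManifold 𝓘(ℝ, V) 1 M := IsManifold.of_le (n := ∞) (by simp)
  have h1 := mfderivWithin_extChartAt_symm_comp_mfderiv_extChartAt (I := 𝓘(ℝ, V)) hy
  have h2 := mfderiv_extChartAt_comp_mfderivWithin_extChartAt_symm (I := 𝓘(ℝ, V)) hy
  rw [modelWithCornersSelf_coe, range_id, mfderivWithin_univ] at h1 h2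
  rw [VectorField.mpullback_apply, ContinuousLinearMap.inverse_eq h1 h2]
  rfl

theorem vectorFieldInChart_mlieBracket [CompleteSpace V] (x₀ : M)
    {Y Z : (p : M) → TangentSpace 𝓘(ℝ, V) p}
    (hY : IsSmoothField Y) (hZ : IsSmoothField Z) :
    EqOn (vectorFieldInChart x₀ (VectorField.mlieBracket 𝓘(ℝ, V) Y Z))
      (VectorField.lieBracket ℝ (vectorFieldInChart x₀ Y) (vectorFieldInChart x₀ Z))
      (extChartAt 𝓘(ℝ, V) x₀).target := fun y hy => by
  have h2 : minSmoothness ℝ 2 ≤ (∞ : WithTop ℕ∞) := by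
    simp only [minSmoothness_of_isRCLikeNormedField]
    exact WithTop.coe_le_coe.2 (le_top : (2 : ℕ∞) ≤ ⊤)
  have h3 : minSmoothness ℝ 3 ≤ (∞ : WithTop ℕ∞) := by
    simp only [minSmoothness_of_isRCLikeNormedField]
    exact WithTop.coe_le_coe.2 (le_top : (3 : ℕ∞) ≤ ⊤)
  have : IsManifold 𝓘(ℝ, V) (minSmoothness ℝ 3) M := IsManifold.of_le (n := ∞) h3
  have : IsManifold 𝓘(ℝ, V) (minSmoothness ℝ 2) M := IsManifold.of_le (n := ∞) h2
  have hopen : IsOpen (extChartAt 𝓘(ℝ, V) x₀).target := isOpen_extChartAt_target x₀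
  have hs : ContMDiffAt 𝓘(ℝ, V) 𝓘(ℝ, V) ∞ (extChartAt 𝓘(ℝ, V) x₀).symm y :=
    (contMDiffOn_extChartAt_symm x₀).contMDiffAt (hopen.mem_nhds hy)
  rw [vectorFieldInChart_eq_mpullback x₀ _ hy, VectorField.mpullback_mlieBracket
    ((hY _).mdifferentiableAt (by simp)) ((hZ _).mdifferentiableAt (by simp)) hs h2,
    ← VectorField.mlieBracketWithin_univ, VectorField.mlieBracketWithin_eq_lieBracketWithin]
  refine (congrFun (VectorField.lieBracketWithin_univ (𝕜 := ℝ) (E := V)) y).trans ?_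
  refine Filter.EventuallyEq.lieBracket_vectorField_eq ?_ ?_ <;>
  · filter_upwards [hopen.mem_nhds hy] with z hz
    rw [vectorFieldInChart_eq_mpullback x₀ _ hz]

theorem IsSmoothField.mlieBracket [CompleteSpace V] {Y Z : (p : M) → TangentSpace 𝓘(ℝ, V) p}
    (hY : IsSmoothField Y) (hZ : IsSmoothField Z) :
    IsSmoothField (VectorField.mlieBracket 𝓘(ℝ, V) Y Z) := by
  have : IsManifold 𝓘(ℝ, V) (((⊤ : ℕ∞) : WithTop ℕ∞) + 1) M :=
    IsManifold.of_le (n := ∞) (by simp)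
  have h3 : minSmoothness ℝ 3 ≤ (∞ : WithTop ℕ∞) := by
    simp only [minSmoothness_of_isRCLikeNormedField]
    exact WithTop.coe_le_coe.2 (le_top : (3 : ℕ∞) ≤ ⊤)
  have : IsManifold 𝓘(ℝ, V) (minSmoothness ℝ 3) M := IsManifold.of_le (n := ∞) h3
  exact ContDiff.mlieBracket_vectorField (m := ⊤) (n := ⊤) hY hZ (by simp)

theorem InGeneratedLieAlgebra.isSmoothField [CompleteSpace V] {ι : Type*}
    {X : ι → (p : M) → TangentSpace 𝓘(ℝ, V) p} (hX : ∀ i, IsSmoothField (X i))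
    {Y : (p : M) → TangentSpace 𝓘(ℝ, V) p} (hY : InGeneratedLieAlgebra X Y) : IsSmoothField Y := by
  induction hY with
  | base i => exact hX i
  | zero => exact Bundle.contMDiff_zeroSection ℝ (TangentSpace 𝓘(ℝ, V) (M := M))
  | add Y Z _ _ hY hZ => exact ContMDiff.add_section hY hZ
  | smul c Y _ hY => exact ContMDiff.const_smul_section hY
  | bracket Y Z _ _ hY hZ => exact hY.mlieBracket hZ

/-- In a chart, all fields of the generated Lie algebra are normalizers of the orbit fields. -/
theorem InGeneratedLieAlgebra.isOrbitNormalizer [FiniteDimensional ℝ V] {ι : Type*}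
    {X : ι → (p : M) → TangentSpace 𝓘(ℝ, V) p} (hX : ∀ i, IsSmoothField (X i)) (x₀ : M)
    {Z : ι → V → V} {C η : ℝ} {x : V} {O : Set V} (hZ : ∀ i, IsBddField C (Z i)) (hC : 0 ≤ C)
    (hη : η * C ≤ 1 / 2) (hOo : IsOpen O) (hO : ∀ z, ‖z - x‖ ≤ η * C → z ∈ O)
    (hOt : O ⊆ (extChartAt 𝓘(ℝ, V) x₀).target)
    (hZX : ∀ i, EqOn (Z i) (vectorFieldInChart x₀ (X i)) O)
    {Y : (p : M) → TangentSpace 𝓘(ℝ, V) p} (hY : InGeneratedLieAlgebra X Y) :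
    IsOrbitNormalizer Z η x O (vectorFieldInChart x₀ Y) := by
  have : CompleteSpace V := FiniteDimensional.complete ℝ V
  induction hY with
  | base i =>
    exact (IsOrbitNormalizer.base hZ hC hη hOo hO (fun i =>
      (((hX i).contDiffOn_vectorFieldInChart x₀).mono hOt).congr (hZX i)) i).congr hZ hC hη hOo hO
      (hZX i).symm
  | zero =>
    refine IsOrbitNormalizer.zero.congr hZ hC hη hOo hO fun y _ => ?_
    exact map_zero (mfderiv 𝓘(ℝ, V) 𝓘(ℝ, V) (extChartAt 𝓘(ℝ, V) x₀) _)
  | add Y W _ _ h h' =>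
    refine (h.add hZ hC hη hOo hO h').congr hZ hC hη hOo hO fun y _ => ?_
    exact map_add (mfderiv 𝓘(ℝ, V) 𝓘(ℝ, V) (extChartAt 𝓘(ℝ, V) x₀) _) _ _
  | smul c Y _ h =>
    refine (h.smul hZ hC hη hOo hO c).congr hZ hC hη hOo hO fun y _ => ?_
    exact map_smul (mfderiv 𝓘(ℝ, V) 𝓘(ℝ, V) (extChartAt 𝓘(ℝ, V) x₀) _) _ _
  | bracket Y W hY' hW' h h' =>
    exact (h.lieBracket hZ hC hη hOo hO h').congr hZ hC hη hOo hO
      ((vectorFieldInChart_mlieBracket x₀ (hY'.isSmoothField hX) (hW'.isSmoothField hX)).mono hOt)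

/-- The tangent space at `x₀` is identified with `V` through this very chart, whose derivative at
`x₀` is therefore the identity. -/
theorem vectorFieldInChart_self (x₀ : M) (X : (p : M) → TangentSpace 𝓘(ℝ, V) p) :
    vectorFieldInChart x₀ X (extChartAt 𝓘(ℝ, V) x₀ x₀) = X x₀ := by
  have : IsManifold 𝓘(ℝ, V) 1 M := IsManifold.of_le (n := ∞) (by simp)
  rw [vectorFieldInChart, extChartAt_to_inv, mfderiv_extChartAt_self]
  rfl

/-- All generated fields are normalizers in the chart, so their values at the centre lie in
`orbitSpan`. Bracket generation is consumed here, for arbitrarily small `η`. -/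
theorem IsBracketGenerating.orbitSpan_eq_top [FiniteDimensional ℝ V] {ι : Type*}
    {X : ι → (p : M) → TangentSpace 𝓘(ℝ, V) p} (hgen : IsBracketGenerating X)
    (hX : ∀ i, IsSmoothField (X i)) (x₀ : M)
    {Z : ι → V → V} {C η : ℝ} {O : Set V} (hZ : ∀ i, IsBddField C (Z i)) (hC : 0 ≤ C)
    (hη0 : 0 < η) (hη : η * C ≤ 1 / 2) (hOo : IsOpen O)
    (hO : ∀ z, ‖z - extChartAt 𝓘(ℝ, V) x₀ x₀‖ ≤ η * C → z ∈ O)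
    (hOt : O ⊆ (extChartAt 𝓘(ℝ, V) x₀).target)
    (hZX : ∀ i, EqOn (Z i) (vectorFieldInChart x₀ (X i)) O) :
    orbitSpan Z η (extChartAt 𝓘(ℝ, V) x₀ x₀) = ⊤ := by
  have : CompleteSpace V := FiniteDimensional.complete ℝ V
  refine eq_top_iff.2 fun v _ => ?_
  obtain ⟨Y, hY, hYv⟩ := hgen x₀ v
  have := (hY.isOrbitNormalizer hX x₀ hZ hC hη hOo hO hOt hZX).apply_mem hη0
  rw [vectorFieldInChart_self, hYv] at this
  exact this

end ChartFields

/-! ### Cutting off families of vector fields -/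

section Cutoff

variable {Λ : Type*} [TopologicalSpace Λ] {V W : Type*} [NormedAddCommGroup V] [NormedSpace ℝ V]
  [NormedAddCommGroup W] [NormedSpace ℝ W]

theorem continuous_of_support {F : Λ × V → W} {T K : Set V} (hT : IsOpen T) (hK : IsClosed K)
    (hKT : K ⊆ T) (hF : ContinuousOn F (univ ×ˢ T)) (h0 : ∀ z : Λ × V, z.2 ∉ K → F z = 0) :
    Continuous F := by
  refine continuous_iff_continuousAt.2 fun z => ?_
  by_cases hz : z.2 ∈ T
  · exact hF.continuousAt ((isOpen_univ.prod hT).mem_nhds ⟨mem_univ _, hz⟩)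
  · have hz' : z.2 ∈ Kᶜ := fun h => hz (hKT h)
    have : F =ᶠ[𝓝 z] fun _ => 0 := by
      filter_upwards [(hK.isOpen_compl.preimage continuous_snd).mem_nhds hz'] with w hw
      exact h0 w hw
    exact continuousAt_const.congr this.symm

/-- Compactness of `Λ` makes the bound uniform in the parameter. -/
theorem exists_norm_le_of_support [CompactSpace Λ] {F : Λ × V → W} {K : Set V} (hK : IsCompact K)
    (hF : Continuous F) (h0 : ∀ z : Λ × V, z.2 ∉ K → F z = 0) : ∃ C, ∀ z, ‖F z‖ ≤ C := by
  obtain ⟨C, hC⟩ := (isCompact_univ.prod hK).exists_bound_of_continuousOn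
    (s := (univ : Set Λ) ×ˢ K) hF.continuousOn
  refine ⟨max C 0, fun z => ?_⟩
  by_cases hz : z.2 ∈ K
  · exact (hC z ⟨mem_univ _, hz⟩).trans (le_max_left _ _)
  · rw [h0 z hz, norm_zero]; exact le_max_right _ _

/-- A family of `C¹` fields on an open set, continuous in the parameter with its derivative,
can be cut off to a bounded family. -/
theorem exists_isBddFamily_of_continuousOn [CompactSpace Λ] [FiniteDimensional ℝ V]
    {g : Λ → V → V} {T : Set V}
    (hT : IsOpen T) {x : V} (χ : ContDiffBump x) (hχ : Metric.closedBall x χ.rOut ⊆ T)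
    (hd : ∀ l, DifferentiableOn ℝ (g l) T)
    (h0 : ContinuousOn (fun z : Λ × V => g z.1 z.2) (univ ×ˢ T))
    (h1 : ContinuousOn (fun z : Λ × V => fderiv ℝ (g z.1) z.2) (univ ×ˢ T)) :
    ∃ C, ∀ C' ≥ C, IsBddFamily C' (fun l y => χ y • g l y) := by
  set K := Metric.closedBall x χ.rOut
  have hK : IsCompact K := isCompact_closedBall _ _
  have hχ0 : ∀ y ∉ K, χ y = 0 := fun y hy => χ.zero_of_le_dist (by
    rw [Metric.mem_closedBall, not_le] at hy; exact hy.le)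
  have hχd0 : ∀ y ∉ K, fderiv ℝ χ y = 0 := fun y hy => by
    have : (χ : V → ℝ) =ᶠ[𝓝 y] fun _ => 0 := by
      filter_upwards [hK.isClosed.isOpen_compl.mem_nhds hy] with z hz
      exact hχ0 z hz
    rw [this.fderiv_eq]; simp
  have hχs : ContDiff ℝ 1 (χ : V → ℝ) := χ.contDiff
  have hχd : Differentiable ℝ (χ : V → ℝ) := hχs.differentiable (by simp)
  have hχc : Continuous (fderiv ℝ (χ : V → ℝ)) := hχs.continuous_fderiv (by simp)
  set D : Λ × V → V →L[ℝ] V := fun z =>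
    χ z.2 • fderiv ℝ (g z.1) z.2 + (fderiv ℝ χ z.2).smulRight (g z.1 z.2) with hD
  have hDder : ∀ z : Λ × V, HasFDerivAt (fun y => χ y • g z.1 y) (D z) z.2 := fun z => by
    by_cases hz : z.2 ∈ T
    · exact (hχd z.2).hasFDerivAt.smul
        ((hd z.1).differentiableAt (hT.mem_nhds hz)).hasFDerivAt
    · have hz' : z.2 ∉ K := fun h => hz (hχ h)
      have hDz : D z = 0 := by
        rw [hD]; simp only [hχ0 _ hz', hχd0 _ hz', zero_smul, zero_add]; ext; simp
      rw [hDz]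
      refine (hasFDerivAt_const (0 : V) z.2).congr_of_eventuallyEq ?_
      filter_upwards [hK.isClosed.isOpen_compl.mem_nhds hz'] with y hy
      rw [hχ0 y hy, zero_smul]
  have hF : Continuous fun z : Λ × V => χ z.2 • g z.1 z.2 :=
    continuous_of_support hT hK.isClosed hχ
      ((χ.continuous.comp continuous_snd).continuousOn.smul h0)
      (fun z hz => by rw [hχ0 _ hz, zero_smul])
  have hDc : Continuous D := by
    refine continuous_of_support hT hK.isClosed hχ
      (((χ.continuous.comp continuous_snd).continuousOn.smul h1).add ?_)
      (fun z hz => by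
        rw [hD]; simp only [hχ0 _ hz, hχd0 _ hz, zero_smul, zero_add]; ext; simp)
    exact ((ContinuousLinearMap.smulRightL ℝ V V).continuous₂.comp_continuousOn
      ((hχc.comp continuous_snd).continuousOn.prodMk h0))
  obtain ⟨C₁, hC₁⟩ := exists_norm_le_of_support hK hF
    (fun z hz => by rw [hχ0 _ hz, zero_smul])
  obtain ⟨C₂, hC₂⟩ := exists_norm_le_of_support hK hDc (fun z hz => by
        rw [hD]; simp only [hχ0 _ hz, hχd0 _ hz, zero_smul, zero_add]; ext; simp)
  refine ⟨max C₁ C₂, fun C' hC' => ⟨fun l => ⟨fun y => (hDder (l, y)).differentiableAt, ?_,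
    fun y => (hC₁ (l, y)).trans ((le_max_left _ _).trans hC'), fun y => ?_⟩, hF, ?_⟩⟩
  · have : fderiv ℝ (fun y => χ y • g l y) = fun y => D (l, y) :=
      funext fun y => (hDder (l, y)).fderiv
    rw [this]; exact hDc.comp (by fun_prop)
  · rw [(hDder (l, y)).fderiv]; exact (hC₂ (l, y)).trans ((le_max_right _ _).trans hC')
  · have : (fun z : Λ × V => fderiv ℝ (fun y => χ y • g z.1 y) z.2) = D :=
      funext fun z => (hDder z).fderiv
    rw [this]; exact hDc

end Cutoff

/-! ### Global model fields for a continuously varying structure -/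

section CCChart

variable {V : Type*} [NormedAddCommGroup V] [NormedSpace ℝ V]
  {M : Type*} [TopologicalSpace M] [ChartedSpace V M] [IsManifold 𝓘(ℝ, V) ∞ M]
  {Λ : Type*} [TopologicalSpace Λ] {k : ℕ}

theorem IsCCBundleStructure.isSmoothField {f : (p : M) → CtrlSpace k →L[ℝ] TangentSpace 𝓘(ℝ, V) p}
    {N : M → CtrlSpace k → ℝ} (h : IsCCBundleStructure f N) (v : CtrlSpace k) :
    IsSmoothField (fun p => f p v) :=
  h.smooth.comp (f := fun p : M => (p, v)) (contMDiff_id.prodMk contMDiff_const)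

theorem vectorFieldInChart_eq_sum (f : (p : M) → CtrlSpace k →L[ℝ] TangentSpace 𝓘(ℝ, V) p)
    (x₀ : M) (v : CtrlSpace k) (y : V) :
    vectorFieldInChart x₀ (fun p => f p v) y
      = ∑ i, v i • vectorFieldInChart x₀ (fun p => f p (EuclideanSpace.single i 1)) y := by
  have hv : v = ∑ i, v i • EuclideanSpace.single i (1 : ℝ) := by
    ext j
    simp [Pi.single_apply]
  let L : CtrlSpace k →ₗ[ℝ] V :=
    { toFun := fun v => vectorFieldInChart x₀ (fun p => f p v) y
      map_add' := fun v w => by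
        refine (congrArg (mfderiv 𝓘(ℝ, V) 𝓘(ℝ, V) (extChartAt 𝓘(ℝ, V) x₀) _)
          (map_add (f _) v w)).trans ?_
        exact map_add (mfderiv 𝓘(ℝ, V) 𝓘(ℝ, V) (extChartAt 𝓘(ℝ, V) x₀) _) _ _
      map_smul' := fun c v => by
        refine (congrArg (mfderiv 𝓘(ℝ, V) 𝓘(ℝ, V) (extChartAt 𝓘(ℝ, V) x₀) _)
          (map_smul (f _) c v)).trans ?_
        exact map_smul (mfderiv 𝓘(ℝ, V) 𝓘(ℝ, V) (extChartAt 𝓘(ℝ, V) x₀) _) _ _ }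
  change L v = ∑ i, v i • L (EuclideanSpace.single i 1)
  conv_lhs => rw [hv]
  rw [map_sum]
  simp only [map_smul]

/-- The fields of a continuously varying structure, read in the chart around `x₀` and cut off. -/
theorem IsContinuouslyVaryingCC.exists_cutoff [CompactSpace Λ] [FiniteDimensional ℝ V]
    {f : Λ → (p : M) → CtrlSpace k →L[ℝ] TangentSpace 𝓘(ℝ, V) p}
    {N : Λ → M → CtrlSpace k → ℝ} (h : IsContinuouslyVaryingCC f N) (x₀ : M) :
    ∃ ρ > 0, ∃ C > 0, ∃ X : Λ → Fin k → V → V,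
      Metric.closedBall (extChartAt 𝓘(ℝ, V) x₀ x₀) ρ ⊆ (extChartAt 𝓘(ℝ, V) x₀).target ∧
      (∀ i, IsBddFamily C (fun l => X l i)) ∧
      ∀ l i, EqOn (X l i) (vectorFieldInChart x₀ fun p => f l p (EuclideanSpace.single i 1))
        (Metric.closedBall (extChartAt 𝓘(ℝ, V) x₀ x₀) ρ) := by
  set x := extChartAt 𝓘(ℝ, V) x₀ x₀
  set T := (extChartAt 𝓘(ℝ, V) x₀).target
  have hT : IsOpen T := isOpen_extChartAt_target x₀
  obtain ⟨r, hr, hrT⟩ := Metric.isOpen_iff.1 hT x (mem_extChartAt_target x₀)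
  set χ : ContDiffBump x := ⟨r / 4, r / 2, by positivity, by linarith⟩
  have hχ : Metric.closedBall x χ.rOut ⊆ T :=
    (Metric.closedBall_subset_ball (by change r / 2 < r; linarith)).trans hrT
  have hex : ∀ i : Fin k, ∃ C, ∀ C' ≥ C, IsBddFamily C' (fun (l : Λ) y => χ y •
      vectorFieldInChart x₀ (fun p => f l p (EuclideanSpace.single i 1)) y) := fun i => by
    refine exists_isBddFamily_of_continuousOn hT χ hχ (fun l => ?_) ?_ ?_
    · exact (((h.isCC l).isSmoothField _).contDiffOn_vectorFieldInChart x₀).differentiableOn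
        (by simp)
    · have h0 := h.continuous_derivs x₀ i 0 (by norm_num)
      refine ((ContinuousMultilinearMap.apply ℝ (fun _ : Fin 0 => V) V 0).continuous.comp_continuousOn
        h0).congr fun z _ => ?_
      simp
    · have h1 := h.continuous_derivs x₀ i 1 (by norm_num)
      refine continuousOn_clm_apply.2 fun v => ?_
      refine ((ContinuousMultilinearMap.apply ℝ (fun _ : Fin 1 => V) V
        (fun _ => v)).continuous.comp_continuousOn h1).congr fun z _ => ?_
      simp
  choose C hC using hex
  -- The bump function equals one up to radius `r / 4`. The sum provides one positive constant for
  -- all `i`.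
  refine ⟨r / 4, by positivity, 1 + ∑ i, |C i|, by positivity, fun l i y => χ y •
      vectorFieldInChart x₀ (fun p => f l p (EuclideanSpace.single i 1)) y, ?_, fun i => ?_, ?_⟩
  · exact (Metric.closedBall_subset_closedBall (by change r / 4 ≤ r / 2; linarith)).trans hχ
  · refine hC i _ ?_
    have := Finset.single_le_sum (f := fun i => |C i|) (fun i _ => abs_nonneg _)
      (Finset.mem_univ i)
    linarith [le_abs_self (C i)]
  · intro l i y hy
    have : χ y = 1 := χ.one_of_mem_closedBall hy
    simp [this]

end CCChart

/-! ### Affine reparametrisation, Lipschitz and absolutely continuous curves -/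

section RealLine

theorem quasiMeasurePreserving_affine {α : ℝ} (hα : α ≠ 0) (β : ℝ) :
    Measure.QuasiMeasurePreserving (fun s : ℝ => α * s + β) volume volume := by
  have h1 : Measure.QuasiMeasurePreserving (fun s : ℝ => α * s) volume volume := by
    refine ⟨by fun_prop, ?_⟩
    rw [Real.map_volume_mul_left hα]
    exact Measure.smul_absolutelyContinuous
  exact (measurePreserving_add_right volume β).quasiMeasurePreserving.comp h1

theorem LipschitzOnWith.congr_eqOn {X Y : Type*} [PseudoEMetricSpace X] [PseudoEMetricSpace Y]
    {K : ℝ≥0} {g g' : X → Y} {s : Set X} (h : LipschitzOnWith K g s) (hg : EqOn g' g s) :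
    LipschitzOnWith K g' s := fun x hx y hy => by rw [hg hx, hg hy]; exact h hx hy

theorem lipschitzOnWith_Icc_union {X : Type*} [PseudoMetricSpace X] {g : ℝ → X} {a m b : ℝ}
    {K : ℝ≥0} (hm : m ∈ Icc a b) (h₁ : LipschitzOnWith K g (Icc a m))
    (h₂ : LipschitzOnWith K g (Icc m b)) : LipschitzOnWith K g (Icc a b) := by
  have key : ∀ s ∈ Icc a b, ∀ t ∈ Icc a b, s ≤ t → dist (g s) (g t) ≤ K * dist s t := by
    intro s hs t ht hst
    rcases le_total t m with htm | htm
    · exact h₁.dist_le_mul s ⟨hs.1, hst.trans htm⟩ t ⟨ht.1, htm⟩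
    rcases le_total m s with hms | hms
    · exact h₂.dist_le_mul s ⟨hms, hs.2⟩ t ⟨htm, ht.2⟩
    have e1 := h₁.dist_le_mul s ⟨hs.1, hms⟩ m ⟨hm.1, le_rfl⟩
    have e2 := h₂.dist_le_mul m ⟨le_rfl, hm.2⟩ t ⟨htm, ht.2⟩
    rw [Real.dist_eq, abs_of_nonpos (by linarith)] at e1 e2 ⊢
    calc _ ≤ _ := dist_triangle (g s) (g m) (g t)
      _ ≤ K * -(s - m) + K * -(m - t) := add_le_add e1 e2
      _ = _ := by ring
  refine LipschitzOnWith.of_dist_le_mul fun s hs t ht => ?_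
  rcases le_total s t with h | h
  · exact key s hs t ht h
  · rw [dist_comm, dist_comm s]; exact key t ht s hs h

variable {V : Type*} [NormedAddCommGroup V] [NormedSpace ℝ V]

theorem LipschitzWith.comp_absolutelyContinuousOnInterval {X Y : Type*} [PseudoMetricSpace X]
    [PseudoMetricSpace Y] {K : ℝ≥0} {φ : X → Y} (hφ : LipschitzWith K φ) {h : ℝ → X} {a b : ℝ}
    (hh : AbsolutelyContinuousOnInterval h a b) : AbsolutelyContinuousOnInterval (φ ∘ h) a b := by
  rw [absolutelyContinuousOnInterval_iff] at hh ⊢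
  intro ε hε
  obtain ⟨δ, hδ, H⟩ := hh (ε / (K + 1)) (by positivity)
  refine ⟨δ, hδ, fun E hE hlt => ?_⟩
  have h1 := H E hE hlt
  have hS : 0 ≤ ∑ i ∈ Finset.range E.1, dist (h (E.2 i).1) (h (E.2 i).2) :=
    Finset.sum_nonneg fun _ _ => dist_nonneg
  calc _ ≤ ∑ i ∈ Finset.range E.1, K * dist (h (E.2 i).1) (h (E.2 i).2) :=
        Finset.sum_le_sum fun i _ => hφ.dist_le_mul _ _
    _ = K * ∑ i ∈ Finset.range E.1, dist (h (E.2 i).1) (h (E.2 i).2) := by rw [Finset.mul_sum]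
    _ ≤ (K + 1) * ∑ i ∈ Finset.range E.1, dist (h (E.2 i).1) (h (E.2 i).2) := by
        gcongr; linarith
    _ < (K + 1) * (ε / (K + 1)) := by gcongr
    _ = ε := by field_simp

/-- The fundamental theorem of calculus for absolutely continuous curves. -/
theorem AbsolutelyContinuousOnInterval.sub_eq_integral [CompleteSpace V] {h g : ℝ → V} {a b : ℝ}
    (hh : AbsolutelyContinuousOnInterval h a b) (hg : IntervalIntegrable g volume a b)
    (hd : ∀ᵐ t, t ∈ uIcc a b → HasDerivAt h (g t) t) : h b - h a = ∫ t in a..b, g t := by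
  -- Testing against continuous functionals reduces to real-valued absolutely continuous functions.
  rw [SeparatingDual.eq_iff_forall_dual_eq (R := ℝ)]
  intro ψ
  have h1 := (ψ.lipschitz.comp_absolutelyContinuousOnInterval hh).integral_deriv_eq_sub
  rw [map_sub, ← ψ.intervalIntegral_comp_comm hg, ← Function.comp_apply (f := ψ) (x := b),
    ← Function.comp_apply (f := ψ) (x := a), ← h1]
  refine intervalIntegral.integral_congr_ae ?_
  filter_upwards [hd] with t ht ht'
  exact (ψ.hasFDerivAt.comp_hasDerivAt t (ht (uIoc_subset_uIcc ht'))).deriv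

end RealLine

/-! ### Controlled curves on intervals: restriction, reparametrisation, gluing -/

section ControlledCurves

variable {V : Type*} [NormedAddCommGroup V] [NormedSpace ℝ V]
  {M : Type*} [TopologicalSpace M] [ChartedSpace V M] {k : ℕ}

/-- The curve `γ` is driven on `[a, b]` by the bounded control `u`, with speed at most `c`. -/
structure IsCtrlOn (f : (p : M) → CtrlSpace k →L[ℝ] TangentSpace 𝓘(ℝ, V) p)
    (N : M → CtrlSpace k → ℝ) (u : ℝ → CtrlSpace k) (γ : ℝ → M) (a b c : ℝ) : Prop where
  cont : ContinuousOn γ (Icc a b)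
  lip : ∀ (x₀ : M) (a' b' : ℝ), a ≤ a' → a' ≤ b' → b' ≤ b →
    MapsTo γ (Icc a' b') (chartAt V x₀).source →
      ∃ K, LipschitzOnWith K (extChartAt 𝓘(ℝ, V) x₀ ∘ γ) (Icc a' b')
  meas : AEStronglyMeasurable u (volume.restrict (Icc a b))
  bdd : ∃ R, ∀ᵐ t ∂(volume.restrict (Icc a b)), ‖u t‖ ≤ R
  deriv : ∀ᵐ t ∂(volume.restrict (Icc a b)), HasMFDerivAt 𝓘(ℝ, ℝ) 𝓘(ℝ, V) γ t
      ((1 : ℝ →L[ℝ] ℝ).smulRight (f (γ t) (u t) : TangentSpace 𝓘(ℝ, V) (γ t)))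
  speed : ∀ᵐ t ∂(volume.restrict (Icc a b)), N (γ t) (u t) ≤ c

variable {f : (p : M) → CtrlSpace k →L[ℝ] TangentSpace 𝓘(ℝ, V) p} {N : M → CtrlSpace k → ℝ}
  {u : ℝ → CtrlSpace k} {γ : ℝ → M} {a b c : ℝ}

theorem IsCtrlOn.mono (h : IsCtrlOn f N u γ a b c) {a' b' : ℝ} (ha : a ≤ a') (hb : b' ≤ b) :
    IsCtrlOn f N u γ a' b' c := by
  have hsub : Icc a' b' ⊆ Icc a b := Icc_subset_Icc ha hb
  have hle : volume.restrict (Icc a' b') ≤ volume.restrict (Icc a b) :=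
    Measure.restrict_mono hsub le_rfl
  obtain ⟨R, hR⟩ := h.bdd
  exact ⟨h.cont.mono hsub, fun x₀ s t hs hst ht => h.lip x₀ s t (ha.trans hs) hst (ht.trans hb),
    h.meas.mono_measure hle, ⟨R, ae_mono hle hR⟩, ae_mono hle h.deriv, ae_mono hle h.speed⟩

/-- Both signs of `α` matter: positive ones change the time interval, and `α = -1` reverses the
curve and gives the symmetry of the distance. -/
theorem IsCtrlOn.comp_affine (hN : ∀ p, IsNormFun (N p)) (h : IsCtrlOn f N u γ a b c) {α : ℝ}
    (hα : α ≠ 0) (β : ℝ) {a' b' : ℝ}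
    (hmaps : MapsTo (fun s => α * s + β) (Icc a' b') (Icc a b)) :
    IsCtrlOn f N (fun s => α • u (α * s + β)) (fun s => γ (α * s + β)) a' b' (|α| * c) := by
  have hq : Measure.QuasiMeasurePreserving (fun s : ℝ => α * s + β)
      (volume.restrict (Icc a' b')) (volume.restrict (Icc a b)) :=
    (quasiMeasurePreserving_affine hα β).restrict hmaps
  obtain ⟨R, hR⟩ := h.bdd
  refine ⟨h.cont.comp (by fun_prop) hmaps, fun x₀ s t hs hst ht hsrc => ?_,
    (h.meas.comp_quasiMeasurePreserving hq).const_smul α, ⟨|α| * R, ?_⟩, ?_, ?_⟩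
  · set s' := min (α * s + β) (α * t + β)
    set t' := max (α * s + β) (α * t + β)
    have hs' := hmaps ⟨hs, hst.trans ht⟩
    have ht' := hmaps ⟨hs.trans hst, ht⟩
    -- The chart hypothesis concerns the reparametrised curve; surjectivity onto the image interval
    -- transfers it to `γ`.
    have hsurj : ∀ x ∈ Icc s' t', ∃ r ∈ Icc s t, α * r + β = x := fun x hx => by
      have hx' : x ∈ uIcc (α * s + β) (α * t + β) := hx
      have hc : ContinuousOn (fun r => α * r + β) (uIcc s t) := by fun_prop
      obtain ⟨r, hr, hrx⟩ := intermediate_value_uIcc hc hx'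
      exact ⟨r, by rwa [uIcc_of_le hst] at hr, hrx⟩
    have hmem : MapsTo (fun r => α * r + β) (Icc s t) (Icc s' t') := fun r hr => by
      rcases le_total 0 α with h0 | h0
      · exact ⟨(min_le_left _ _).trans (by nlinarith [hr.1]),
          le_trans (by nlinarith [hr.2]) (le_max_right _ _)⟩
      · exact ⟨(min_le_right _ _).trans (by nlinarith [hr.2]),
          le_trans (by nlinarith [hr.1]) (le_max_left _ _)⟩
    obtain ⟨K, hK⟩ := h.lip x₀ s' t' (le_min hs'.1 ht'.1) min_le_max (max_le hs'.2 ht'.2)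
      (fun x hx => by obtain ⟨r, hr, rfl⟩ := hsurj x hx; exact hsrc hr)
    have hθ : LipschitzOnWith ‖α‖₊ (fun r : ℝ => α * r + β) (Icc s t) :=
      LipschitzOnWith.of_dist_le_mul fun x _ y _ => by
        rw [Real.dist_eq, Real.dist_eq, add_sub_add_right_eq_sub, ← mul_sub, abs_mul]
        exact le_of_eq rfl
    exact ⟨K * ‖α‖₊, hK.comp hθ hmem⟩
  · filter_upwards [hq.ae hR] with s hs
    rw [norm_smul, Real.norm_eq_abs]
    gcongr
  · filter_upwards [hq.ae h.deriv] with s hs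
    have h1 : HasMFDerivAt 𝓘(ℝ, ℝ) 𝓘(ℝ, ℝ) (fun r : ℝ => α * r + β) s
        ((1 : ℝ →L[ℝ] ℝ).smulRight α : ℝ →L[ℝ] ℝ) := by
      have := ((hasDerivAt_id s).const_mul α).add_const β
      rw [mul_one] at this
      exact hasMFDerivAt_iff_hasFDerivAt.2 this.hasFDerivAt
    refine (HasMFDerivAt.comp s hs h1).congr_mfderiv ?_
    refine ContinuousLinearMap.ext fun (r : ℝ) => ?_
    change (r * α) • f (γ (α * s + β)) (u (α * s + β)) = r • f (γ (α * s + β)) (α • u (α * s + β))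
    rw [map_smul, smul_smul]
  · filter_upwards [hq.ae h.speed] with s hs
    rw [(hN _).smul]
    gcongr

theorem IsCtrlOn.glue {u₁ u₂ : ℝ → CtrlSpace k} {γ₁ γ₂ : ℝ → M} {m : ℝ}
    (h₁ : IsCtrlOn f N u₁ γ₁ a m c) (h₂ : IsCtrlOn f N u₂ γ₂ m b c) (hm : m ∈ Icc a b)
    (hγ : γ₁ m = γ₂ m) :
    IsCtrlOn f N (fun t => if t ≤ m then u₁ t else u₂ t) (fun t => if t ≤ m then γ₁ t else γ₂ t)
      a b c := by
  set u := fun t => if t ≤ m then u₁ t else u₂ t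
  set γ := fun t => if t ≤ m then γ₁ t else γ₂ t
  have hγ1 : EqOn γ γ₁ (Icc a m) := fun t ht => if_pos ht.2
  have hγ2 : EqOn γ γ₂ (Icc m b) := fun t ht => by
    by_cases h : t ≤ m
    · obtain rfl : t = m := le_antisymm h ht.1
      exact (if_pos h).trans hγ
    · exact if_neg h
  have hunion : Icc a b = Icc a m ∪ Icc m b := (Icc_union_Icc_eq_Icc hm.1 hm.2).symm
  have hnm : ∀ᵐ t : ℝ, t ≠ m := by simp [ae_iff, measure_singleton]
  have hlt : ∀ t, t < m → γ =ᶠ[𝓝 t] γ₁ ∧ γ t = γ₁ t ∧ u t = u₁ t := fun t ht =>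
    ⟨by filter_upwards [eventually_lt_nhds ht] with s hs; exact if_pos hs.le,
      if_pos ht.le, if_pos ht.le⟩
  have hgt : ∀ t, m < t → γ =ᶠ[𝓝 t] γ₂ ∧ γ t = γ₂ t ∧ u t = u₂ t := fun t ht =>
    ⟨by filter_upwards [eventually_gt_nhds ht] with s hs; exact if_neg (not_le.2 hs),
      if_neg (not_le.2 ht), if_neg (not_le.2 ht)⟩
  -- Away from the null set `{m}` the glued curve has the germ of one of its pieces. The germ is
  -- what the derivative condition depends on.
  have hae : ∀ {P : (ℝ → M) → (ℝ → CtrlSpace k) → ℝ → Prop},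
      (∀ γ' u' t, γ =ᶠ[𝓝 t] γ' ∧ γ t = γ' t ∧ u t = u' t → P γ' u' t → P γ u t) →
      (∀ᵐ t ∂(volume.restrict (Icc a m)), P γ₁ u₁ t) →
      (∀ᵐ t ∂(volume.restrict (Icc m b)), P γ₂ u₂ t) →
      ∀ᵐ t ∂(volume.restrict (Icc a b)), P γ u t := by
    intro P hP hP1 hP2
    rw [ae_restrict_iff' measurableSet_Icc] at hP1 hP2 ⊢
    filter_upwards [hP1, hP2, hnm] with t ht1 ht2 htm ht
    rcases lt_or_gt_of_ne htm with h | h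
    · exact hP _ _ t (hlt t h) (ht1 ⟨ht.1, h.le⟩)
    · exact hP _ _ t (hgt t h) (ht2 ⟨h.le, ht.2⟩)
  obtain ⟨R₁, hR₁⟩ := h₁.bdd
  obtain ⟨R₂, hR₂⟩ := h₂.bdd
  refine ⟨?_, fun x₀ s t hs hst ht hsrc => ?_, ?_, ⟨max R₁ R₂, ?_⟩, ?_, ?_⟩
  · rw [hunion]
    exact (h₁.cont.congr hγ1).union_of_isClosed (h₂.cont.congr hγ2) isClosed_Icc isClosed_Icc
  · have key1 : t ≤ m → ∃ K, LipschitzOnWith K (extChartAt 𝓘(ℝ, V) x₀ ∘ γ) (Icc s t) := fun htm => by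
      have hsub : Icc s t ⊆ Icc a m := Icc_subset_Icc hs htm
      obtain ⟨K, hK⟩ := h₁.lip x₀ s t hs hst htm (hsrc.congr (hγ1.mono hsub))
      exact ⟨K, hK.congr_eqOn fun x hx => congrArg (extChartAt 𝓘(ℝ, V) x₀) (hγ1 (hsub hx))⟩
    have key2 : m ≤ s → ∃ K, LipschitzOnWith K (extChartAt 𝓘(ℝ, V) x₀ ∘ γ) (Icc s t) := fun htm => by
      have hsub : Icc s t ⊆ Icc m b := Icc_subset_Icc htm ht
      obtain ⟨K, hK⟩ := h₂.lip x₀ s t htm hst ht (hsrc.congr (hγ2.mono hsub))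
      exact ⟨K, hK.congr_eqOn fun x hx => congrArg (extChartAt 𝓘(ℝ, V) x₀) (hγ2 (hsub hx))⟩
    rcases le_total t m with htm | htm
    · exact key1 htm
    rcases le_total m s with hms | hms
    · exact key2 hms
    have hsub1 : Icc s m ⊆ Icc a m := Icc_subset_Icc hs le_rfl
    have hsub2 : Icc m t ⊆ Icc m b := Icc_subset_Icc le_rfl ht
    obtain ⟨K₁, hK₁⟩ := h₁.lip x₀ s m hs hms le_rfl
      ((hsrc.mono_left (Icc_subset_Icc_right htm)).congr (hγ1.mono hsub1))
    obtain ⟨K₂, hK₂⟩ := h₂.lip x₀ m t le_rfl htm ht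
      ((hsrc.mono_left (Icc_subset_Icc_left hms)).congr (hγ2.mono hsub2))
    refine ⟨max K₁ K₂, lipschitzOnWith_Icc_union ⟨hms, htm⟩ ?_ ?_⟩
    · exact (hK₁.weaken (le_max_left _ _)).congr_eqOn fun x hx =>
        congrArg (extChartAt 𝓘(ℝ, V) x₀) (hγ1 (hsub1 hx))
    · exact (hK₂.weaken (le_max_right _ _)).congr_eqOn fun x hx =>
        congrArg (extChartAt 𝓘(ℝ, V) x₀) (hγ2 (hsub2 hx))
  · rw [hunion, aestronglyMeasurable_union_iff]
    refine ⟨h₁.meas.congr ?_, h₂.meas.congr ?_⟩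
    · refine (ae_restrict_iff' measurableSet_Icc).2 (ae_of_all _ fun t ht => (if_pos ht.2).symm)
    · refine (ae_restrict_iff' measurableSet_Icc).2 ?_
      filter_upwards [hnm] with t htm ht
      exact (hgt t (lt_of_le_of_ne ht.1 htm.symm)).2.2.symm
  · exact hae (P := fun _ u t => ‖u t‖ ≤ max R₁ R₂) (fun γ' u' t h h' => by rwa [h.2.2])
      (hR₁.mono fun _ h => h.trans (le_max_left _ _))
      (hR₂.mono fun _ h => h.trans (le_max_right _ _))
  · exact hae (P := fun γ u t => HasMFDerivAt 𝓘(ℝ, ℝ) 𝓘(ℝ, V) γ t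
      ((1 : ℝ →L[ℝ] ℝ).smulRight (f (γ t) (u t) : TangentSpace 𝓘(ℝ, V) (γ t))))
      (fun γ' u' t h h' => by
        have h2 := h'.congr_of_eventuallyEq h.1
        rw [h.2.1, h.2.2]
        exact h2) h₁.deriv h₂.deriv
  · exact hae (P := fun γ u t => N (γ t) (u t) ≤ c) (fun γ' u' t h h' => by rwa [h.2.1, h.2.2])
      h₁.speed h₂.speed

theorem isCtrlOn_const (hN : ∀ p, IsNormFun (N p)) (p : M) (a b : ℝ) :
    IsCtrlOn f N (fun _ => 0) (fun _ => p) a b 0 := by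
  refine ⟨continuousOn_const, fun x₀ _ _ _ _ _ _ => ⟨0, ?_⟩, aestronglyMeasurable_const,
    ⟨0, by simp⟩, ae_of_all _ fun t => ?_, ae_of_all _ fun t => ((hN p).eq_zero_iff 0).2 rfl |>.le⟩
  · exact (LipschitzWith.const _).lipschitzOnWith
  · refine (hasMFDerivAt_const p t).congr_mfderiv ?_
    rw [map_zero]
    ext
    exact (smul_zero _).symm

end ControlledCurves

/-! ### Controlled curves as integral equations in a chart -/

section ChartCurves

variable {V : Type*} [NormedAddCommGroup V] [NormedSpace ℝ V]
  {M : Type*} [TopologicalSpace M] [ChartedSpace V M] [IsManifold 𝓘(ℝ, V) ∞ M] {k : ℕ}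

/-- The velocity, read in the chart around `x₀` at the point `y`, given by the control `v`. -/
noncomputable def chartVelocity (f : (p : M) → CtrlSpace k →L[ℝ] TangentSpace 𝓘(ℝ, V) p) (x₀ : M)
    (y : V) (v : CtrlSpace k) : V :=
  ∑ i, v i • vectorFieldInChart x₀ (fun p => f p (EuclideanSpace.single i 1)) y

theorem vectorFieldInChart_extChartAt (x₀ : M) (X : (p : M) → TangentSpace 𝓘(ℝ, V) p) {p : M}
    (hp : p ∈ (chartAt V x₀).source) :
    vectorFieldInChart x₀ X (extChartAt 𝓘(ℝ, V) x₀ p)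
      = mfderiv 𝓘(ℝ, V) 𝓘(ℝ, V) (extChartAt 𝓘(ℝ, V) x₀) p (X p) := by
  have h : (extChartAt 𝓘(ℝ, V) x₀).symm (extChartAt 𝓘(ℝ, V) x₀ p) = p :=
    (extChartAt 𝓘(ℝ, V) x₀).left_inv (by rwa [extChartAt_source])
  rw [vectorFieldInChart, h]

variable {f : (p : M) → CtrlSpace k →L[ℝ] TangentSpace 𝓘(ℝ, V) p} {N : M → CtrlSpace k → ℝ}
  {u : ℝ → CtrlSpace k} {γ : ℝ → M} {a b c : ℝ}

theorem chartVelocity_extChartAt (x₀ : M) (v : CtrlSpace k) {p : M}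
    (hp : p ∈ (chartAt V x₀).source) :
    chartVelocity f x₀ (extChartAt 𝓘(ℝ, V) x₀ p) v
      = mfderiv 𝓘(ℝ, V) 𝓘(ℝ, V) (extChartAt 𝓘(ℝ, V) x₀) p (f p v) := by
  rw [chartVelocity, ← vectorFieldInChart_eq_sum]
  exact vectorFieldInChart_extChartAt x₀ (fun p => f p v) hp

theorem HasMFDerivAt.hasDerivAt_extChartAt {t : ℝ} {x₀ : M} {v : CtrlSpace k}
    (h : HasMFDerivAt 𝓘(ℝ, ℝ) 𝓘(ℝ, V) γ t
      ((1 : ℝ →L[ℝ] ℝ).smulRight (f (γ t) v : TangentSpace 𝓘(ℝ, V) (γ t))))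
    (ht : γ t ∈ (chartAt V x₀).source) :
    HasDerivAt (extChartAt 𝓘(ℝ, V) x₀ ∘ γ)
      (chartVelocity f x₀ (extChartAt 𝓘(ℝ, V) x₀ (γ t)) v) t := by
  have : IsManifold 𝓘(ℝ, V) 1 M := IsManifold.of_le (n := ∞) (by simp)
  have h1 := (mdifferentiableAt_extChartAt (I := 𝓘(ℝ, V)) ht).hasMFDerivAt.comp t h
  let L : ℝ →L[ℝ] V :=
    (1 : ℝ →L[ℝ] ℝ).smulRight (chartVelocity f x₀ (extChartAt 𝓘(ℝ, V) x₀ (γ t)) v)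
  have h2 : HasMFDerivAt 𝓘(ℝ, ℝ) 𝓘(ℝ, V) (extChartAt 𝓘(ℝ, V) x₀ ∘ γ) t L := by
    refine h1.congr_mfderiv (ContinuousLinearMap.ext fun (r : ℝ) => ?_)
    change _ = r • chartVelocity f x₀ (extChartAt 𝓘(ℝ, V) x₀ (γ t)) v
    rw [chartVelocity_extChartAt x₀ v ht]
    exact map_smul (mfderiv 𝓘(ℝ, V) 𝓘(ℝ, V) (extChartAt 𝓘(ℝ, V) x₀) (γ t)) r (f (γ t) v)
  have h3 := hasMFDerivAt_iff_hasFDerivAt.1 h2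
  exact hasDerivAt_iff_hasFDerivAt.2 h3

theorem HasDerivAt.hasMFDerivAt_extChartAt_symm {y : ℝ → V} {t : ℝ} {x₀ : M} {v : CtrlSpace k}
    (h : HasDerivAt y (chartVelocity f x₀ (y t) v) t)
    (ht : y t ∈ (extChartAt 𝓘(ℝ, V) x₀).target) :
    HasMFDerivAt 𝓘(ℝ, ℝ) 𝓘(ℝ, V) (fun s => (extChartAt 𝓘(ℝ, V) x₀).symm (y s)) t
      ((1 : ℝ →L[ℝ] ℝ).smulRight (f ((extChartAt 𝓘(ℝ, V) x₀).symm (y t)) v :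
        TangentSpace 𝓘(ℝ, V) ((extChartAt 𝓘(ℝ, V) x₀).symm (y t)))) := by
  have : IsManifold 𝓘(ℝ, V) 1 M := IsManifold.of_le (n := ∞) (by simp)
  have h1 : MDifferentiableAt 𝓘(ℝ, V) 𝓘(ℝ, V) (extChartAt 𝓘(ℝ, V) x₀).symm (y t) :=
    ((contMDiffOn_extChartAt_symm (n := 1) x₀).contMDiffAt
      ((isOpen_extChartAt_target x₀).mem_nhds ht)).mdifferentiableAt (by simp)
  have h2 := h1.hasMFDerivAt.comp t (hasMFDerivAt_iff_hasFDerivAt.2 h.hasFDerivAt)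
  refine h2.congr_mfderiv ?_
  have h3 := mfderivWithin_extChartAt_symm_comp_mfderiv_extChartAt (I := 𝓘(ℝ, V)) ht
  rw [modelWithCornersSelf_coe, range_id, mfderivWithin_univ] at h3
  have h4 : chartVelocity f x₀ (y t) v = mfderiv 𝓘(ℝ, V) 𝓘(ℝ, V) (extChartAt 𝓘(ℝ, V) x₀)
      ((extChartAt 𝓘(ℝ, V) x₀).symm (y t)) (f _ v) := by
    rw [chartVelocity, ← vectorFieldInChart_eq_sum]
    rfl
  refine ContinuousLinearMap.ext fun (r : ℝ) => ?_
  change mfderiv 𝓘(ℝ, V) 𝓘(ℝ, V) (extChartAt 𝓘(ℝ, V) x₀).symm (y t)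
    (r • chartVelocity f x₀ (y t) v) = r • f ((extChartAt 𝓘(ℝ, V) x₀).symm (y t)) v
  refine (map_smul (mfderiv 𝓘(ℝ, V) 𝓘(ℝ, V) (extChartAt 𝓘(ℝ, V) x₀).symm (y t)) r _).trans ?_
  rw [h4]
  exact congrArg (r • ·) (DFunLike.congr_fun h3 (f _ v))

theorem abs_apply_le_norm (v : CtrlSpace k) (i : Fin k) : |v i| ≤ ‖v‖ := by
  simpa using PiLp.norm_apply_le v i

theorem IsCCBundleStructure.chart_velocity_bounds (hf : IsCCBundleStructure f N) {x₀ : M}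
    (hγ : ContinuousOn γ (Icc a b)) (hsrc : MapsTo γ (Icc a b) (chartAt V x₀).source)
    (hu : AEStronglyMeasurable u (volume.restrict (Icc a b))) {R : ℝ}
    (hR : ∀ᵐ t ∂(volume.restrict (Icc a b)), ‖u t‖ ≤ R) :
    AEStronglyMeasurable (fun t => chartVelocity f x₀ (extChartAt 𝓘(ℝ, V) x₀ (γ t)) (u t))
      (volume.restrict (Icc a b)) ∧
    ∃ C : ℝ≥0, ∀ᵐ t ∂(volume.restrict (Icc a b)),
      ‖chartVelocity f x₀ (extChartAt 𝓘(ℝ, V) x₀ (γ t)) (u t)‖ ≤ C := by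
  have hc : ∀ i : Fin k, ContinuousOn (fun t => vectorFieldInChart x₀
      (fun p => f p (EuclideanSpace.single i 1)) (extChartAt 𝓘(ℝ, V) x₀ (γ t))) (Icc a b) :=
    fun i => by
      have h1 : ContinuousOn (fun t => extChartAt 𝓘(ℝ, V) x₀ (γ t)) (Icc a b) :=
        (continuousOn_extChartAt x₀).comp hγ (by rwa [extChartAt_source])
      refine (((hf.isSmoothField _).contDiffOn_vectorFieldInChart x₀).continuousOn).comp h1
        fun t ht => (extChartAt 𝓘(ℝ, V) x₀).map_source ?_
      rw [extChartAt_source]; exact hsrc ht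
  have hb : ∀ i : Fin k, ∃ B, ∀ t ∈ Icc a b, ‖vectorFieldInChart x₀
      (fun p => f p (EuclideanSpace.single i 1)) (extChartAt 𝓘(ℝ, V) x₀ (γ t))‖ ≤ B := fun i =>
    isCompact_Icc.exists_bound_of_continuousOn (hc i)
  choose B hB using hb
  refine ⟨?_, (∑ i, |R| * |B i|).toNNReal, ?_⟩
  · have : (fun t => chartVelocity f x₀ (extChartAt 𝓘(ℝ, V) x₀ (γ t)) (u t))
        = ∑ i, fun t => u t i • vectorFieldInChart x₀
          (fun p => f p (EuclideanSpace.single i 1)) (extChartAt 𝓘(ℝ, V) x₀ (γ t)) := by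
      ext t; simp [chartVelocity]
    rw [this]
    refine Finset.aestronglyMeasurable_sum _ fun i _ => ?_
    exact ((EuclideanSpace.proj (𝕜 := ℝ) i).continuous.comp_aestronglyMeasurable hu).smul
      ((hc i).aestronglyMeasurable measurableSet_Icc)
  · rw [ae_restrict_iff' measurableSet_Icc] at hR ⊢
    filter_upwards [hR] with t ht htm
    rw [Real.coe_toNNReal _ (Finset.sum_nonneg fun i _ => by positivity)]
    refine (norm_sum_le _ _).trans (Finset.sum_le_sum fun i _ => ?_)
    rw [norm_smul, Real.norm_eq_abs]
    have h1 := (abs_apply_le_norm (u t) i).trans ((ht htm).trans (le_abs_self R))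
    have h2 := (hB i t htm).trans (le_abs_self _)
    gcongr

theorem intervalIntegrable_of_ae_bound {g : ℝ → V} {C : ℝ≥0} {a b s t : ℝ}
    (hm : AEStronglyMeasurable g (volume.restrict (Icc a b)))
    (hC : ∀ᵐ t ∂(volume.restrict (Icc a b)), ‖g t‖ ≤ C) (hs : s ∈ Icc a b) (ht : t ∈ Icc a b) :
    IntervalIntegrable g volume s t := by
  have h : IntegrableOn g (Icc a b) := ⟨hm, .of_bounded hC⟩
  rw [intervalIntegrable_iff]
  refine h.mono_set (uIoc_subset_uIcc.trans ?_)
  exact uIcc_subset_Icc hs ht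

theorem lipschitzOnWith_of_integral {y g : ℝ → V} {C : ℝ≥0} {a b : ℝ}
    (hC : ∀ᵐ t ∂(volume.restrict (Icc a b)), ‖g t‖ ≤ C)
    (h : ∀ s ∈ Icc a b, ∀ t ∈ Icc a b, y t - y s = ∫ τ in s..t, g τ) :
    LipschitzOnWith C y (Icc a b) := by
  refine LipschitzOnWith.of_dist_le_mul fun s hs t ht => ?_
  rw [dist_comm, dist_comm s, dist_eq_norm, h s hs t ht, Real.dist_eq]
  refine intervalIntegral.norm_integral_le_of_norm_le_const_ae ?_
  rw [ae_restrict_iff' measurableSet_Icc] at hC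
  filter_upwards [hC] with τ hτ hτ'
  exact hτ (uIcc_subset_Icc hs ht (uIoc_subset_uIcc hτ'))

theorem IsCCBundleStructure.sub_eq_integral [CompleteSpace V] (hf : IsCCBundleStructure f N)
    {x₀ : M} (hγ : ContinuousOn γ (Icc a b)) (hsrc : MapsTo γ (Icc a b) (chartAt V x₀).source)
    (hac : AbsolutelyContinuousOnInterval (extChartAt 𝓘(ℝ, V) x₀ ∘ γ) a b)
    (hu : AEStronglyMeasurable u (volume.restrict (Icc a b))) {R : ℝ}
    (hR : ∀ᵐ t ∂(volume.restrict (Icc a b)), ‖u t‖ ≤ R)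
    (hd : ∀ᵐ t ∂(volume.restrict (Icc a b)), HasMFDerivAt 𝓘(ℝ, ℝ) 𝓘(ℝ, V) γ t
      ((1 : ℝ →L[ℝ] ℝ).smulRight (f (γ t) (u t) : TangentSpace 𝓘(ℝ, V) (γ t))))
    {s t : ℝ} (hs : s ∈ Icc a b) (ht : t ∈ Icc a b) :
    extChartAt 𝓘(ℝ, V) x₀ (γ t) - extChartAt 𝓘(ℝ, V) x₀ (γ s)
      = ∫ τ in s..t, chartVelocity f x₀ (extChartAt 𝓘(ℝ, V) x₀ (γ τ)) (u τ) := by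
  obtain ⟨hm, C, hC⟩ := hf.chart_velocity_bounds hγ hsrc hu hR
  have hsub : uIcc s t ⊆ Icc a b := uIcc_subset_Icc hs ht
  refine (hac.mono (c := s) (d := t) ?_).sub_eq_integral
    (intervalIntegrable_of_ae_bound hm hC hs ht) ?_
  · exact hsub.trans Icc_subset_uIcc
  · rw [ae_restrict_iff' measurableSet_Icc] at hd
    filter_upwards [hd] with τ hτ hτ'
    exact (hτ (hsub hτ')).hasDerivAt_extChartAt (hsrc (hsub hτ'))

/-- A bounded control gives a bounded velocity in the chart, and absolute continuity makes the curve
the integral of its velocity. So the curve is Lipschitz there, a property that passes easily to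
glued and reparametrised curves. -/
theorem IsControlledCurve.isCtrlOn [CompleteSpace V] (hf : IsCCBundleStructure f N)
    (hγ : IsControlledCurve f u γ) (hu : MemLp u ⊤ (volume.restrict (Icc (0 : ℝ) 1)))
    (hc : ∀ᵐ t ∂(volume.restrict (Icc (0 : ℝ) 1)), N (γ t) (u t) ≤ c) :
    IsCtrlOn f N u γ 0 1 c := by
  have hR : ∀ᵐ t ∂(volume.restrict (Icc (0 : ℝ) 1)),
      ‖u t‖ ≤ (eLpNorm u ⊤ (volume.restrict (Icc (0 : ℝ) 1))).toReal := by
    filter_upwards [ae_le_eLpNormEssSup (f := u) (μ := volume.restrict (Icc (0 : ℝ) 1))] with t ht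
    rw [← eLpNorm_exponent_top] at ht
    rw [← toReal_enorm]
    exact ENNReal.toReal_mono hu.2.ne ht
  refine ⟨hγ.continuousOn, fun x₀ s t hs hst ht hsrc => ?_, hu.1, ⟨_, hR⟩, hγ.ae_hasDeriv, hc⟩
  have hle : volume.restrict (Icc s t) ≤ volume.restrict (Icc 0 1) :=
    Measure.restrict_mono (Icc_subset_Icc hs ht) le_rfl
  have hcont := hγ.continuousOn.mono (Icc_subset_Icc hs ht)
  have hm := hu.1.mono_measure hle
  obtain ⟨-, C, hC⟩ := hf.chart_velocity_bounds hcont hsrc hm (ae_mono hle hR)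
  exact ⟨C, lipschitzOnWith_of_integral hC fun s' hs' t' ht' =>
    hf.sub_eq_integral hcont hsrc (hγ.absolutelyContinuous x₀ s t hs hst ht hsrc) hm
      (ae_mono hle hR) (ae_mono hle hγ.ae_hasDeriv) hs' ht'⟩

theorem IsCtrlOn.sub_eq_integral [CompleteSpace V] (hf : IsCCBundleStructure f N)
    (h : IsCtrlOn f N u γ a b c) (hab : a ≤ b) {x₀ : M}
    (hsrc : MapsTo γ (Icc a b) (chartAt V x₀).source)
    {s t : ℝ} (hs : s ∈ Icc a b) (ht : t ∈ Icc a b) :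
    extChartAt 𝓘(ℝ, V) x₀ (γ t) - extChartAt 𝓘(ℝ, V) x₀ (γ s)
      = ∫ τ in s..t, chartVelocity f x₀ (extChartAt 𝓘(ℝ, V) x₀ (γ τ)) (u τ) := by
  obtain ⟨K, hK⟩ := h.lip x₀ a b le_rfl hab le_rfl hsrc
  obtain ⟨R, hR⟩ := h.bdd
  exact hf.sub_eq_integral h.cont hsrc
    (LipschitzOnWith.absolutelyContinuousOnInterval (by rwa [uIcc_of_le hab])) h.meas hR h.deriv
    hs ht

theorem IsCtrlOn.isControlledCurve (h : IsCtrlOn f N u γ 0 1 c) : IsControlledCurve f u γ where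
  continuousOn := h.cont
  absolutelyContinuous x₀ s t hs hst ht hsrc := by
    obtain ⟨K, hK⟩ := h.lip x₀ s t hs hst ht hsrc
    exact LipschitzOnWith.absolutelyContinuousOnInterval (by rwa [uIcc_of_le hst])
  ae_hasDeriv := h.deriv

end ChartCurves

/-! ### The Carnot–Carathéodory distance as an extended pseudometric -/

section Distance

variable {V : Type*} [NormedAddCommGroup V] [NormedSpace ℝ V] [CompleteSpace V]
  {M : Type*} [TopologicalSpace M] [ChartedSpace V M] [IsManifold 𝓘(ℝ, V) ∞ M] {k : ℕ}
  {f : (p : M) → CtrlSpace k →L[ℝ] TangentSpace 𝓘(ℝ, V) p} {N : M → CtrlSpace k → ℝ}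
  {u : ℝ → CtrlSpace k} {γ : ℝ → M} {a b c : ℝ}

theorem IsCtrlOn.ccDist_le_of_unit (h : IsCtrlOn f N u γ 0 1 c) :
    ccDist f N (γ 0) (γ 1) ≤ ENNReal.ofReal c := by
  obtain ⟨R, hR⟩ := h.bdd
  have hmem : ccDist f N (γ 0) (γ 1) ≤ ccEnergy N u γ :=
    sInf_le ⟨u, γ, memLp_top_of_bound h.meas R hR, h.isControlledCurve, rfl, rfl, rfl⟩
  refine hmem.trans ?_
  exact essSup_le_of_ae_le _ (h.speed.mono fun t ht => ENNReal.ofReal_le_ofReal ht)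

theorem IsCtrlOn.ccDist_le (hf : IsCCBundleStructure f N) (h : IsCtrlOn f N u γ a b c)
    (hab : a < b) : ccDist f N (γ a) (γ b) ≤ ENNReal.ofReal ((b - a) * c) := by
  have h1 := h.comp_affine hf.isNorm (α := b - a) (by linarith) a (a' := 0) (b' := 1)
    (fun s hs => ⟨by nlinarith [hs.1], by nlinarith [hs.2]⟩)
  have h2 := h1.ccDist_le_of_unit
  rw [abs_of_pos (by linarith)] at h2
  simpa using h2

theorem exists_isCtrlOn_of_ccDist_lt (hf : IsCCBundleStructure f N) {p q : M}
    (h : ccDist f N p q < ENNReal.ofReal c) :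
    ∃ u γ, IsCtrlOn f N u γ 0 1 c ∧ γ 0 = p ∧ γ 1 = q := by
  obtain ⟨e, ⟨u, γ, hu, hγ, h0, h1, rfl⟩, he⟩ := sInf_lt_iff.1 h
  refine ⟨u, γ, hγ.isCtrlOn hf hu ?_, h0, h1⟩
  have hc : 0 < c := ENNReal.ofReal_pos.1 (lt_of_le_of_lt (zero_le) he)
  filter_upwards [ENNReal.ae_le_essSup (μ := volume.restrict (Icc (0 : ℝ) 1))
    (fun t => ENNReal.ofReal (N (γ t) (u t)))] with t ht
  exact (ENNReal.ofReal_le_ofReal_iff hc.le).1 (ht.trans he.le)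

/-- Points at distance less than `T` are joined by a curve of speed at most one defined on an
interval of length `T`. -/
theorem exists_isCtrlOn_length (hf : IsCCBundleStructure f N) {p q : M} {T : ℝ}
    (h : ccDist f N p q < ENNReal.ofReal T) (a : ℝ) :
    ∃ u γ, IsCtrlOn f N u γ a (a + T) 1 ∧ γ a = p ∧ γ (a + T) = q := by
  have hT : 0 < T := ENNReal.ofReal_pos.1 (lt_of_le_of_lt (zero_le) h)
  obtain ⟨u, γ, hγ, h0, h1⟩ := exists_isCtrlOn_of_ccDist_lt hf h
  have h2 := hγ.comp_affine hf.isNorm (α := T⁻¹) (by positivity) (-(T⁻¹ * a)) (a' := a)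
    (b' := a + T) (fun s hs => by
      have e : T⁻¹ * s + -(T⁻¹ * a) = (s - a) / T := by field_simp; ring
      simp only [e]
      exact ⟨div_nonneg (by linarith [hs.1]) hT.le,
        (div_le_one hT).2 (by linarith [hs.2])⟩)
  rw [abs_of_pos (by positivity), inv_mul_cancel₀ hT.ne'] at h2
  refine ⟨_, _, h2, ?_, ?_⟩
  · simpa using h0
  · have e : T⁻¹ * (a + T) + -(T⁻¹ * a) = 1 := by field_simp; ring
    simp only [e]
    exact h1

theorem ccDist_self (hf : IsCCBundleStructure f N) (p : M) : ccDist f N p p = 0 := by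
  have h := (isCtrlOn_const (f := f) hf.isNorm p 0 1).ccDist_le_of_unit
  simpa using h

theorem ccDist_comm_le (hf : IsCCBundleStructure f N) (p q : M) :
    ccDist f N q p ≤ ccDist f N p q := by
  refine ENNReal.le_of_forall_pos_le_add fun ε hε hfin => ?_
  have hε' : (0 : ℝ) ≤ ε := ε.coe_nonneg
  have hlt : ccDist f N p q < ENNReal.ofReal ((ccDist f N p q).toReal + ε) := by
    rw [ENNReal.ofReal_add ENNReal.toReal_nonneg hε', ENNReal.ofReal_toReal hfin.ne]
    exact ENNReal.lt_add_right hfin.ne (by simpa using hε.ne')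
  obtain ⟨u, γ, hγ, h0, h1⟩ := exists_isCtrlOn_of_ccDist_lt hf hlt
  have h2 := (hγ.comp_affine hf.isNorm (α := -1) (by norm_num) 1 (a' := 0) (b' := 1)
    (fun s hs => ⟨by linarith [hs.2], by linarith [hs.1]⟩)).ccDist_le_of_unit
  rw [abs_neg, abs_one, one_mul, ENNReal.ofReal_add ENNReal.toReal_nonneg hε',
    ENNReal.ofReal_toReal hfin.ne, ENNReal.ofReal_coe_nnreal] at h2
  simpa [h0, h1] using h2

theorem ccDist_comm (hf : IsCCBundleStructure f N) (p q : M) :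
    ccDist f N p q = ccDist f N q p :=
  le_antisymm (ccDist_comm_le hf q p) (ccDist_comm_le hf p q)

/-- Energies, being essential suprema, do not add under concatenation. So almost optimal curves are
rescaled to speed at most one on intervals of lengths `T₁` and `T₂`, and it is the lengths that add.
-/
theorem ccDist_triangle (hf : IsCCBundleStructure f N) (p q r : M) :
    ccDist f N p r ≤ ccDist f N p q + ccDist f N q r := by
  refine ENNReal.le_of_forall_pos_le_add fun ε hε hfin => ?_
  have hfin1 := (ENNReal.add_lt_top.1 hfin).1
  have hfin2 := (ENNReal.add_lt_top.1 hfin).2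
  have hlt : ∀ p q, ccDist f N p q < ⊤ →
      ccDist f N p q < ENNReal.ofReal ((ccDist f N p q).toReal + ε / 2) := fun p q hfin => by
    rw [ENNReal.ofReal_add ENNReal.toReal_nonneg (by positivity), ENNReal.ofReal_toReal hfin.ne]
    refine ENNReal.lt_add_right hfin.ne ?_
    rw [ne_eq, ENNReal.ofReal_eq_zero, not_le]
    have : (0 : ℝ) < ε := hε
    linarith
  set T₁ := (ccDist f N p q).toReal + ε / 2
  set T₂ := (ccDist f N q r).toReal + ε / 2
  have hε' : (0 : ℝ) < ε := hε
  have hT₁ : 0 < T₁ := by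
    have : 0 ≤ (ccDist f N p q).toReal := ENNReal.toReal_nonneg
    positivity
  have hT₂ : 0 < T₂ := by
    have : 0 ≤ (ccDist f N q r).toReal := ENNReal.toReal_nonneg
    positivity
  obtain ⟨u₁, γ₁, hγ₁, h10, h11⟩ := exists_isCtrlOn_length (T := T₁) hf (hlt p q hfin1) 0
  obtain ⟨u₂, γ₂, hγ₂, h20, h21⟩ := exists_isCtrlOn_length (T := T₂) hf (hlt q r hfin2) (0 + T₁)
  have hg := hγ₁.glue hγ₂ ⟨by linarith, by linarith⟩ (h11.trans h20.symm)
  have h := hg.ccDist_le hf (by linarith)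
  rw [if_pos (by linarith), if_neg (by linarith), h10, h21] at h
  refine h.trans (le_of_eq ?_)
  have e : (0 + T₁ + T₂ - 0) * 1
      = (ccDist f N p q).toReal + (ccDist f N q r).toReal + ε := by
    simp only [T₁, T₂]; ring
  rw [e, ENNReal.ofReal_add (by positivity) hε'.le, ENNReal.ofReal_add (by positivity)
    (by positivity), ENNReal.ofReal_toReal hfin1.ne, ENNReal.ofReal_toReal hfin2.ne,
    ENNReal.ofReal_coe_nnreal]

/-- Points at distance less than `c` are joined by chains of `m` steps of length at most `c / m`. -/
theorem exists_ccDist_chain (hf : IsCCBundleStructure f N) {p q : M}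
    (h : ccDist f N p q < ENNReal.ofReal c) {m : ℕ} (hm : 0 < m) :
    ∃ x : ℕ → M, x 0 = p ∧ x m = q ∧
      ∀ i < m, ccDist f N (x i) (x (i + 1)) ≤ ENNReal.ofReal (c / m) := by
  obtain ⟨u, γ, hγ, h0, h1⟩ := exists_isCtrlOn_of_ccDist_lt hf h
  have hm' : (0 : ℝ) < m := by exact_mod_cast hm
  refine ⟨fun i => γ (i / m), by simpa using h0, by simpa [hm'.ne'] using h1, fun i hi => ?_⟩
  have hi' : (i : ℝ) + 1 ≤ m := by exact_mod_cast hi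
  have h2 := (hγ.mono (a' := i / m) (b' := (i + 1) / m) (by positivity)
    ((div_le_one hm').2 hi')).ccDist_le hf (by gcongr; linarith)
  have e : ((i + 1 : ℝ) / m - i / m) * c = c / m := by field_simp; ring
  rw [e] at h2
  simpa using h2

theorem exists_continuousOn_of_ccDist_lt_top {p q : M}
    (h : ccDist f N p q < ⊤) : ∃ γ : ℝ → M, ContinuousOn γ (Icc 0 1) ∧ γ 0 = p ∧ γ 1 = q := by
  obtain ⟨e, ⟨u, γ, hu, hγ, h0, h1, rfl⟩, he⟩ := sInf_lt_iff.1 h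
  exact ⟨γ, hγ.continuousOn, h0, h1⟩

end Distance

/-! ### Lifting chart solutions to the manifold -/

section Lift

variable {V : Type*} [NormedAddCommGroup V] [NormedSpace ℝ V] [CompleteSpace V]
  {M : Type*} [TopologicalSpace M] [ChartedSpace V M] [IsManifold 𝓘(ℝ, V) ∞ M] {k : ℕ}
  {f : (p : M) → CtrlSpace k →L[ℝ] TangentSpace 𝓘(ℝ, V) p} {N : M → CtrlSpace k → ℝ}
  {u : ℝ → CtrlSpace k} {a b c : ℝ}

theorem locallyLipschitzOn_of_contDiffOn {E F : Type*} [NormedAddCommGroup E] [NormedSpace ℝ E]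
    [NormedAddCommGroup F] [NormedSpace ℝ F] {g : E → F} {O : Set E} (hO : IsOpen O)
    (hg : ContDiffOn ℝ 1 g O) : LocallyLipschitzOn O g := fun x hx => by
  obtain ⟨K, t, ht, hK⟩ := ((hg x hx).contDiffAt (hO.mem_nhds hx)).exists_lipschitzOnWith
  exact ⟨K, t, mem_nhdsWithin_of_mem_nhds ht, hK⟩

/-- Solutions in a chart are controlled curves of the manifold. -/
theorem IsCCBundleStructure.isCtrlOn_extChartAt_symm (hf : IsCCBundleStructure f N) {x₀ : M}
    {y : ℝ → V} (hy : ContinuousOn y (Icc a b))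
    (hyt : MapsTo y (Icc a b) (extChartAt 𝓘(ℝ, V) x₀).target)
    (hu : AEStronglyMeasurable u (volume.restrict (Icc a b))) {R : ℝ}
    (hR : ∀ᵐ t ∂(volume.restrict (Icc a b)), ‖u t‖ ≤ R)
    (hint : ∀ s ∈ Icc a b, ∀ t ∈ Icc a b, y t - y s = ∫ τ in s..t, chartVelocity f x₀ (y τ) (u τ))
    (hspeed : ∀ᵐ t ∂(volume.restrict (Icc a b)),
      N ((extChartAt 𝓘(ℝ, V) x₀).symm (y t)) (u t) ≤ c) :
    IsCtrlOn f N u (fun t => (extChartAt 𝓘(ℝ, V) x₀).symm (y t)) a b c := by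
  set γ := fun t => (extChartAt 𝓘(ℝ, V) x₀).symm (y t) with hγdef
  have hγ : ContinuousOn γ (Icc a b) := (continuousOn_extChartAt_symm x₀).comp hy hyt
  have hsrc0 : MapsTo γ (Icc a b) (chartAt V x₀).source := fun t ht => by
    have := (extChartAt 𝓘(ℝ, V) x₀).map_target (hyt ht)
    rwa [extChartAt_source] at this
  have hφγ : ∀ t ∈ Icc a b, extChartAt 𝓘(ℝ, V) x₀ (γ t) = y t := fun t ht =>
    (extChartAt 𝓘(ℝ, V) x₀).right_inv (hyt ht)
  obtain ⟨hm, C, hC⟩ := hf.chart_velocity_bounds hγ hsrc0 hu hR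
  have hae : (fun t => chartVelocity f x₀ (extChartAt 𝓘(ℝ, V) x₀ (γ t)) (u t))
      =ᵐ[volume.restrict (Icc a b)] fun t => chartVelocity f x₀ (y t) (u t) :=
    (ae_restrict_iff' measurableSet_Icc).2 (ae_of_all _ fun t ht => by simp only [hφγ t ht])
  replace hm := hm.congr hae
  replace hC : ∀ᵐ t ∂(volume.restrict (Icc a b)), ‖chartVelocity f x₀ (y t) (u t)‖ ≤ C := by
    filter_upwards [hC, hae] with t h1 h2
    rwa [← h2]
  have hlip : LipschitzOnWith C y (Icc a b) := lipschitzOnWith_of_integral hC hint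
  refine ⟨hγ, fun x₁ s t hs hst ht hsrc => ?_, hu, ⟨R, hR⟩, ?_, hspeed⟩
  · have hsub : Icc s t ⊆ Icc a b := Icc_subset_Icc hs ht
    -- In another chart the curve is composed with a smooth transition map, which is Lipschitz on
    -- the compact image of the curve.
    set O := ((extChartAt 𝓘(ℝ, V) x₀).symm ≫ extChartAt 𝓘(ℝ, V) x₁).source with hOdef
    have hO : IsOpen O := by
      rw [hOdef, PartialEquiv.trans_source, PartialEquiv.symm_source, extChartAt_source]
      exact (continuousOn_extChartAt_symm x₀).isOpen_inter_preimage (isOpen_extChartAt_target x₀)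
        (chartAt V x₁).open_source
    have h1 : LocallyLipschitzOn O (extChartAt 𝓘(ℝ, V) x₁ ∘ (extChartAt 𝓘(ℝ, V) x₀).symm) :=
      locallyLipschitzOn_of_contDiffOn hO
        ((contDiffOn_ext_coord_change (n := ∞) x₁ x₀).of_le (by simp))
    have h2 : y '' Icc s t ⊆ O := by
      rintro _ ⟨τ, hτ, rfl⟩
      rw [hOdef, PartialEquiv.trans_source, PartialEquiv.symm_source, extChartAt_source]
      exact ⟨hyt (hsub hτ), hsrc hτ⟩
    obtain ⟨K, hK⟩ := LocallyLipschitzOn.exists_lipschitzOnWith_of_compact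
      (isCompact_Icc.image_of_continuousOn (hy.mono hsub)) (h1.mono h2)
    exact ⟨K * C, hK.comp (hlip.mono hsub) (mapsTo_image _ _)⟩
  · rcases lt_or_ge b a with hba | hab
    · rw [Icc_eq_empty (not_le.2 hba)]; simp
    have hii : IntervalIntegrable (fun t => chartVelocity f x₀ (y t) (u t)) volume a b :=
      intervalIntegrable_of_ae_bound hm hC ⟨le_rfl, hab⟩ ⟨hab, le_rfl⟩
    rw [ae_restrict_iff' measurableSet_Icc]
    -- The integral equation holds on `[a, b]` only, so a two-sided derivative requires discarding
    -- the endpoints.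
    have hna : ∀ᵐ t : ℝ, t ≠ a := by simp [ae_iff, measure_singleton]
    have hnb : ∀ᵐ t : ℝ, t ≠ b := by simp [ae_iff, measure_singleton]
    filter_upwards [hii.ae_hasDerivAt_integral, hna, hnb] with t ht hta htb htm
    rw [uIcc_of_le hab] at ht
    have h1 := (ht htm a ⟨le_rfl, hab⟩).const_add (y a)
    refine HasDerivAt.hasMFDerivAt_extChartAt_symm ?_ (hyt htm)
    refine h1.congr_of_eventuallyEq ?_
    filter_upwards [Icc_mem_nhds (lt_of_le_of_ne htm.1 hta.symm) (lt_of_le_of_ne htm.2 htb)]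
      with s hs
    rw [← hint a ⟨le_rfl, hab⟩ s hs]; abel

end Lift

/-! ### Uniform estimates for the structures in one chart -/

section ChartModel

variable {V : Type*} [NormedAddCommGroup V] [NormedSpace ℝ V]
  {M : Type*} [TopologicalSpace M] [ChartedSpace V M]
  {Λ : Type*} [TopologicalSpace Λ] {k : ℕ}

/-- The linear combination of the fields `X i` with coefficients `v`. -/
def combField (X : Fin k → V → V) (y : V) (v : CtrlSpace k) : V := ∑ i, v i • X i y

/-- The fields `X` and the constants `ρ`, `A` control the structures `(f_l, N_l)` uniformly in `l`
in the chart around `x₀`. -/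
structure IsChartModel (f : Λ → (p : M) → CtrlSpace k →L[ℝ] TangentSpace 𝓘(ℝ, V) p)
    (N : Λ → M → CtrlSpace k → ℝ) (x₀ : M) (X : Λ → Fin k → V → V) (ρ A : ℝ) : Prop where
  pos : 0 < A
  subset : Metric.closedBall (extChartAt 𝓘(ℝ, V) x₀ x₀) ρ ⊆ (extChartAt 𝓘(ℝ, V) x₀).target
  family : ∀ i, IsBddFamily A (fun l => X l i)
  eqOn : ∀ l i, EqOn (X l i) (vectorFieldInChart x₀ fun p => f l p (EuclideanSpace.single i 1))
    (Metric.closedBall (extChartAt 𝓘(ℝ, V) x₀ x₀) ρ)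
  norm_le : ∀ l, ∀ y ∈ Metric.closedBall (extChartAt 𝓘(ℝ, V) x₀ x₀) ρ, ∀ v,
    ‖v‖ ≤ A * N l ((extChartAt 𝓘(ℝ, V) x₀).symm y) v
  le_norm : ∀ l, ∀ y ∈ Metric.closedBall (extChartAt 𝓘(ℝ, V) x₀ x₀) ρ, ∀ v,
    N l ((extChartAt 𝓘(ℝ, V) x₀).symm y) v ≤ A * ‖v‖
  comb_le : ∀ l y v, ‖combField (X l) y v‖ ≤ A * ‖v‖
  comb_sub_le : ∀ l y y' v, ‖combField (X l) y v - combField (X l) y' v‖ ≤ A * ‖v‖ * ‖y - y'‖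

theorem IsChartModel.mono {f : Λ → (p : M) → CtrlSpace k →L[ℝ] TangentSpace 𝓘(ℝ, V) p}
    {N : Λ → M → CtrlSpace k → ℝ} {x₀ : M} {X : Λ → Fin k → V → V} {ρ ρ' A : ℝ}
    (h : IsChartModel f N x₀ X ρ A) (hρ : ρ' ≤ ρ) : IsChartModel f N x₀ X ρ' A :=
  have hsub := Metric.closedBall_subset_closedBall (x := extChartAt 𝓘(ℝ, V) x₀ x₀) hρ
  { h with
    subset := hsub.trans h.subset
    eqOn := fun l i => (h.eqOn l i).mono hsub
    norm_le := fun l y hy => h.norm_le l y (hsub hy)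
    le_norm := fun l y hy => h.le_norm l y (hsub hy) }

theorem IsChartModel.chartVelocity_eq
    {f : Λ → (p : M) → CtrlSpace k →L[ℝ] TangentSpace 𝓘(ℝ, V) p}
    {N : Λ → M → CtrlSpace k → ℝ} {x₀ : M} {X : Λ → Fin k → V → V} {ρ A : ℝ}
    (h : IsChartModel f N x₀ X ρ A) (l : Λ) {y : V}
    (hy : y ∈ Metric.closedBall (extChartAt 𝓘(ℝ, V) x₀ x₀) ρ) (v : CtrlSpace k) :
    chartVelocity (f l) x₀ y v = combField (X l) y v :=
  Finset.sum_congr rfl fun i _ => by rw [h.eqOn l i hy]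

theorem combField_single (X : Fin k → V → V) (y : V) (i : Fin k) (t : ℝ) :
    combField X y (t • EuclideanSpace.single i 1) = t • X i y := by
  rw [combField, Finset.sum_eq_single i]
  · simp
  · intro j _ hj; simp [hj]
  · simp

theorem norm_combField_sub_le {X X' : Fin k → V → V} {y y' : V} {ε : ℝ}
    (h : ∀ i, ‖X i y - X' i y'‖ ≤ ε) (v : CtrlSpace k) :
    ‖combField X y v - combField X' y' v‖ ≤ k * ε * ‖v‖ := by
  rw [combField, combField, ← Finset.sum_sub_distrib]
  refine (norm_sum_le _ _).trans ((Finset.sum_le_card_nsmul _ _ (ε * ‖v‖) fun i _ => ?_).trans ?_)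
  · rw [← smul_sub, norm_smul, mul_comm, Real.norm_eq_abs]
    have h1 := abs_apply_le_norm v i
    have h2 := h i
    have h3 := (norm_nonneg _).trans h2
    gcongr
  · simp [mul_assoc]

theorem continuousOn_norm_chart [IsManifold 𝓘(ℝ, V) ∞ M]
    {f : Λ → (p : M) → CtrlSpace k →L[ℝ] TangentSpace 𝓘(ℝ, V) p}
    {N : Λ → M → CtrlSpace k → ℝ} (h : IsContinuouslyVaryingCC f N) (x₀ : M) :
    ContinuousOn (fun z : Λ × V × CtrlSpace k =>
      N z.1 ((extChartAt 𝓘(ℝ, V) x₀).symm z.2.1) z.2.2)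
      (univ ×ˢ ((extChartAt 𝓘(ℝ, V) x₀).target ×ˢ univ)) := by
  refine h.continuous_norm.comp_continuousOn (f := fun z : Λ × V × CtrlSpace k =>
    (z.1, (extChartAt 𝓘(ℝ, V) x₀).symm z.2.1, z.2.2)) ?_
  refine continuousOn_fst.prodMk (ContinuousOn.prodMk ?_ (by fun_prop))
  exact (continuousOn_extChartAt_symm x₀).comp (by fun_prop) fun z hz => hz.2.1

variable [FiniteDimensional ℝ V] [IsManifold 𝓘(ℝ, V) ∞ M] [CompactSpace Λ]
  {f : Λ → (p : M) → CtrlSpace k →L[ℝ] TangentSpace 𝓘(ℝ, V) p}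
  {N : Λ → M → CtrlSpace k → ℝ}

/-- By homogeneity it suffices to bound `N` and its inverse on the compact set `Λ × B × sphere`,
where `N` is continuous and positive. -/
theorem IsContinuouslyVaryingCC.exists_norm_comparison (h : IsContinuouslyVaryingCC f N) {x₀ : M}
    {B : Set V} (hB : IsCompact B) (hBt : B ⊆ (extChartAt 𝓘(ℝ, V) x₀).target) :
    ∃ A > 0, ∀ l, ∀ y ∈ B, ∀ v,
      ‖v‖ ≤ A * N l ((extChartAt 𝓘(ℝ, V) x₀).symm y) v ∧
      N l ((extChartAt 𝓘(ℝ, V) x₀).symm y) v ≤ A * ‖v‖ := by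
  set S := (univ : Set Λ) ×ˢ (B ×ˢ Metric.sphere (0 : CtrlSpace k) 1)
  have hS : IsCompact S := isCompact_univ.prod (hB.prod (isCompact_sphere 0 1))
  have hc := (continuousOn_norm_chart h x₀).mono
    (prod_mono (subset_refl univ) (prod_mono hBt (subset_univ _)) : S ⊆ _)
  have hpos : ∀ z ∈ S, 0 < N z.1 ((extChartAt 𝓘(ℝ, V) x₀).symm z.2.1) z.2.2 := fun z hz => by
    refine lt_of_le_of_ne (((h.isCC z.1).isNorm _).nonneg _) fun h0 => ?_
    have h1 := (((h.isCC z.1).isNorm _).eq_zero_iff _).1 h0.symm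
    have h2 := hz.2.2
    rw [h1] at h2
    simp at h2
  obtain ⟨C₁, hC₁⟩ := hS.exists_bound_of_continuousOn hc
  obtain ⟨C₂, hC₂⟩ : ∃ C₂, ∀ z ∈ S, ‖(N z.1 ((extChartAt 𝓘(ℝ, V) x₀).symm z.2.1) z.2.2)⁻¹‖ ≤ C₂ :=
    hS.exists_bound_of_continuousOn (hc.inv₀ fun z hz => (hpos z hz).ne')
  refine ⟨max 1 (max C₁ C₂), by positivity, fun l y hy v => ?_⟩
  have hN := (h.isCC l).isNorm ((extChartAt 𝓘(ℝ, V) x₀).symm y)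
  rcases eq_or_ne v 0 with rfl | hv
  · rw [(hN.eq_zero_iff 0).2 rfl]; simp
  have hv' : 0 < ‖v‖ := norm_pos_iff.2 hv
  have hmem : (l, y, ‖v‖⁻¹ • v) ∈ S := ⟨mem_univ _, hy, by simp [norm_smul, hv'.ne']⟩
  have h1 := hC₁ _ hmem
  have h2 := hC₂ _ hmem
  have h3 := hpos _ hmem
  simp only [Real.norm_eq_abs] at h1 h2
  rw [abs_of_pos h3] at h1
  rw [abs_of_pos (inv_pos.2 h3)] at h2
  simp only [hN.smul, abs_of_pos (inv_pos.2 hv')] at h1 h2 h3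
  set n := N l ((extChartAt 𝓘(ℝ, V) x₀).symm y) v
  have hn : 0 < n := by
    by_contra hcon
    have : ‖v‖⁻¹ * n ≤ 0 := mul_nonpos_of_nonneg_of_nonpos (by positivity) (not_lt.1 hcon)
    linarith
  have h4 : C₁ ≤ max 1 (max C₁ C₂) := (le_max_left _ _).trans (le_max_right _ _)
  have h5 : C₂ ≤ max 1 (max C₁ C₂) := (le_max_right _ _).trans (le_max_right _ _)
  constructor
  · have e : (‖v‖⁻¹ * n)⁻¹ = ‖v‖ / n := by field_simp
    rw [e] at h2
    exact (div_le_iff₀ hn).1 (h2.trans h5)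
  · have e : ‖v‖⁻¹ * n = n / ‖v‖ := by field_simp
    rw [e] at h1
    exact (div_le_iff₀ hv').1 (h1.trans h4)

theorem IsContinuouslyVaryingCC.exists_isChartModel (h : IsContinuouslyVaryingCC f N) (x₀ : M) :
    ∃ ρ > 0, ∃ A, ∃ X, IsChartModel f N x₀ X ρ A := by
  obtain ⟨ρ, hρ, C, hC, X, hsub, hX, heq⟩ := h.exists_cutoff x₀
  obtain ⟨A, hA, hAN⟩ := h.exists_norm_comparison (isCompact_closedBall _ ρ) hsub
  have hCB : C ≤ C + A + k * C := by
    have : 0 ≤ k * C := by positivity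
    linarith
  have hAB : A ≤ C + A + k * C := by
    have : 0 ≤ k * C := by positivity
    linarith
  have hkB : k * C ≤ C + A + k * C := by linarith
  refine ⟨ρ, hρ, C + A + k * C, X, by positivity, hsub, fun i => ⟨fun l => ?_, (hX i).continuous,
    (hX i).continuous_fderiv⟩, heq, fun l y hy v => ?_, fun l y hy v => ?_, fun l y v => ?_,
    fun l y y' v => ?_⟩
  · have := (hX i).bdd l
    exact ⟨this.differentiable, this.continuous_fderiv, fun y => (this.norm_le y).trans hCB,
      fun y => (this.fderiv_le y).trans hCB⟩
  · refine (hAN l y hy v).1.trans ?_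
    have := ((h.isCC l).isNorm ((extChartAt 𝓘(ℝ, V) x₀).symm y)).nonneg v
    gcongr
  · exact (hAN l y hy v).2.trans (by gcongr)
  · have h1 := norm_combField_sub_le (X := X l) (X' := fun _ _ => 0) (y := y) (y' := y) (ε := C)
      (fun i => by simpa using ((hX i).bdd l).norm_le y) v
    have h2 : combField (fun _ _ => (0 : V)) y v = 0 := by simp [combField]
    rw [h2, sub_zero] at h1
    exact h1.trans (by gcongr)
  · have h1 := norm_combField_sub_le (X := X l) (X' := X l) (y := y) (y' := y')
      (ε := C * ‖y - y'‖) (fun i => ((hX i).bdd l).norm_sub_le y y') v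
    calc _ ≤ _ := h1
      _ = k * C * ‖v‖ * ‖y - y'‖ := by ring
      _ ≤ _ := by gcongr

theorem IsChartModel.eventually_comb_close {x₀ : M} {X : Λ → Fin k → V → V} {ρ A : ℝ}
    (h : IsChartModel f N x₀ X ρ A) (l₀ : Λ) {ε : ℝ} (hε : 0 < ε) :
    ∀ᶠ l in 𝓝 l₀, ∀ y ∈ Metric.closedBall (extChartAt 𝓘(ℝ, V) x₀ x₀) ρ, ∀ v,
      ‖combField (X l) y v - combField (X l₀) y v‖ ≤ ε * ‖v‖ := by
  have h1 : ∀ i, ∀ᶠ l in 𝓝 l₀, ∀ y ∈ Metric.closedBall (extChartAt 𝓘(ℝ, V) x₀ x₀) ρ,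
      ‖X l i y - X l₀ i y‖ ≤ ε / (k + 1) := fun i => by
    obtain ⟨δ, hδ, h2⟩ := eventually_forall_norm_sub_le (g := fun l y => X l i y)
      (h.family i).continuous l₀
      (isCompact_closedBall (extChartAt 𝓘(ℝ, V) x₀ x₀) ρ) (ε := ε / (k + 1)) (by positivity)
    exact h2.mono fun l hl y hy => hl y hy y (by simpa using hδ.le)
  filter_upwards [eventually_all.2 h1] with l hl y hy v
  refine (norm_combField_sub_le (fun i => hl i y hy) v).trans ?_
  have : k * (ε / (k + 1)) ≤ ε := by
    rw [mul_div_assoc', div_le_iff₀ (by positivity)]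
    nlinarith
  gcongr

/-- Two base points are allowed because a curve and its shadow differ. On the unit sphere, uniform
convergence over the compact set handles the parameter and uniform continuity of `N l₀` handles the
points; homogeneity gives all `v`. -/
theorem IsContinuouslyVaryingCC.eventually_norm_close (h : IsContinuouslyVaryingCC f N) {x₀ : M}
    {B : Set V} (hB : IsCompact B) (hBt : B ⊆ (extChartAt 𝓘(ℝ, V) x₀).target) (l₀ : Λ)
    {ε : ℝ} (hε : 0 < ε) :
    ∃ δ > 0, ∀ᶠ l in 𝓝 l₀, ∀ y ∈ B, ∀ y' ∈ B, ‖y - y'‖ ≤ δ → ∀ v,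
      |N l ((extChartAt 𝓘(ℝ, V) x₀).symm y) v - N l₀ ((extChartAt 𝓘(ℝ, V) x₀).symm y') v|
        ≤ ε * ‖v‖ := by
  set F : Λ → V → CtrlSpace k → ℝ := fun l y v => N l ((extChartAt 𝓘(ℝ, V) x₀).symm y) v
  set S := B ×ˢ Metric.sphere (0 : CtrlSpace k) 1
  have hS : IsCompact S := hB.prod (isCompact_sphere 0 1)
  have hc := (continuousOn_norm_chart h x₀).mono
    (prod_mono (subset_refl univ) (prod_mono hBt (subset_univ _)) :
      (univ : Set Λ) ×ˢ S ⊆ _)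
  have h0 : ContinuousOn (fun z : V × CtrlSpace k => F l₀ z.1 z.2) S :=
    hc.comp (f := fun z : V × CtrlSpace k => (l₀, z)) (by fun_prop) fun z hz => ⟨mem_univ _, hz⟩
  have hu := hS.uniformContinuousOn_of_continuous h0
  rw [Metric.uniformContinuousOn_iff] at hu
  obtain ⟨δ, hδ, hu⟩ := hu (ε / 2) (by positivity)
  have h1 : ∀ᶠ l in 𝓝 l₀, ∀ z ∈ S, |F l z.1 z.2 - F l₀ z.1 z.2| ≤ ε / 2 := by
    have : ContinuousOn (fun z : Λ × V × CtrlSpace k => F z.1 z.2.1 z.2.2 - F l₀ z.2.1 z.2.2)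
        (univ ×ˢ S) := hc.sub (h0.comp continuousOn_snd fun z hz => hz.2)
    have h2 : ∀ z ∈ S, ∀ᶠ w : Λ × V × CtrlSpace k in 𝓝 l₀ ×ˢ 𝓝[S] z,
        |F w.1 w.2.1 w.2.2 - F l₀ w.2.1 w.2.2| ≤ ε / 2 := fun z hz => by
      have h3 := (this (l₀, z) ⟨mem_univ _, hz⟩).abs
      rw [ContinuousWithinAt, nhdsWithin_prod_eq, nhdsWithin_univ] at h3
      refine (h3.eventually_lt (tendsto_const_nhds (x := ε / 2)) ?_).mono fun _ h => le_of_lt h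
      simpa using hε
    have h4 : ∀ z ∈ S, ∃ t ∈ 𝓝[S] z, ∀ᶠ l in 𝓝 l₀, ∀ w ∈ t,
        |F l w.1 w.2 - F l₀ w.1 w.2| ≤ ε / 2 := fun z hz => by
      obtain ⟨pa, ha, pb, hb, hab⟩ := eventually_prod_iff.1 (h2 z hz)
      exact ⟨{w | pb w}, hb, ha.mono fun l hl w hw => hab hl hw⟩
    refine hS.induction_on (p := fun t => ∀ᶠ l in 𝓝 l₀, ∀ w ∈ t,
      |F l w.1 w.2 - F l₀ w.1 w.2| ≤ ε / 2) (by simp)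
      (fun s t hst ht => ht.mono fun l hl w hw => hl w (hst hw))
      (fun s t hs ht => by
        filter_upwards [hs, ht] with l h1 h2 w hw
        exact hw.elim (h1 w) (h2 w)) h4
  refine ⟨δ / 2, by positivity, h1.mono fun l hl y hy y' hy' hyy v => ?_⟩
  have hN := (h.isCC l).isNorm ((extChartAt 𝓘(ℝ, V) x₀).symm y)
  have hN' := (h.isCC l₀).isNorm ((extChartAt 𝓘(ℝ, V) x₀).symm y')
  rcases eq_or_ne v 0 with rfl | hv
  · rw [(hN.eq_zero_iff 0).2 rfl, (hN'.eq_zero_iff 0).2 rfl]; simp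
  have hv' : 0 < ‖v‖ := norm_pos_iff.2 hv
  have hmem : ‖v‖⁻¹ • v ∈ Metric.sphere (0 : CtrlSpace k) 1 := by simp [norm_smul, hv'.ne']
  have h2 := hl (y, ‖v‖⁻¹ • v) ⟨hy, hmem⟩
  have h3 := hu (y, ‖v‖⁻¹ • v) ⟨hy, hmem⟩ (y', ‖v‖⁻¹ • v) ⟨hy', hmem⟩ (by
    rw [Prod.dist_eq, dist_self, dist_eq_norm]
    exact max_lt (by linarith) hδ)
  rw [Real.dist_eq] at h3
  have h4 : |F l y (‖v‖⁻¹ • v) - F l₀ y' (‖v‖⁻¹ • v)| ≤ ε := by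
    refine (abs_sub_le _ (F l₀ y (‖v‖⁻¹ • v)) _).trans ?_
    simp only at h2 h3
    linarith
  simp only [F, hN.smul, hN'.smul, abs_of_pos (inv_pos.2 hv'), ← mul_sub, abs_mul] at h4
  rwa [inv_mul_le_iff₀ hv', mul_comm] at h4

end ChartModel

/-! ### Chow's theorem near a bracket-generating parameter -/

section Chow

variable {V : Type*} [NormedAddCommGroup V] [NormedSpace ℝ V] [FiniteDimensional ℝ V]
  {M : Type*} [TopologicalSpace M] [ChartedSpace V M] [IsManifold 𝓘(ℝ, V) ∞ M]
  {Λ : Type*} [TopologicalSpace Λ] {k : ℕ}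
  {f : Λ → (p : M) → CtrlSpace k →L[ℝ] TangentSpace 𝓘(ℝ, V) p}
  {N : Λ → M → CtrlSpace k → ℝ} {x₀ : M} {X : Λ → Fin k → V → V} {ρ A : ℝ}

/-- The trajectory is driven by the constant control `t • e_i`, and the smallness conditions keep it
in the ball where the model fields are the true ones. -/
theorem IsChartModel.ccDist_fieldFlow_le (hm : IsChartModel f N x₀ X ρ A)
    (h : IsContinuouslyVaryingCC f N) (l : Λ) (i : Fin k) {t : ℝ} {y : V}
    (hy : ‖y - extChartAt 𝓘(ℝ, V) x₀ x₀‖ + |t| * A ≤ ρ) (ht : |t| * A ≤ 1 / 2) :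
    ccDist (f l) (N l) ((extChartAt 𝓘(ℝ, V) x₀).symm y)
      ((extChartAt 𝓘(ℝ, V) x₀).symm (fieldFlow (X l i) t y)) ≤ ENNReal.ofReal (A * |t|) := by
  have : CompleteSpace V := FiniteDimensional.complete ℝ V
  have hZ := (hm.family i).bdd l
  have hT := hZ.isTrajectory ht y
  have hB : ∀ s ∈ Icc (0 : ℝ) 1, trajectory (X l i) t y s
      ∈ Metric.closedBall (extChartAt 𝓘(ℝ, V) x₀ x₀) ρ := fun s hs => by
    rw [mem_closedBall_iff_norm]
    have := hT.norm_sub_start_le hZ hs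
    linarith [norm_sub_le_norm_sub_add_norm_sub (trajectory (X l i) t y s) y
      (extChartAt 𝓘(ℝ, V) x₀ x₀)]
  have hctrl := (h.isCC l).isCtrlOn_extChartAt_symm (x₀ := x₀) (y := trajectory (X l i) t y)
    (u := fun _ => t • EuclideanSpace.single i (1 : ℝ)) (a := 0) (b := 1) (c := A * |t|)
    (R := |t|) hT.1.continuousOn (fun s hs => hm.subset (hB s hs)) aestronglyMeasurable_const
    (ae_of_all _ fun s => by simp [norm_smul]) (fun s hs s' hs' => ?_) ?_
  · have h1 := hctrl.ccDist_le_of_unit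
    rw [hT.apply_zero] at h1
    exact h1
  · have hi : ∀ a b, IntervalIntegrable (fun τ => t • X l i (trajectory (X l i) t y τ))
        volume a b := fun a b => hT.intervalIntegrable hZ.continuous _ _
    rw [hT.2 s hs, hT.2 s' hs', add_sub_add_left_eq_sub,
      intervalIntegral.integral_interval_sub_left (hi _ _) (hi _ _)]
    refine intervalIntegral.integral_congr fun τ hτ => ?_
    rw [hm.chartVelocity_eq l (hB τ (uIcc_subset_Icc hs hs' hτ)), combField_single]
  · refine (ae_restrict_iff' measurableSet_Icc).2 (ae_of_all _ fun s hs => ?_)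
    refine (hm.le_norm l _ (hB s hs) _).trans (le_of_eq ?_)
    simp [norm_smul]

theorem IsChartModel.ccDist_wordFlow_le (hm : IsChartModel f N x₀ X ρ A)
    (h : IsContinuouslyVaryingCC f N) (l : Λ) (w : List (Fin k × ℝ)) {y : V}
    (hy : ‖y - extChartAt 𝓘(ℝ, V) x₀ x₀‖ + wordCost w * A ≤ ρ) (hw : wordCost w * A ≤ 1 / 2) :
    ccDist (f l) (N l) ((extChartAt 𝓘(ℝ, V) x₀).symm y)
      ((extChartAt 𝓘(ℝ, V) x₀).symm (wordFlow (X l) w y)) ≤ ENNReal.ofReal (A * wordCost w) := by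
  have : CompleteSpace V := FiniteDimensional.complete ℝ V
  have hA := hm.pos
  induction w generalizing y with
  | nil => simp [ccDist_self (h.isCC l)]
  | cons p w ih =>
    rw [wordCost_cons, add_mul] at hw hy
    have h1 : 0 ≤ wordCost w * A := mul_nonneg (wordCost_nonneg w) hA.le
    have h2 : 0 ≤ |p.2| * A := by positivity
    have h3 := ((hm.family p.1).bdd l).flow_sub_le (t := p.2) (by linarith) y
    have h4 := hm.ccDist_fieldFlow_le h l p.1 (t := p.2) (y := y) (by linarith) (by linarith)
    have h5 := ih (y := fieldFlow (X l p.1) p.2 y) (by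
      linarith [norm_sub_le_norm_sub_add_norm_sub (fieldFlow (X l p.1) p.2 y) y
        (extChartAt 𝓘(ℝ, V) x₀ x₀)]) (by linarith)
    rw [wordFlow_cons, wordCost_cons, mul_add, ENNReal.ofReal_add (by positivity) (by linarith)]
    exact (ccDist_triangle (h.isCC l) _ _ _).trans (add_le_add h4 h5)

variable [CompactSpace Λ] {l₀ : Λ}

/-- Chow's theorem, uniformly in the structure. -/
theorem IsContinuouslyVaryingCC.eventually_ccDist_le (h : IsContinuouslyVaryingCC f N)
    (hgen : IsBracketGenerating
      (fun (i : Fin k) (p : M) => f l₀ p (EuclideanSpace.single i 1))) (x₀ : M) {ε : ℝ}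
    (hε : 0 < ε) :
    ∃ U ∈ 𝓝 x₀, ∀ᶠ l in 𝓝 l₀, ∀ p ∈ U, ∀ q ∈ U,
      ccDist (f l) (N l) p q ≤ ENNReal.ofReal ε := by
  have : CompleteSpace V := FiniteDimensional.complete ℝ V
  obtain ⟨ρ, hρ, A, X, hm⟩ := h.exists_isChartModel x₀
  have hA := hm.pos
  set n : ℝ := (Module.finrank ℝ V : ℝ)
  obtain ⟨κ, hκ, hκA, hκρ, hκε⟩ : ∃ κ > 0, κ * A ≤ 1 / 2 ∧ κ * A ≤ ρ / 2 ∧ A * κ ≤ ε := by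
    refine ⟨min (1 / 2) (min (ρ / 2) ε) / A, by positivity, ?_⟩
    rw [div_mul_cancel₀ _ hA.ne', mul_div_cancel₀ _ hA.ne']
    exact ⟨min_le_left _ _, (min_le_right _ _).trans (min_le_left _ _),
      (min_le_right _ _).trans (min_le_right _ _)⟩
  -- The joining words consist of `n` detours, each of cost at most `3 * η`. Their total stays below
  -- `κ`, which was chosen for existence of flows, confinement to the chart and the target `ε`.
  set η := κ / (3 * n + 1)
  have hn : 0 ≤ n := Nat.cast_nonneg _
  have hη0 : 0 < η := by positivity
  have hηκ : η ≤ κ := div_le_self hκ.le (by linarith)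
  have hnη : n * (3 * η) ≤ κ := by
    have : η * (3 * n + 1) = κ := div_mul_cancel₀ _ (by positivity)
    nlinarith
  have hηA : η * A ≤ κ * A := by gcongr
  have hspan : orbitSpan (X l₀) η (extChartAt 𝓘(ℝ, V) x₀ x₀) = ⊤ :=
    hgen.orbitSpan_eq_top (fun i => (h.isCC l₀).isSmoothField _) x₀
      (fun i => (hm.family i).bdd l₀) hA.le hη0 (hηA.trans hκA) Metric.isOpen_ball
      (fun z hz => by
        rw [mem_ball_iff_norm]
        linarith) (Metric.ball_subset_closedBall.trans hm.subset)
      (fun i => (hm.eqOn l₀ i).mono Metric.ball_subset_closedBall)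
  obtain ⟨U, hU, hev⟩ := eventually_exists_wordFlow_eq hm.family hA.le hη0 (hηA.trans hκA) l₀ hspan
  have hsrc : (extChartAt 𝓘(ℝ, V) x₀).source ∈ 𝓝 x₀ := extChartAt_source_mem_nhds x₀
  have hpre : extChartAt 𝓘(ℝ, V) x₀ ⁻¹' (U ∩ Metric.ball (extChartAt 𝓘(ℝ, V) x₀ x₀) (ρ / 2))
      ∈ 𝓝 x₀ :=
    (continuousAt_extChartAt x₀).preimage_mem_nhds
      (inter_mem hU (Metric.ball_mem_nhds _ (by positivity)))
  refine ⟨_, inter_mem hsrc hpre, hev.mono fun l hl p hp q hq => ?_⟩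
  obtain ⟨w, hw, hwq⟩ := hl _ hp.2.1 _ hq.2.1
  have hwκ := hw.trans hnη
  have hwA : wordCost w * A ≤ κ * A := by gcongr
  have hpρ := mem_ball_iff_norm.1 hp.2.2
  have h1 := hm.ccDist_wordFlow_le h l w (y := extChartAt 𝓘(ℝ, V) x₀ p) (by linarith)
    (hwA.trans hκA)
  rw [hwq, (extChartAt 𝓘(ℝ, V) x₀).left_inv hp.1, (extChartAt 𝓘(ℝ, V) x₀).left_inv hq.1] at h1
  refine h1.trans (ENNReal.ofReal_le_ofReal (le_trans ?_ hκε))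
  gcongr

/-- A Lebesgue number for a finite cover of `B` by balls on which the local statement holds gives
one `δ` for the whole compact set. -/
theorem IsContinuouslyVaryingCC.eventually_ccDist_le_of_norm_sub_le
    (h : IsContinuouslyVaryingCC f N) (hgen : IsBracketGenerating
      (fun (i : Fin k) (p : M) => f l₀ p (EuclideanSpace.single i 1))) {x₀ : M} {B : Set V}
    (hB : IsCompact B) (hBt : B ⊆ (extChartAt 𝓘(ℝ, V) x₀).target) {ε : ℝ} (hε : 0 < ε) :
    ∃ δ > 0, ∀ᶠ l in 𝓝 l₀, ∀ y ∈ B, ∀ z ∈ B, ‖y - z‖ ≤ δ →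
      ccDist (f l) (N l) ((extChartAt 𝓘(ℝ, V) x₀).symm y) ((extChartAt 𝓘(ℝ, V) x₀).symm z)
        ≤ ENNReal.ofReal ε := by
  have h1 : ∀ y ∈ B, ∃ r > 0, ∀ᶠ l in 𝓝 l₀, ∀ z ∈ Metric.ball y r, ∀ z' ∈ Metric.ball y r,
      ccDist (f l) (N l) ((extChartAt 𝓘(ℝ, V) x₀).symm z) ((extChartAt 𝓘(ℝ, V) x₀).symm z')
        ≤ ENNReal.ofReal ε := fun y hy => by
    obtain ⟨U, hU, hev⟩ := h.eventually_ccDist_le hgen ((extChartAt 𝓘(ℝ, V) x₀).symm y) hε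
    have hc : ContinuousAt (extChartAt 𝓘(ℝ, V) x₀).symm y :=
      (continuousOn_extChartAt_symm x₀).continuousAt
        ((isOpen_extChartAt_target x₀).mem_nhds (hBt hy))
    obtain ⟨r, hr, hrU⟩ := Metric.mem_nhds_iff.1 (hc.preimage_mem_nhds hU)
    exact ⟨r, hr, hev.mono fun l hl z hz z' hz' => hl _ (hrU hz) _ (hrU hz')⟩
  choose! r hr hev using h1
  obtain ⟨t, htB, ht⟩ := hB.elim_nhds_subcover (fun y => Metric.ball y (r y))
    fun y hy => Metric.ball_mem_nhds y (hr y hy)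
  obtain ⟨δ, hδ, hδt⟩ := lebesgue_number_lemma_of_metric (ι := t)
    (c := fun y => Metric.ball (y : V) (r y)) hB (fun _ => Metric.isOpen_ball) (by
      intro z hz
      obtain ⟨y, hy, hzy⟩ := mem_iUnion₂.1 (ht hz)
      exact mem_iUnion.2 ⟨⟨y, hy⟩, hzy⟩)
  refine ⟨δ / 2, by positivity, ?_⟩
  filter_upwards [(Finset.eventually_all t).2 fun y hy => hev y (htB y hy)] with l hl y hy z _ hyz
  obtain ⟨i, hi⟩ := hδt y hy
  refine hl i i.2 y (hi (Metric.mem_ball_self hδ)) z (hi ?_)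
  rw [mem_ball_iff_norm, norm_sub_rev]
  linarith

end Chow

/-! ### Short curves stay in the chart -/

section Comparison

variable {V : Type*} [NormedAddCommGroup V] [NormedSpace ℝ V] [FiniteDimensional ℝ V]
  {M : Type*} [TopologicalSpace M] [T2Space M] [ChartedSpace V M] [IsManifold 𝓘(ℝ, V) ∞ M]
  {Λ : Type*} [TopologicalSpace Λ] {k : ℕ}
  {f : Λ → (p : M) → CtrlSpace k →L[ℝ] TangentSpace 𝓘(ℝ, V) p}
  {N : Λ → M → CtrlSpace k → ℝ} {x₀ : M} {X : Λ → Fin k → V → V} {ρ A c : ℝ}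
  {u : ℝ → CtrlSpace k} {γ : ℝ → M} {y : V}

/-- Speed at most `c` bounds the control by `A * c`, hence the chart velocity by `A * (A * c)`. -/
theorem IsChartModel.norm_sub_le_of_mapsTo (hm : IsChartModel f N x₀ X ρ A)
    (h : IsContinuouslyVaryingCC f N) {l : Λ} (hγ : IsCtrlOn (f l) (N l) u γ 0 1 c) (hc : 0 ≤ c)
    {T : ℝ} (hT : T ∈ Icc (0 : ℝ) 1) (hmaps : ∀ t ∈ Icc 0 T, γ t ∈
      (extChartAt 𝓘(ℝ, V) x₀).symm '' Metric.closedBall (extChartAt 𝓘(ℝ, V) x₀ x₀) ρ) :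
    ‖extChartAt 𝓘(ℝ, V) x₀ (γ T) - extChartAt 𝓘(ℝ, V) x₀ (γ 0)‖ ≤ A * (A * c) := by
  have : CompleteSpace V := FiniteDimensional.complete ℝ V
  have hA := hm.pos
  have hB : ∀ t ∈ Icc 0 T, γ t ∈ (chartAt V x₀).source ∧ extChartAt 𝓘(ℝ, V) x₀ (γ t) ∈
      Metric.closedBall (extChartAt 𝓘(ℝ, V) x₀ x₀) ρ ∧
      (extChartAt 𝓘(ℝ, V) x₀).symm (extChartAt 𝓘(ℝ, V) x₀ (γ t)) = γ t := fun t ht => by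
    obtain ⟨z, hz, hzt⟩ := hmaps t ht
    have h1 := (extChartAt 𝓘(ℝ, V) x₀).map_target (hm.subset hz)
    have h2 := (extChartAt 𝓘(ℝ, V) x₀).right_inv (hm.subset hz)
    rw [← hzt, h2]
    rw [extChartAt_source] at h1
    exact ⟨h1, hz, rfl⟩
  have hγ' := hγ.mono (le_refl 0) hT.2
  rw [hγ'.sub_eq_integral (h.isCC l) hT.1 (fun t ht => (hB t ht).1) ⟨le_rfl, hT.1⟩
    ⟨hT.1, le_rfl⟩]
  have hbd := intervalIntegral.norm_integral_le_of_norm_le_const_ae (a := 0) (b := T)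
    (f := fun τ => chartVelocity (f l) x₀ (extChartAt 𝓘(ℝ, V) x₀ (γ τ)) (u τ))
    (C := A * (A * c)) ?_
  · refine hbd.trans ?_
    rw [sub_zero, abs_of_nonneg hT.1]
    exact mul_le_of_le_one_right (by positivity) hT.2
  · have hs := hγ'.speed
    rw [ae_restrict_iff' measurableSet_Icc] at hs
    filter_upwards [hs] with τ hτ hτ'
    rw [uIoc_of_le hT.1] at hτ'
    have hτm := Ioc_subset_Icc_self hτ'
    obtain ⟨h1, h2, h3⟩ := hB τ hτm
    have h4 := hm.norm_le l _ h2 (u τ)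
    rw [h3] at h4
    rw [hm.chartVelocity_eq l h2]
    refine (hm.comb_le l _ _).trans ?_
    have := hτ hτm
    have : A * N l (γ τ) (u τ) ≤ A * c := by gcongr
    gcongr
    linarith

/-- Curves of small speed stay in the chart. -/
theorem IsChartModel.mem_chart_of_isCtrlOn (hm : IsChartModel f N x₀ X ρ A)
    (h : IsContinuouslyVaryingCC f N) {l : Λ} (hγ : IsCtrlOn (f l) (N l) u γ 0 1 c) (hc : 0 ≤ c)
    (h0 : γ 0 = (extChartAt 𝓘(ℝ, V) x₀).symm y)
    (hy : ‖y - extChartAt 𝓘(ℝ, V) x₀ x₀‖ + A * (A * c) < ρ) {t : ℝ} (ht : t ∈ Icc (0 : ℝ) 1) :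
    γ t ∈ (extChartAt 𝓘(ℝ, V) x₀).source ∧ ‖extChartAt 𝓘(ℝ, V) x₀ (γ t) - y‖ ≤ A * (A * c) ∧
      extChartAt 𝓘(ℝ, V) x₀ (γ t) ∈ Metric.closedBall (extChartAt 𝓘(ℝ, V) x₀ x₀) ρ := by
  have hA := hm.pos
  have hAc : 0 ≤ A * (A * c) := by positivity
  set x := extChartAt 𝓘(ℝ, V) x₀ x₀
  set D := (extChartAt 𝓘(ℝ, V) x₀).symm '' Metric.closedBall x ρ with hD
  set G := (extChartAt 𝓘(ℝ, V) x₀).symm '' Metric.ball x ρ with hG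
  have hGD : G ⊆ D := image_mono Metric.ball_subset_closedBall
  -- The image of a compact ball is closed because `M` is Hausdorff. This rules out leaving the
  -- chart through a missing limit.
  have hDc : IsClosed D := ((isCompact_closedBall x ρ).image_of_continuousOn
    ((continuousOn_extChartAt_symm x₀).mono hm.subset)).isClosed
  have hGt : Metric.ball x ρ ⊆ (extChartAt 𝓘(ℝ, V) x₀).target :=
    Metric.ball_subset_closedBall.trans hm.subset
  have hGo : IsOpen G := by
    have : G = (extChartAt 𝓘(ℝ, V) x₀).source ∩ extChartAt 𝓘(ℝ, V) x₀ ⁻¹' Metric.ball x ρ :=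
      (extChartAt 𝓘(ℝ, V) x₀).symm.image_eq_target_inter_inv_preimage hGt
    rw [this]
    exact (continuousOn_extChartAt x₀).isOpen_inter_preimage (isOpen_extChartAt_source x₀)
      Metric.isOpen_ball
  have hyB : y ∈ Metric.ball x ρ := by rw [mem_ball_iff_norm]; linarith
  have hφ0 : extChartAt 𝓘(ℝ, V) x₀ (γ 0) = y := by
    rw [h0]; exact (extChartAt 𝓘(ℝ, V) x₀).right_inv (hGt hyB)
  have hall : ∀ t ∈ Icc (0 : ℝ) 1, γ t ∈ G := by
    by_contra! hcon
    obtain ⟨t₁, ht₁, hn⟩ := hcon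
    -- At the first exit time from the open image `G` the curve is still in `D`. The displacement
    -- estimate then puts it back into `G`, a contradiction.
    obtain ⟨T, ⟨hT, hTG⟩, hmin⟩ : ∃ T, IsLeast (Icc (0 : ℝ) 1 ∩ γ ⁻¹' Gᶜ) T :=
      (isCompact_Icc.of_isClosed_subset (hγ.cont.preimage_isClosed_of_isClosed isClosed_Icc
        hGo.isClosed_compl) inter_subset_left).exists_isLeast ⟨t₁, ht₁, hn⟩
    have hlt : ∀ s ∈ Ico 0 T, γ s ∈ G := fun s hs => by
      by_contra hsG
      exact absurd (hmin ⟨⟨hs.1, hs.2.le.trans hT.2⟩, hsG⟩) (not_le.2 hs.2)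
    have hT0 : 0 < T := lt_of_le_of_ne hT.1 fun h0' => hTG (by
      rw [← h0', h0]; exact mem_image_of_mem _ hyB)
    have hTD : γ T ∈ D := by
      have hcl : T ∈ closure (Ico 0 T) := by
        rw [closure_Ico hT0.ne]; exact ⟨hT.1, le_rfl⟩
      have := ((hγ.cont T hT).mono (fun s hs => ⟨hs.1, hs.2.le.trans hT.2⟩)).mem_closure hcl
        (fun s hs => hGD (hlt s hs) : MapsTo γ (Ico 0 T) D)
      rwa [hDc.closure_eq] at this
    have hmaps : ∀ s ∈ Icc 0 T, γ s ∈ D := fun s hs => by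
      rcases eq_or_lt_of_le hs.2 with rfl | hs'
      · exact hTD
      · exact hGD (hlt s ⟨hs.1, hs'⟩)
    have hest := hm.norm_sub_le_of_mapsTo h hγ hc hT hmaps
    rw [hφ0] at hest
    obtain ⟨z, hz, hzT⟩ := hTD
    have hz' : extChartAt 𝓘(ℝ, V) x₀ (γ T) = z := by
      rw [← hzT]; exact (extChartAt 𝓘(ℝ, V) x₀).right_inv (hm.subset hz)
    refine hTG ⟨z, ?_, hzT⟩
    rw [mem_ball_iff_norm]
    rw [hz'] at hest
    linarith [norm_sub_le_norm_sub_add_norm_sub z y x]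
  have hest := hm.norm_sub_le_of_mapsTo h hγ hc ht fun s hs =>
    hGD (hall s ⟨hs.1, hs.2.trans ht.2⟩)
  rw [hφ0] at hest
  obtain ⟨z, hz, hzt⟩ := hall t ht
  refine ⟨?_, hest, ?_⟩
  · rw [← hzt]; exact (extChartAt 𝓘(ℝ, V) x₀).map_target (hGt hz)
  · rw [← hzt, (extChartAt 𝓘(ℝ, V) x₀).right_inv (hGt hz)]
    exact Metric.ball_subset_closedBall hz

end Comparison

/-! ### Shadowing and local comparison of the distances -/

section LocalComparison

variable {V : Type*} [NormedAddCommGroup V] [NormedSpace ℝ V] [FiniteDimensional ℝ V]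
  {M : Type*} [TopologicalSpace M] [T2Space M] [ChartedSpace V M] [IsManifold 𝓘(ℝ, V) ∞ M]
  {Λ : Type*} [TopologicalSpace Λ] {k : ℕ}
  {f : Λ → (p : M) → CtrlSpace k →L[ℝ] TangentSpace 𝓘(ℝ, V) p}
  {N : Λ → M → CtrlSpace k → ℝ} {x₀ : M} {X : Λ → Fin k → V → V} {ρ A c : ℝ}
  {u : ℝ → CtrlSpace k} {γ : ℝ → M} {y : V}

/-- The integral equation is solved with bounds valid at every time, so the control is changed on a
null set. -/
theorem exists_bounded_representative {u : ℝ → CtrlSpace k} {μ : Measure ℝ} {R : ℝ} (hR : 0 ≤ R)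
    (hu : AEStronglyMeasurable u μ) (hb : ∀ᵐ t ∂μ, ‖u t‖ ≤ R) :
    ∃ v : ℝ → CtrlSpace k, StronglyMeasurable v ∧ (∀ t, ‖v t‖ ≤ R) ∧ ∀ᵐ t ∂μ, v t = u t := by
  refine ⟨{t | ‖hu.mk u t‖ ≤ R}.indicator (hu.mk u), hu.stronglyMeasurable_mk.indicator
    (measurableSet_le hu.stronglyMeasurable_mk.norm.measurable measurable_const), fun t => ?_, ?_⟩
  · by_cases ht : ‖hu.mk u t‖ ≤ R
    · rwa [indicator_of_mem (by exact ht)]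
    · rw [indicator_of_notMem (by exact ht)]; simpa
  · filter_upwards [hu.ae_eq_mk, hb] with t h1 h2
    rw [indicator_of_mem, h1]
    change ‖hu.mk u t‖ ≤ R
    rwa [← h1]

theorem IsChartModel.aestronglyMeasurable_combField (hm : IsChartModel f N x₀ X ρ A) (l : Λ)
    (hu : StronglyMeasurable u) {z : ℝ → V} (hz : Continuous z) (μ : Measure ℝ) :
    AEStronglyMeasurable (fun t => combField (X l) (z t) (u t)) μ := by
  have : (fun t => combField (X l) (z t) (u t)) = ∑ i, fun t => u t i • X l i (z t) := by
    ext t; simp [combField]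
  rw [this]
  refine Finset.aestronglyMeasurable_sum _ fun i _ => ?_
  exact ((EuclideanSpace.proj (𝕜 := ℝ) i).continuous.comp_aestronglyMeasurable
    hu.aestronglyMeasurable).smul
    ((((hm.family i).bdd l).continuous.comp hz).aestronglyMeasurable)

/-- A curve of small speed of the structure `a` is followed by a curve of a close structure `b`. -/
theorem IsChartModel.exists_shadow (hm : IsChartModel f N x₀ X ρ A)
    (h : IsContinuouslyVaryingCC f N) {a b : Λ} {ε κ δ : ℝ} (hε : 0 ≤ ε)
    (hκ : 0 ≤ κ) (hc : 0 ≤ c)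
    (hW : ∀ z ∈ Metric.closedBall (extChartAt 𝓘(ℝ, V) x₀ x₀) ρ, ∀ v,
      ‖combField (X a) z v - combField (X b) z v‖ ≤ ε * ‖v‖)
    (hN : ∀ z ∈ Metric.closedBall (extChartAt 𝓘(ℝ, V) x₀ x₀) ρ,
      ∀ z' ∈ Metric.closedBall (extChartAt 𝓘(ℝ, V) x₀ x₀) ρ, ‖z - z'‖ ≤ δ → ∀ v,
      |N a ((extChartAt 𝓘(ℝ, V) x₀).symm z) v - N b ((extChartAt 𝓘(ℝ, V) x₀).symm z') v|
        ≤ κ * ‖v‖)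
    (hγ : IsCtrlOn (f a) (N a) u γ 0 1 c) (h0 : γ 0 = (extChartAt 𝓘(ℝ, V) x₀).symm y)
    (hy : ‖y - extChartAt 𝓘(ℝ, V) x₀ x₀‖ + A * (A * c) < ρ) (hAc : A * (A * c) ≤ 1 / 2)
    (hδ : 2 * (ε * (A * c)) ≤ δ) :
    ∃ z ∈ Metric.closedBall (extChartAt 𝓘(ℝ, V) x₀ x₀) ρ,
      ‖extChartAt 𝓘(ℝ, V) x₀ (γ 1) - z‖ ≤ 2 * (ε * (A * c)) ∧
      ccDist (f b) (N b) (γ 0) ((extChartAt 𝓘(ℝ, V) x₀).symm z)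
        ≤ ENNReal.ofReal (c + κ * (A * c)) := by
  have : CompleteSpace V := FiniteDimensional.complete ℝ V
  have hA := hm.pos
  have hAc0 : 0 ≤ A * c := by positivity
  have hεAc : 0 ≤ ε * (A * c) := by positivity
  set x := extChartAt 𝓘(ℝ, V) x₀ x₀
  have hmem := fun (t : ℝ) (ht : t ∈ Icc (0 : ℝ) 1) => hm.mem_chart_of_isCtrlOn h hγ hc h0 hy ht
  have hinv := fun (t : ℝ) (ht : t ∈ Icc (0 : ℝ) 1) =>
    (extChartAt 𝓘(ℝ, V) x₀).left_inv (hmem t ht).1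
  have hsrc : MapsTo γ (Icc 0 1) (chartAt V x₀).source := fun t ht => by
    have := (hmem t ht).1
    rwa [extChartAt_source] at this
  have hyB : y ∈ Metric.closedBall x ρ := by rw [mem_closedBall_iff_norm]; nlinarith
  have hφ0 : extChartAt 𝓘(ℝ, V) x₀ (γ 0) = y := by
    rw [h0]; exact (extChartAt 𝓘(ℝ, V) x₀).right_inv (hm.subset hyB)
  have hub : ∀ᵐ t ∂(volume.restrict (Icc (0 : ℝ) 1)), ‖u t‖ ≤ A * c := by
    have hs := hγ.speed
    rw [ae_restrict_iff' measurableSet_Icc] at hs ⊢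
    filter_upwards [hs] with t ht htm
    have h1 := hm.norm_le a _ (hmem t htm).2.2 (u t)
    rw [hinv t htm] at h1
    exact h1.trans (by have := ht htm; gcongr)
  obtain ⟨v, hvm, hvb, hvu⟩ := exists_bounded_representative hAc0 hγ.meas hub
  have hGb : ∀ t z, ‖combField (X b) z (v t)‖ ≤ A * (A * c) := fun t z =>
    (hm.comb_le b z (v t)).trans (by have := hvb t; gcongr)
  have hGlip : ∀ t z z', ‖combField (X b) z (v t) - combField (X b) z' (v t)‖ ≤ ‖z - z'‖ / 2 :=
    fun t z z' => by
      refine (hm.comb_sub_le b z z' (v t)).trans ?_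
      have h1 : A * ‖v t‖ ≤ 1 / 2 := (mul_le_mul_of_nonneg_left (hvb t) hA.le).trans hAc
      nlinarith [norm_nonneg (z - z')]
  -- The shadow: the same control drives the fields of `b` from the same starting point.
  obtain ⟨z, hzc, hz⟩ := exists_integral_eq (G := fun t z => combField (X b) z (v t)) hGlip
    (fun t => hGb t 0) (fun z hz => hm.aestronglyMeasurable_combField b hvm hz _) y
  have hz0 : z 0 = y := by simpa using hz 0 (by simp)
  have hzi : ∀ s t, IntervalIntegrable (fun τ => combField (X b) (z τ) (v τ)) volume s t :=
    fun s t => by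
      have : IsFiniteMeasure (volume.restrict (uIoc s t)) := ⟨by simp [uIoc]⟩
      rw [intervalIntegrable_iff]
      exact ⟨hm.aestronglyMeasurable_combField b hvm hzc _,
        .of_bounded (C := A * (A * c)) (ae_of_all _ fun τ => hGb τ _)⟩
  have hzB : ∀ t ∈ Icc (0 : ℝ) 1, z t ∈ Metric.closedBall x ρ := fun t ht => by
    have h1 : ‖z t - y‖ ≤ A * (A * c) := by
      rw [hz t ht, add_sub_cancel_left]
      refine (intervalIntegral.norm_integral_le_of_norm_le_const
        fun τ _ => hGb τ (z τ)).trans ?_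
      rw [sub_zero, abs_of_nonneg ht.1]
      exact mul_le_of_le_one_right (by positivity) ht.2
    rw [mem_closedBall_iff_norm]
    linarith [norm_sub_le_norm_sub_add_norm_sub (z t) y x]
  obtain ⟨hcm, C, hC⟩ := (h.isCC a).chart_velocity_bounds hγ.cont hsrc hγ.meas hub
  -- The velocities differ by at most `ε * (A * c)`, from changing the structure, plus half the
  -- current distance, from changing the point.
  have hdist : ∀ t ∈ Icc (0 : ℝ) 1, ‖extChartAt 𝓘(ℝ, V) x₀ (γ t) - z t‖ ≤ 2 * (ε * (A * c)) := by
    have hcont : ContinuousOn (fun t => extChartAt 𝓘(ℝ, V) x₀ (γ t) - z t) (Icc 0 1) :=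
      ((continuousOn_extChartAt x₀).comp hγ.cont fun t ht => (hmem t ht).1).sub hzc.continuousOn
    have key := norm_le_of_integral_eq (a := (0 : V)) (δ := ε * (A * c)) hcont
      (g := fun τ => chartVelocity (f a) x₀ (extChartAt 𝓘(ℝ, V) x₀ (γ τ)) (u τ)
        - combField (X b) (z τ) (v τ)) (fun t ht => ?_) ?_
    · intro t ht
      have := key t ht
      rwa [norm_zero, zero_add, abs_of_nonneg hεAc] at this
    · rw [intervalIntegral.integral_sub (intervalIntegrable_of_ae_bound hcm hC (by simp) ht)
        (hzi _ _), ← hγ.sub_eq_integral (h.isCC a) zero_le_one hsrc (by simp) ht, hφ0, hz t ht]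
      abel
    · rw [ae_restrict_iff' measurableSet_Icc] at hvu hub ⊢
      filter_upwards [hvu, hub] with t h1 h2 ht
      have hB := (hmem t ht).2.2
      rw [h1 ht, hm.chartVelocity_eq a hB]
      have h3 := hW _ hB (u t)
      have h4 := hm.comb_sub_le b (extChartAt 𝓘(ℝ, V) x₀ (γ t)) (z t) (u t)
      have h5 : A * ‖u t‖ ≤ 1 / 2 := (mul_le_mul_of_nonneg_left (h2 ht) hA.le).trans hAc
      have h6 : ε * ‖u t‖ ≤ ε * (A * c) := mul_le_mul_of_nonneg_left (h2 ht) hε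
      have h7 := norm_sub_le_norm_sub_add_norm_sub
        (combField (X a) (extChartAt 𝓘(ℝ, V) x₀ (γ t)) (u t))
        (combField (X b) (extChartAt 𝓘(ℝ, V) x₀ (γ t)) (u t)) (combField (X b) (z t) (u t))
      nlinarith [norm_nonneg (extChartAt 𝓘(ℝ, V) x₀ (γ t) - z t)]
  refine ⟨z 1, hzB 1 (by simp), hdist 1 (by simp), ?_⟩
  have hctrl := (h.isCC b).isCtrlOn_extChartAt_symm (x₀ := x₀) (y := z) (u := v) (a := 0) (b := 1)
    (c := c + κ * (A * c)) hzc.continuousOn (fun t ht => hm.subset (hzB t ht))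
    hvm.aestronglyMeasurable (ae_of_all _ hvb) (fun s hs t ht => ?_) ?_
  · have h1 := hctrl.ccDist_le_of_unit
    rwa [hz0, ← h0] at h1
  · rw [hz s hs, hz t ht, add_sub_add_left_eq_sub,
      intervalIntegral.integral_interval_sub_left (hzi _ _) (hzi _ _)]
    refine intervalIntegral.integral_congr fun τ hτ => ?_
    exact (hm.chartVelocity_eq b (hzB τ (uIcc_subset_Icc hs ht hτ)) _).symm
  · have hs := hγ.speed
    rw [ae_restrict_iff' measurableSet_Icc] at hvu hub hs ⊢
    filter_upwards [hvu, hub, hs] with t h1 h2 h3 ht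
    have h4 := hN _ (hmem t ht).2.2 _ (hzB t ht) ((hdist t ht).trans hδ) (u t)
    rw [hinv t ht] at h4
    have h5 := (abs_le.1 h4).1
    have h6 : κ * ‖u t‖ ≤ κ * (A * c) := mul_le_mul_of_nonneg_left (h2 ht) hκ
    rw [h1 ht]
    linarith [h3 ht]

variable [CompactSpace Λ] {l₀ : Λ}

/-- Close to a point, the distances of close structures are close. -/
theorem IsContinuouslyVaryingCC.exists_local_comparison (h : IsContinuouslyVaryingCC f N)
    (hgen : IsBracketGenerating
      (fun (i : Fin k) (p : M) => f l₀ p (EuclideanSpace.single i 1))) (x₀ : M) :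
    ∃ U ∈ 𝓝 x₀, ∃ r > 0, ∀ ε > 0, ∀ᶠ l in 𝓝 l₀, ∀ p ∈ U, ∀ q,
      (ccDist (f l₀) (N l₀) p q < ENNReal.ofReal r →
        ccDist (f l) (N l) p q ≤ ccDist (f l₀) (N l₀) p q + ENNReal.ofReal ε) ∧
      (ccDist (f l) (N l) p q < ENNReal.ofReal r →
        ccDist (f l₀) (N l₀) p q ≤ ccDist (f l) (N l) p q + ENNReal.ofReal ε) := by
  have : CompleteSpace V := FiniteDimensional.complete ℝ V
  obtain ⟨ρ, hρ, A, X, hm⟩ := h.exists_isChartModel x₀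
  have hA := hm.pos
  set x := extChartAt 𝓘(ℝ, V) x₀ x₀ with hx
  have hBc : IsCompact (Metric.closedBall x ρ) := isCompact_closedBall x ρ
  -- The radius is fixed before `ε`. This allows the number of steps of a chain to be chosen first
  -- and the error per step afterwards.
  obtain ⟨r, hr, hr1, hrρ⟩ : ∃ r > 0, A * (A * r) ≤ 1 / 2 ∧ A * (A * r) ≤ ρ / 4 := by
    refine ⟨min (1 / 2) (ρ / 4) / (A * A), by positivity, ?_⟩
    have e : A * (A * (min (1 / 2) (ρ / 4) / (A * A))) = min (1 / 2) (ρ / 4) := by field_simp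
    rw [e]
    exact ⟨min_le_left _ _, min_le_right _ _⟩
  have hU : (extChartAt 𝓘(ℝ, V) x₀).source ∩ extChartAt 𝓘(ℝ, V) x₀ ⁻¹' Metric.ball x (ρ / 2)
      ∈ 𝓝 x₀ := inter_mem (extChartAt_source_mem_nhds x₀)
    ((continuousAt_extChartAt x₀).preimage_mem_nhds (Metric.ball_mem_nhds _ (by positivity)))
  refine ⟨_, hU, r, hr, fun ε hε => ?_⟩
  obtain ⟨δ, hδ, hchow⟩ := h.eventually_ccDist_le_of_norm_sub_le (l₀ := l₀) hgen hBc hm.subset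
    (ε := ε / 3) (by positivity)
  -- The error has three parts of size `ε / 3`: closing the gap between endpoints, the change of
  -- speed, and the excess of `c` over the distance `D`.
  obtain ⟨κ, hκ, hκε⟩ : ∃ κ > 0, κ * (A * r) ≤ ε / 3 :=
    ⟨ε / 3 / (A * r), by positivity, (div_mul_cancel₀ _ (by positivity)).le⟩
  obtain ⟨δ', hδ', hNc⟩ := h.eventually_norm_close hBc hm.subset l₀ hκ
  obtain ⟨ν, hν, hνδ⟩ : ∃ ν > 0, 2 * (ν * (A * r)) ≤ min δ δ' := by
    refine ⟨min δ δ' / (2 * (A * r)), by positivity, le_of_eq ?_⟩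
    field_simp
  -- The argument is symmetric in the two structures; it is applied to `(l₀, l)` and to `(l, l₀)`,
  -- with Chow's theorem for the second of the pair.
  have key : ∀ a b : Λ,
      (∀ z ∈ Metric.closedBall x ρ, ∀ v, ‖combField (X a) z v - combField (X b) z v‖ ≤ ν * ‖v‖) →
      (∀ z ∈ Metric.closedBall x ρ, ∀ z' ∈ Metric.closedBall x ρ, ‖z - z'‖ ≤ δ' → ∀ v,
        |N a ((extChartAt 𝓘(ℝ, V) x₀).symm z) v - N b ((extChartAt 𝓘(ℝ, V) x₀).symm z') v|
          ≤ κ * ‖v‖) →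
      (∀ y ∈ Metric.closedBall x ρ, ∀ z ∈ Metric.closedBall x ρ, ‖y - z‖ ≤ δ →
        ccDist (f b) (N b) ((extChartAt 𝓘(ℝ, V) x₀).symm y) ((extChartAt 𝓘(ℝ, V) x₀).symm z)
          ≤ ENNReal.ofReal (ε / 3)) →
      ∀ p ∈ (extChartAt 𝓘(ℝ, V) x₀).source ∩
        extChartAt 𝓘(ℝ, V) x₀ ⁻¹' Metric.ball x (ρ / 2), ∀ q,
        ccDist (f a) (N a) p q < ENNReal.ofReal r →
        ccDist (f b) (N b) p q ≤ ccDist (f a) (N a) p q + ENNReal.ofReal ε := by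
    intro a b hW hN hb p hp q hpq
    set D := (ccDist (f a) (N a) p q).toReal
    have hD : ccDist (f a) (N a) p q = ENNReal.ofReal D :=
      (ENNReal.ofReal_toReal (hpq.trans_le le_top).ne).symm
    have hD0 : 0 ≤ D := ENNReal.toReal_nonneg
    rw [hD] at hpq ⊢
    have hDr := (ENNReal.ofReal_lt_ofReal_iff hr).1 hpq
    obtain ⟨c, hDc, hcr, hcε⟩ : ∃ c, D < c ∧ c ≤ r ∧ c ≤ D + ε / 3 :=
      ⟨min r (D + ε / 3), lt_min hDr (by linarith), min_le_left _ _, min_le_right _ _⟩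
    have hc0 : 0 < c := hD0.trans_lt hDc
    obtain ⟨u, γ, hγ, rfl, rfl⟩ := exists_isCtrlOn_of_ccDist_lt (h.isCC a)
      (hD ▸ (ENNReal.ofReal_lt_ofReal_iff hc0).2 hDc)
    have hAc : A * c ≤ A * r := by gcongr
    have hAAc : A * (A * c) ≤ A * (A * r) := by gcongr
    have hp2 := mem_ball_iff_norm.1 hp.2
    have hy : ‖extChartAt 𝓘(ℝ, V) x₀ (γ 0) - x‖ + A * (A * c) < ρ := by linarith
    have h0 := ((extChartAt 𝓘(ℝ, V) x₀).left_inv hp.1).symm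
    have hνc : ν * (A * c) ≤ ν * (A * r) := by gcongr
    have hκc : κ * (A * c) ≤ κ * (A * r) := by gcongr
    obtain ⟨z, hzB, hz1, hz2⟩ := hm.exists_shadow h (ε := ν) (κ := κ) (δ := δ') hν.le hκ.le hc0.le
      hW hN hγ h0 hy (hAAc.trans hr1) (by linarith [min_le_right δ δ'])
    obtain ⟨hq1, -, hq2⟩ := hm.mem_chart_of_isCtrlOn h hγ hc0.le h0 hy (t := 1) (by simp)
    have h3 := hb z hzB _ hq2 (by
      rw [norm_sub_rev]; linarith [min_le_left δ δ'])
    rw [(extChartAt 𝓘(ℝ, V) x₀).left_inv hq1] at h3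
    refine (ccDist_triangle (h.isCC b) _ _ _).trans ((add_le_add hz2 h3).trans ?_)
    rw [← ENNReal.ofReal_add (by positivity) (by positivity), ← ENNReal.ofReal_add hD0 hε.le]
    exact ENNReal.ofReal_le_ofReal (by linarith)
  filter_upwards [hm.eventually_comb_close l₀ hν, hNc, hchow] with l h1 h2 h3 p hp q
  refine ⟨key l₀ l (fun z hz v => ?_) (fun z hz z' hz' hzz v => ?_) h3 p hp q,
    key l l₀ h1 h2 hchow.self_of_nhds p hp q⟩
  · rw [norm_sub_rev]; exact h1 z hz v
  · rw [abs_sub_comm]; exact h2 z' hz' z hz (by rwa [norm_sub_rev]) v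

end LocalComparison

/-! ### From local to global: compactness and chains -/

section Global

variable {V : Type*} [NormedAddCommGroup V] [NormedSpace ℝ V] [FiniteDimensional ℝ V]
  {M : Type*} [TopologicalSpace M] [T2Space M] [ChartedSpace V M] [IsManifold 𝓘(ℝ, V) ∞ M]
  {Λ : Type*} [TopologicalSpace Λ] [CompactSpace Λ] {k : ℕ}
  {f : Λ → (p : M) → CtrlSpace k →L[ℝ] TangentSpace 𝓘(ℝ, V) p}
  {N : Λ → M → CtrlSpace k → ℝ} {l₀ : Λ}

/-- A curve of small speed cannot leave a small chart ball, so points at small distance are close in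
the manifold, for every parameter. -/
theorem IsContinuouslyVaryingCC.exists_ccDist_ball_subset (h : IsContinuouslyVaryingCC f N)
    (l : Λ) {x : M} {U : Set M} (hU : U ∈ 𝓝 x) :
    ∃ ε : ℝ≥0∞, 0 < ε ∧ ∀ y, ccDist (f l) (N l) x y < ε → y ∈ U := by
  obtain ⟨ρ, hρ, A, X, hm⟩ := h.exists_isChartModel x
  have hA := hm.pos
  have hc : ContinuousAt (extChartAt 𝓘(ℝ, V) x).symm (extChartAt 𝓘(ℝ, V) x x) :=
    continuousAt_extChartAt_symm x
  obtain ⟨ρ', hρ', hsub⟩ := Metric.nhds_basis_closedBall.mem_iff.1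
    (hc.preimage_mem_nhds (by rwa [extChartAt_to_inv]))
  have hm' := hm.mono (min_le_left ρ ρ')
  have hpos : 0 < min ρ ρ' := lt_min hρ hρ'
  set c := min ρ ρ' / (2 * (A * A))
  have hc0 : 0 < c := by positivity
  have hAc : A * (A * c) < min ρ ρ' := by
    have : A * (A * c) = min ρ ρ' / 2 := by simp only [c]; field_simp
    linarith
  refine ⟨ENNReal.ofReal c, ENNReal.ofReal_pos.2 hc0, fun y hy => ?_⟩
  have : CompleteSpace V := FiniteDimensional.complete ℝ V
  obtain ⟨u, γ, hγ, h0, rfl⟩ := exists_isCtrlOn_of_ccDist_lt (h.isCC l) hy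
  obtain ⟨h1, -, h2⟩ := hm'.mem_chart_of_isCtrlOn h hγ hc0.le
    (y := extChartAt 𝓘(ℝ, V) x x) (by rw [h0, extChartAt_to_inv]) (by simpa using hAc)
    (t := 1) (by simp)
  have h3 := hsub (Metric.closedBall_subset_closedBall (min_le_right ρ ρ') h2)
  rwa [mem_preimage, (extChartAt 𝓘(ℝ, V) x).left_inv h1] at h3

/-- With this, sets compact for the distance are covered by finitely many manifold neighbourhoods.
-/
theorem IsContinuouslyVaryingCC.isOpen_distTopology (h : IsContinuouslyVaryingCC f N) (l : Λ)
    {U : Set M} (hU : IsOpen U) : IsOpen[distTopology (ccDist (f l) (N l))] U :=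
  fun _ hx => h.exists_ccDist_ball_subset l (hU.mem_nhds hx)

theorem isClosed_distTopology_closedBall {d : M → M → ℝ≥0∞} (hc : ∀ x y, d x y = d y x)
    (ht : ∀ x y z, d x z ≤ d x y + d y z) (x : M) (r : ℝ≥0∞) :
    IsClosed[distTopology d] {y | d x y ≤ r} := by
  refine @IsClosed.mk M (distTopology d) _ fun y hy => ?_
  have hy' : r < d x y := not_le.1 hy
  refine ⟨d x y - r, tsub_pos_of_lt hy', fun z hz hzr => ?_⟩
  have h1 : d x y ≤ d y z + r := by
    rw [add_comm, hc y z]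
    exact (ht x z y).trans (by gcongr; exact hzr)
  exact absurd hz (not_lt.2 (tsub_le_iff_right.2 h1))

/-- The step bound is required only at points of `S`. The induction keeps the chain in a ball
contained in `S`, so no confinement has to be known in advance. -/
theorem ccDist_chain_le {f : (p : M) → CtrlSpace k →L[ℝ] TangentSpace 𝓘(ℝ, V) p}
    {N : M → CtrlSpace k → ℝ} (hf : IsCCBundleStructure f N) {x : ℕ → M} {m : ℕ} {s : ℝ}
    (hs : 0 ≤ s) {S : Set M} (hS : ∀ z, ccDist f N (x 0) z ≤ ENNReal.ofReal (m * s) → z ∈ S)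
    (hstep : ∀ i < m, x i ∈ S → ccDist f N (x i) (x (i + 1)) ≤ ENNReal.ofReal s) :
    ∀ i ≤ m, ccDist f N (x 0) (x i) ≤ ENNReal.ofReal (i * s) := by
  have : CompleteSpace V := FiniteDimensional.complete ℝ V
  intro i
  induction i with
  | zero => simp [ccDist_self hf]
  | succ i ih =>
    intro hi
    have h1 := ih (by omega)
    have him : (i : ℝ) ≤ m := by exact_mod_cast (by omega : i ≤ m)
    have h2 : x i ∈ S := hS _ (h1.trans (ENNReal.ofReal_le_ofReal (by gcongr)))
    refine (ccDist_triangle hf _ (x i) _).trans ((add_le_add h1 (hstep i hi h2)).trans ?_)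
    rw [← ENNReal.ofReal_add (by positivity) hs]
    refine ENNReal.ofReal_le_ofReal ?_
    push_cast
    linarith

/-- Points joined by a path are at finite distance for a bracket-generating structure. -/
theorem IsContinuouslyVaryingCC.ccDist_lt_top_of_path (h : IsContinuouslyVaryingCC f N)
    (hgen : IsBracketGenerating
      (fun (i : Fin k) (p : M) => f l₀ p (EuclideanSpace.single i 1))) {γ : ℝ → M}
    (hγ : ContinuousOn γ (Icc 0 1)) : ccDist (f l₀) (N l₀) (γ 0) (γ 1) < ⊤ := by
  have : CompleteSpace V := FiniteDimensional.complete ℝ V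
  have hpre : IsPreconnected (γ '' Icc (0 : ℝ) 1) := isPreconnected_Icc.image γ hγ
  -- Finite distance is an equivalence relation whose classes are neighbourhoods of their points, by
  -- Chow's theorem; a connected set meets only one.
  refine hpre.induction₂ (fun p q => ccDist (f l₀) (N l₀) p q < ⊤) (fun x _ => ?_)
    (fun x y z _ _ _ hxy hyz =>
      (ccDist_triangle (h.isCC l₀) x y z).trans_lt (ENNReal.add_lt_top.2 ⟨hxy, hyz⟩))
    (fun x y _ _ hxy => by rwa [ccDist_comm (h.isCC l₀)])
    (mem_image_of_mem γ (by simp)) (mem_image_of_mem γ (by simp))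
  obtain ⟨U, hU, hev⟩ := h.eventually_ccDist_le hgen x one_pos
  filter_upwards [mem_nhdsWithin_of_mem_nhds hU] with y hy
  exact (hev.self_of_nhds x (mem_of_mem_nhds hU) y hy).trans_lt ENNReal.ofReal_lt_top

/-- A compact set is covered by finitely many balls for which the distance is bounded in each
finiteness class. -/
theorem IsContinuouslyVaryingCC.exists_finite_bound (h : IsContinuouslyVaryingCC f N)
    (hgen : IsBracketGenerating
      (fun (i : Fin k) (p : M) => f l₀ p (EuclideanSpace.single i 1))) {K : Set M}
    (hK : IsCompact K) :
    ∃ (t : Finset M) (D : ℝ), 0 ≤ D ∧ (∀ p ∈ K, ∃ a ∈ t, ccDist (f l₀) (N l₀) a p ≤ 1) ∧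
      ∀ p ∈ K, ∀ q ∈ K, ccDist (f l₀) (N l₀) p q < ⊤ →
        ccDist (f l₀) (N l₀) p q ≤ ENNReal.ofReal D := by
  have : CompleteSpace V := FiniteDimensional.complete ℝ V
  have h1 : ∀ x : M, ∃ U ∈ 𝓝 x, ∀ p ∈ U, ccDist (f l₀) (N l₀) x p ≤ 1 := fun x => by
    obtain ⟨U, hU, hev⟩ := h.eventually_ccDist_le hgen x one_pos
    exact ⟨U, hU, fun p hp => by
      simpa using hev.self_of_nhds x (mem_of_mem_nhds hU) p hp⟩
  choose U hU hUd using h1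
  obtain ⟨t, -, ht⟩ := hK.elim_nhds_subcover U fun x _ => hU x
  set d := ccDist (f l₀) (N l₀) with hd
  have hcov : ∀ p ∈ K, ∃ a ∈ t, d a p ≤ 1 := fun p hp => by
    obtain ⟨a, ha, hpa⟩ := mem_iUnion₂.1 (ht hp)
    exact ⟨a, ha, hUd a p hpa⟩
  have htri : ∀ x y z, d x z ≤ d x y + d y z := ccDist_triangle (h.isCC l₀)
  have hcomm : ∀ x y, d x y = d y x := ccDist_comm (h.isCC l₀)
  have hS : 0 ≤ ∑ a ∈ t, ∑ b ∈ t, (d a b).toReal :=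
    Finset.sum_nonneg fun _ _ => Finset.sum_nonneg fun _ _ => ENNReal.toReal_nonneg
  -- The two units are the steps from `p` and `q` to their centres. `toReal` replaces infinite
  -- distances between centres by zero, which is harmless: if `p` and `q` are at finite distance, so
  -- are their centres.
  refine ⟨t, 1 + ∑ a ∈ t, ∑ b ∈ t, (d a b).toReal + 1, by linarith, hcov, fun p hp q hq hpq => ?_⟩
  obtain ⟨a, ha, hap⟩ := hcov p hp
  obtain ⟨b, hb, hbq⟩ := hcov q hq
  rw [hcomm] at hbq
  have hab : d a b < ⊤ := by
    refine ((htri a p b).trans (add_le_add hap (htri p q b))).trans_lt ?_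
    exact ENNReal.add_lt_top.2 ⟨ENNReal.one_lt_top,
      ENNReal.add_lt_top.2 ⟨hpq, hbq.trans_lt ENNReal.one_lt_top⟩⟩
  have h2 : (d a b).toReal ≤ ∑ a ∈ t, ∑ b ∈ t, (d a b).toReal :=
    (Finset.single_le_sum (f := fun b => (d a b).toReal) (fun _ _ => ENNReal.toReal_nonneg)
      hb).trans (Finset.single_le_sum (f := fun a => ∑ b ∈ t, (d a b).toReal)
        (fun _ _ => Finset.sum_nonneg fun _ _ => ENNReal.toReal_nonneg) ha)
  have h3 : d a b ≤ ENNReal.ofReal (∑ a ∈ t, ∑ b ∈ t, (d a b).toReal) := by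
    rw [← ENNReal.ofReal_toReal hab.ne]
    exact ENNReal.ofReal_le_ofReal h2
  rw [ENNReal.ofReal_add (by linarith) one_pos.le, ENNReal.ofReal_add one_pos.le hS,
    ENNReal.ofReal_one]
  calc d p q ≤ d p a + d a q := htri _ _ _
    _ ≤ d p a + (d a b + d b q) := by gcongr; exact htri _ _ _
    _ ≤ 1 + (ENNReal.ofReal (∑ a ∈ t, ∑ b ∈ t, (d a b).toReal) + 1) := by
        rw [hcomm p a, hcomm b q]; gcongr
    _ = _ := by rw [add_assoc]

/-- The local comparison of distances, uniformly close to a compact set. -/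
theorem IsContinuouslyVaryingCC.exists_comparison_near (h : IsContinuouslyVaryingCC f N)
    (hgen : IsBracketGenerating
      (fun (i : Fin k) (p : M) => f l₀ p (EuclideanSpace.single i 1)))
    (hcompact : IsBoundedlyCompact (ccDist (f l₀) (N l₀))) (t : Finset M) (R : ℝ) :
    ∃ r > 0, ∀ ε > 0, ∀ᶠ l in 𝓝 l₀, ∀ a ∈ t, ∀ p,
      ccDist (f l₀) (N l₀) a p ≤ ENNReal.ofReal R → ∀ q,
      (ccDist (f l₀) (N l₀) p q < ENNReal.ofReal r →
        ccDist (f l) (N l) p q ≤ ccDist (f l₀) (N l₀) p q + ENNReal.ofReal ε) ∧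
      (ccDist (f l) (N l) p q < ENNReal.ofReal r →
        ccDist (f l₀) (N l₀) p q ≤ ccDist (f l) (N l) p q + ENNReal.ofReal ε) := by
  have : CompleteSpace V := FiniteDimensional.complete ℝ V
  choose U hU r hr hUr using h.exists_local_comparison (l₀ := l₀) hgen
  set d := ccDist (f l₀) (N l₀) with hd
  have htri : ∀ x y z, d x z ≤ d x y + d y z := ccDist_triangle (h.isCC l₀)
  have hcomm : ∀ x y, d x y = d y x := ccDist_comm (h.isCC l₀)
  -- Bounded compactness enters here: closed balls of finite radius are compact for `d`.
  have hball : ∀ a, @IsCompact M (distTopology d) {p | d a p ≤ ENNReal.ofReal R} := fun a => by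
    refine hcompact _ (isClosed_distTopology_closedBall hcomm htri a _)
      ⟨R.toNNReal + R.toNNReal, fun x hx y hy => ?_⟩
    push_cast
    refine (htri x a y).trans (add_le_add ?_ hy)
    rw [hcomm]; exact hx
  have hcov : ∀ a, ∃ s : Finset M, ∀ p, d a p ≤ ENNReal.ofReal R → ∃ x ∈ s, p ∈ U x := fun a => by
    obtain ⟨s, hs⟩ := @IsCompact.elim_finite_subcover M (distTopology d) _ M (hball a)
      (fun x => interior (U x)) (fun x => h.isOpen_distTopology l₀ isOpen_interior)
      (fun p _ => mem_iUnion.2 ⟨p, mem_interior_iff_mem_nhds.2 (hU p)⟩)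
    refine ⟨s, fun p hp => ?_⟩
    obtain ⟨x, hx, hpx⟩ := mem_iUnion₂.1 (hs hp)
    exact ⟨x, hx, interior_subset hpx⟩
  choose s hs using hcov
  -- A positive lower bound for finitely many radii, taken through a filter so that empty families
  -- need no separate treatment.
  have hrs : ∀ᶠ r' in 𝓝[>] (0 : ℝ), ∀ a ∈ t, ∀ x ∈ s a, r' ≤ r x :=
    (Finset.eventually_all t).2 fun a _ => (Finset.eventually_all (s a)).2 fun x _ =>
      mem_nhdsWithin_of_mem_nhds (Iic_mem_nhds (hr x))
  obtain ⟨r', hr', hr'0⟩ := (hrs.and self_mem_nhdsWithin).exists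
  refine ⟨r', hr'0, fun ε hε => ?_⟩
  have hev : ∀ᶠ l in 𝓝 l₀, ∀ a ∈ t, ∀ x ∈ s a, ∀ p ∈ U x, ∀ q,
      (d p q < ENNReal.ofReal (r x) → ccDist (f l) (N l) p q ≤ d p q + ENNReal.ofReal ε) ∧
      (ccDist (f l) (N l) p q < ENNReal.ofReal (r x) →
        d p q ≤ ccDist (f l) (N l) p q + ENNReal.ofReal ε) :=
    (Finset.eventually_all t).2 fun a _ => (Finset.eventually_all (s a)).2 fun x _ => hUr x ε hε
  filter_upwards [hev] with l hl a ha p hp q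
  obtain ⟨x, hx, hpx⟩ := hs a p hp
  have hle := ENNReal.ofReal_le_ofReal (hr' a ha x hx)
  exact ⟨fun h1 => (hl a ha x hx p hpx q).1 (h1.trans_le hle),
    fun h1 => (hl a ha x hx p hpx q).2 (h1.trans_le hle)⟩

end Global

/-- Continuity at `l₀` of the Carnot-Carathéodory distances of a continuously varying CC-bundle
structure, uniformly on compact sets. -/
theorem theoremC2 {V : Type*} [NormedAddCommGroup V] [NormedSpace ℝ V] [FiniteDimensional ℝ V]
    {M : Type*} [TopologicalSpace M] [T2Space M] [SecondCountableTopology M] [ChartedSpace V M]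
    [IsManifold 𝓘(ℝ, V) ∞ M]
    {Λ : Type*} [TopologicalSpace Λ] [CompactSpace Λ] {k : ℕ}
    (f : Λ → (p : M) → CtrlSpace k →L[ℝ] TangentSpace 𝓘(ℝ, V) p)
    (N : Λ → M → CtrlSpace k → ℝ) (hfN : IsContinuouslyVaryingCC f N) (l₀ : Λ)
    (hbracket : IsBracketGenerating
      (fun (i : Fin k) (p : M) => f l₀ p (EuclideanSpace.single i 1)))
    (hcompact : IsBoundedlyCompact (ccDist (f l₀) (N l₀))) :
    ∀ K : Set M, IsCompact K → ∀ ε : ℝ, 0 < ε → ∀ᶠ l in 𝓝 l₀, ∀ p ∈ K, ∀ q ∈ K,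
      ccDist (f l) (N l) p q ≤ ccDist (f l₀) (N l₀) p q + ENNReal.ofReal ε ∧
      ccDist (f l₀) (N l₀) p q ≤ ccDist (f l) (N l) p q + ENNReal.ofReal ε := by

  have : CompleteSpace V := FiniteDimensional.complete ℝ V
  intro K hK ε hε
  obtain ⟨t, D, hD, htK, hKD⟩ := hfN.exists_finite_bound hbracket hK
  set d := ccDist (f l₀) (N l₀) with hd
  have htri : ∀ x y z, d x z ≤ d x y + d y z := ccDist_triangle (hfN.isCC l₀)
  -- Chains start in `K`, within `1` of a centre, and travel at most `D + 2 * ε`. This slack exceeds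
  -- `D` because a chain for `l` may have length up to `D + 3 / 2 * ε` and picks up the error `ε /
  -- 2`.
  obtain ⟨r, hr, hcomp⟩ := hfN.exists_comparison_near hbracket hcompact t
    (1 + (D + 2 * ε))
  obtain ⟨m, hm⟩ := exists_nat_gt ((D + 2 * ε) / r)
  have hm0 : (0 : ℝ) < m := lt_of_le_of_lt (by positivity) hm
  have hm1 : 0 < m := by exact_mod_cast hm0
  have hmr : (D + 2 * ε) / m < r := by
    rw [div_lt_iff₀ hr] at hm
    rw [div_lt_iff₀ hm0]; linarith
  -- The number of steps `m` does not depend on `l`, so the errors of the steps add up to `ε / 2`.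
  filter_upwards [hcomp (ε / (2 * m)) (by positivity)] with l hl
  have hnear : ∀ p ∈ K, ∀ z, d p z ≤ ENNReal.ofReal (D + 2 * ε) →
      ∃ a ∈ t, d a z ≤ ENNReal.ofReal (1 + (D + 2 * ε)) := fun p hp z hz => by
    obtain ⟨a, ha, hap⟩ := htK p hp
    refine ⟨a, ha, (htri a p z).trans ?_⟩
    rw [ENNReal.ofReal_add one_pos.le (by positivity), ENNReal.ofReal_one]
    exact add_le_add hap hz
  have key : ∀ p ∈ K, ∀ q c, 0 < c → c ≤ D + 3 / 2 * ε →
      (d p q < ENNReal.ofReal c → ccDist (f l) (N l) p q ≤ ENNReal.ofReal (c + ε / 2)) ∧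
      (ccDist (f l) (N l) p q < ENNReal.ofReal c → d p q ≤ ENNReal.ofReal (c + ε / 2)) := by
    intro p hp q c hc hcD
    have hcm : c / m < r := lt_of_le_of_lt (by gcongr; linarith) hmr
    have hcm' : ENNReal.ofReal (c / m) < ENNReal.ofReal r := (ENNReal.ofReal_lt_ofReal_iff hr).2 hcm
    have hsum : ENNReal.ofReal (c / m) + ENNReal.ofReal (ε / (2 * m))
        = ENNReal.ofReal (c / m + ε / (2 * m)) :=
      (ENNReal.ofReal_add (by positivity) (by positivity)).symm
    have hms : m * (c / m + ε / (2 * m)) = c + ε / 2 := by field_simp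
    have hmc : m * (c / m) = c := by field_simp
    constructor
    · intro hpq
      obtain ⟨x, rfl, rfl, hx⟩ := exists_ccDist_chain (hfN.isCC l₀) hpq hm1
      have h1 := ccDist_chain_le (hfN.isCC l₀) (x := x) (m := m) (s := c / m) (S := univ)
        (by positivity) (fun _ _ => mem_univ _) (fun i hi _ => hx i hi)
      have h2 := ccDist_chain_le (hfN.isCC l) (x := x) (m := m) (s := c / m + ε / (2 * m))
        (S := univ) (by positivity) (fun _ _ => mem_univ _) (fun i hi _ => by
          have him : (i : ℝ) ≤ m := by exact_mod_cast hi.le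
          obtain ⟨a, ha, hax⟩ := hnear _ hp (x i) ((h1 i hi.le).trans
            (ENNReal.ofReal_le_ofReal (by
              have : i * (c / m) ≤ m * (c / m) := by gcongr
              linarith)))
          refine ((hl a ha (x i) hax (x (i + 1))).1 ((hx i hi).trans_lt hcm')).trans ?_
          rw [← hsum]
          gcongr
          exact hx i hi) m le_rfl
      rwa [hms] at h2
    · intro hpq
      -- This chain comes from a curve of the structure `l`. Its points are kept in the ball of `d`
      -- by the induction in `ccDist_chain_le`, where the comparison at one point yields the next.
      obtain ⟨x, rfl, rfl, hx⟩ := exists_ccDist_chain (hfN.isCC l) hpq hm1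
      have h2 := ccDist_chain_le (hfN.isCC l₀) (x := x) (m := m) (s := c / m + ε / (2 * m))
        (S := {z | d (x 0) z ≤ ENNReal.ofReal (D + 2 * ε)}) (by positivity)
        (fun z hz => hz.trans (ENNReal.ofReal_le_ofReal (by linarith)))
        (fun i hi hxi => by
          obtain ⟨a, ha, hax⟩ := hnear _ hp (x i) hxi
          refine ((hl a ha (x i) hax (x (i + 1))).2 ((hx i hi).trans_lt hcm')).trans ?_
          rw [← hsum]
          gcongr
          exact hx i hi) m le_rfl
      rwa [hms] at h2
  have hup : ∀ p ∈ K, ∀ q ∈ K,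
      ccDist (f l) (N l) p q ≤ d p q + ENNReal.ofReal ε := fun p hp q hq => by
    rcases eq_or_ne (d p q) ⊤ with htop | htop
    · simp [htop]
    have h1 := hKD p hp q hq (lt_top_iff_ne_top.2 htop)
    obtain ⟨E, hE, hdE⟩ : ∃ E : ℝ, 0 ≤ E ∧ d p q = ENNReal.ofReal E :=
      ⟨_, ENNReal.toReal_nonneg, (ENNReal.ofReal_toReal htop).symm⟩
    rw [hdE] at h1 ⊢
    have hED := (ENNReal.ofReal_le_ofReal_iff hD).1 h1
    refine ((key p hp q (E + ε / 2) (by positivity) (by linarith)).1 ?_).trans ?_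
    · rw [hdE]; exact (ENNReal.ofReal_lt_ofReal_iff (by positivity)).2 (by linarith)
    · rw [← ENNReal.ofReal_add hE hε.le]
      exact ENNReal.ofReal_le_ofReal (by linarith)
  intro p hp q hq
  refine ⟨hup p hp q hq, ?_⟩
  rcases eq_or_ne (ccDist (f l) (N l) p q) ⊤ with htop | htop
  · simp [htop]
  -- Finite distance for `l` provides a path, so `d p q` is finite and hence at most `D`. The upper
  -- estimate then bounds the distance for `l` by `D + ε`, within the range of `key`.
  obtain ⟨γ, hγ, h0, h1⟩ := exists_continuousOn_of_ccDist_lt_top (lt_top_iff_ne_top.2 htop)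
  have hfin : d p q < ⊤ := by
    rw [← h0, ← h1]
    exact hfN.ccDist_lt_top_of_path hbracket hγ
  have h2 := (hup p hp q hq).trans (add_le_add_left (hKD p hp q hq hfin) _)
  obtain ⟨E, hE, hdE⟩ : ∃ E : ℝ, 0 ≤ E ∧ ccDist (f l) (N l) p q = ENNReal.ofReal E :=
    ⟨_, ENNReal.toReal_nonneg, (ENNReal.ofReal_toReal htop).symm⟩
  rw [hdE, ← ENNReal.ofReal_add hD hε.le, ENNReal.ofReal_le_ofReal_iff (by positivity)] at h2
  rw [hdE]
  refine ((key p hp q (E + ε / 2) (by positivity) (by linarith)).2 ?_).trans ?_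
  · rw [hdE]; exact (ENNReal.ofReal_lt_ofReal_iff (by positivity)).2 (by linarith)
  · rw [← ENNReal.ofReal_add hE hε.le]
    exact ENNReal.ofReal_le_ofReal (by linarith)
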